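/- \textbf{Potentials.} A potential is a piecewise continuous function $u:\mathbb R\to\mathbb R$ that attains its maximum at a unique point $S(u)$; write $\mathcal M(u)=u(S(u))$. It is unimodal if it is nondecreasing on $(-\infty,S(u))$ and nonincreasing on $(S(u),\infty)$. Fix a finite speed $v>0$. For $w=(T,E,U)$ with $T\ge 0$, $E>0$, $0\le U\le 1$, and a potential $u$ with $x_*=S(u)$ and $\mathcal M=\mathcal M(u)$, let $z>0$ be the number with $\int_{x_*-z}^{x_*+z}(\mathcal M+T-u)\,dx=E$, put $a=\mathcal M+T-u(x_*-z)$, $b=\mathcal M+T-u(x_*+z)$, let $x^*=x_*-z$ if $U\le \frac a{a+b}$ and $x^*=x_*+z$ otherwise, and define $$(\mathcal H_w u)(x)=\begin{cases}\mathcal M+T+\frac zv, & x=x^*,\\ \mathcal M+T, & x\in[x_*-z,x_*+z],\ x\ne x^*,\\ u(x), &\text{otherwise.}\end{cases}$$ \textbf{The sequence of potentials.} Let $u_0$ be a unimodal potential with $S(u_0)=0$ and $\mathcal M(u_0)=0$, and let $\tau$ be a probability law on $[0,\infty)$ (the law of a service time). Let $w_n=(T_n,E_n,U_n)$, $n\ge1$,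 be i.i.d. with independent coordinates, where $T_n$ has law $\tau$, $E_n$ is standard exponential and $U_n$ is uniform on $[0,1]$. Put $u_n=\mathcal H_{w_n}(u_{n-1})$ for $n\ge 1$. \textbf{The greedy server.} At time $0$ the server starts serving a customer at $x=0$. The other customers present at time $0$ form a Poisson point process on $\mathbb R$ with intensity $-u_0(x)\,dx$, later customers arrive as a Poisson point process on $\mathbb R\times(0,\infty)$ with unit intensity $dx\,dt$, the service times are i.i.d. with law $\tau$, and these three objects are independent. A served customer leaves the system. At the end of each service the server chooses the nearest waiting customer, travels to it at speed $v$, ignoring new arrivals while in transit, and starts its service upon arrival. Let $\mathcal S_t$ be the position of the server at time $t$, and let $t_n$ be the time at which the $n$-th service after the initial one begins, $n\ge1$. \textbf{Lemma 2.} Almost surely the process $(\mathcal S_t)$ and the times $(t_n)$ exist, and the sequences $$\bigl(\mathcal M(u_n),S(u_n)\bigr)_{n=1,2,\dots}\qquad\text{and}\qquad \bigl(t_n,\mathcal S_{t_n}\bigr)_{n=1,2,\dots}$$ have the same distribution. -/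

import Mathlib

open MeasureTheory ProbabilityTheory Set Filter Topology
open scoped ENNReal NNReal

namespace GreedyServer

noncomputable section

/-! ### Potentials and the operators acting on them -/

/-- Piecewise continuity on the line: finitely many discontinuities in every bounded interval, and
finite one-sided limits everywhere. -/
def PiecewiseContinuous (u : ℝ → ℝ) : Prop :=
  (∀ a b : ℝ, {x ∈ Icc a b | ¬ ContinuousAt u x}.Finite) ∧
  (∀ x : ℝ, ∃ l : ℝ, Tendsto u (𝓝[<] x) (𝓝 l)) ∧
  (∀ x : ℝ, ∃ l : ℝ, Tendsto u (𝓝[>] x) (𝓝 l))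

/-- A potential: a piecewise continuous function that attains its maximum at exactly one point. -/
structure IsPotential (u : ℝ → ℝ) : Prop where
  piecewiseContinuous : PiecewiseContinuous u
  unique_max : ∃! x : ℝ, ∀ y : ℝ, u y ≤ u x

/-- `S(u)`, the point at which the potential `u` attains its maximum. -/
def peak (u : ℝ → ℝ) : ℝ := Classical.epsilon fun x : ℝ => ∀ y : ℝ, u y ≤ u x

/-- `M(u) = u(S(u))`, the maximal value of the potential `u`. -/
def height (u : ℝ → ℝ) : ℝ := u (peak u)

/-- A potential is unimodal if it is nondecreasing to the left and nonincreasing to the right of the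
point where it attains its maximum. -/
def IsUnimodal (u : ℝ → ℝ) : Prop :=
  MonotoneOn u (Iio (peak u)) ∧ AntitoneOn u (Ioi (peak u))

/-- A potential is centered if its maximum is attained at `0` and equals `0`. -/
def IsCentered (u : ℝ → ℝ) : Prop := peak u = 0 ∧ height u = 0

/-- The positive number `z` such that the integral of `M(u) + T - u` over
`[S(u) - z, S(u) + z]` equals `E`. -/
def radius (T E : ℝ) (u : ℝ → ℝ) : ℝ :=
  Classical.epsilon fun z : ℝ =>
    0 < z ∧ ∫ x in (peak u - z)..(peak u + z), (height u + T - u x) = E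

open Classical in
/-- The new position `x^*`: with `a = M(u) + T - u(S(u) - z)` and `b = M(u) + T - u(S(u) + z)` it is
`S(u) - z` if `U ≤ a / (a + b)` and `S(u) + z` otherwise. The triple is `w = (T, E, U)`. -/
def newPoint (w : ℝ × ℝ × ℝ) (u : ℝ → ℝ) : ℝ :=
  let z := radius w.1 w.2.1 u
  let a := height u + w.1 - u (peak u - z)
  let b := height u + w.1 - u (peak u + z)
  if w.2.2 ≤ a / (a + b) then peak u - z else peak u + z

open Classical in
/-- The operator `H_w`, `w = (T, E, U)`, for a server travelling at speed `v`. -/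
def step (v : ℝ) (w : ℝ × ℝ × ℝ) (u : ℝ → ℝ) : ℝ → ℝ := fun x =>
  let z := radius w.1 w.2.1 u
  if x = newPoint w u then height u + w.1 + z / v
  else if x ∈ Icc (peak u - z) (peak u + z) then height u + w.1
  else u x

/-- The sequence of potentials `u_0 = u₀`, `u_{n+1} = H_{w_n}(u_n)`. -/
def potentialSeq (v : ℝ) (u₀ : ℝ → ℝ) (w : ℕ → ℝ × ℝ × ℝ) : ℕ → ℝ → ℝ
  | 0 => u₀
  | n + 1 => step v (w n) (potentialSeq v u₀ w n)

/-! ### Poisson point processes, as random sets of points -/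

section Poisson

variable {Ω E : Type*} [MeasurableSpace E]

/-- The number of points of the random set `ξ` in `B`. -/
def count (ξ : Ω → Set E) (B : Set E) (ω : Ω) : ℕ∞ := (ξ ω ∩ B).encard

/-- The σ-algebra on `Ω` generated by the random set of points `ξ`, that is, by the numbers of its
points in measurable sets. -/
@[reducible] def pointSigma (ξ : Ω → Set E) : MeasurableSpace Ω :=
  ⨆ B : {B : Set E // MeasurableSet B}, MeasurableSpace.comap (count ξ B.1) ⊤

/-- `ξ` is a Poisson point process with intensity measure `μ` (the measure `μ` is meant to have no
atoms, so that the points are distinct): the number of points in a set of finite measure `μ B` is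
Poisson distributed with mean `μ B`, and the numbers of points in disjoint sets are independent. -/
structure IsPoissonProcess [MeasurableSpace Ω] (ξ : Ω → Set E) (μ : Measure E) (P : Measure Ω) :
    Prop where
  measurable_count : ∀ B : Set E, MeasurableSet B → Measurable (count ξ B)
  law_count : ∀ B : Set E, MeasurableSet B → μ B < ∞ →
    P.map (count ξ B) = (poissonMeasure (μ B).toNNReal).map (fun n : ℕ => (n : ℕ∞))
  indep_count : ∀ (n : ℕ) (B : Fin n → Set E), (∀ i, MeasurableSet (B i)) →
    Pairwise (fun i j => Disjoint (B i) (B j)) → iIndepFun (fun i => count ξ (B i)) P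

end Poisson

/-! ### The greedy server -/

/-- All customers, as pairs (position, arrival time). A customer who is waiting at time `0` gets
arrival time `0`. -/
def customers (init : Set ℝ) (arr : Set (ℝ × ℝ)) : Set (ℝ × ℝ) :=
  (fun x : ℝ => (x, (0 : ℝ))) '' init ∪ arr

/-- Customers waiting when the service number `n` ends (service `0` starts at time `0`): they have
arrived by that time, `t n + T n`, and are not among the customers `c 0, …, c (n - 1)`, who have
received services `1, …, n`. -/
def waiting (A : Set (ℝ × ℝ)) (T t : ℕ → ℝ) (c : ℕ → ℝ × ℝ) (n : ℕ) : Set (ℝ × ℝ) :=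
  {p ∈ A | p.2 ≤ t n + T n ∧ ∀ k < n, c k ≠ p}

/-- `𝒮 : [0, ∞) → ℝ` is the position of a greedy server of speed `v` facing the customers `A`.
Service number `n` starts at time `t n` and lasts `T n`; service `0` is that of a customer at the
origin. The customer chosen at the end of service `n`, to receive service `n + 1`, is `c n`. -/
structure IsGreedyServer (v : ℝ) (A : Set (ℝ × ℝ)) (T : ℕ → ℝ)
    (t : ℕ → ℝ) (c : ℕ → ℝ × ℝ) (𝒮 : ℝ → ℝ) : Prop where
  time_zero : t 0 = 0
  pos_zero : 𝒮 0 = 0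
  /-- the server does not move during a service -/
  serve : ∀ n, ∀ s ∈ Icc (t n) (t n + T n), 𝒮 s = 𝒮 (t n)
  /-- the customer to be served next is waiting -/
  next_waiting : ∀ n, c n ∈ waiting A T t c n
  /-- no waiting customer is nearer -/
  next_nearest : ∀ n, ∀ p ∈ waiting A T t c n, |(c n).1 - 𝒮 (t n)| ≤ |p.1 - 𝒮 (t n)|
  /-- the next service starts upon arrival at the chosen customer -/
  next_time : ∀ n, t (n + 1) = t n + T n + |(c n).1 - 𝒮 (t n)| / v
  /-- in between, the server travels toward the chosen customer at speed `v` -/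
  travel : ∀ n, ∀ s ∈ Icc (t n + T n) (t (n + 1)),
    𝒮 s = 𝒮 (t n) + (SignType.sign ((c n).1 - 𝒮 (t n)) : ℝ) * (v * (s - (t n + T n)))

end

end GreedyServer

/-! ### Laws from one-sided bounds, and countable partitions of small mesh. -/

namespace GreedyServer

/-! Plot customers in space-time, position against arrival time. The choices of the server reveal
customers only in an explored `region`: in each column within reach of a choice, everything below
the time of that choice. The potential records how high each column has been explored: almost
everywhere, the unexplored intensity over `s` up to a time `c` not before the current one is `c -
pot v u₀ σ n s` (`fiber_intensity`). Hence, when a service ends at time `c`, the nearest unexplored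
customer lies at distance more than `z` with probability `exp (-area z)`, and its position has
density `(c - u y) * exp (-area |y - x|)`. The operator produces the same density
(`IsPeaked.lintegral_newPoint`): `E = area z` makes the area exponential, and `U` picks a side in
the ratio of the endpoint intensities `a` and `b`.

To avoid conditioning on an explored region, whole paths are treated at once. A path of `n` service
times and customers should have density `exp (-intensity region)` on `pathSet` with respect to the
`n`-fold product of `τ` and the customer intensity. The proof needs only the upper bound for closed
sets of paths (`measure_pathEvent_le`), a Mecke-type inequality obtained from small cells.
Integrating out arrival times turns this density into `historyLaw` (`lintegral_pathSet`), which is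
also the law of the histories generated by the triples (`hasLaw_history`).

The upper bound suffices because both sides have total mass one: domination on closed sets forces
equality, and it even gives measurability of the server's path, which is an arbitrary selection
(`hasLaw_of_forall_isClosed_le`). Ties need no separate treatment either, as the explored region is
defined by strict inequalities.

Initial customers are placed at height `-1` rather than `0`. The strict inequality in `region` then
sees them even when the first service has length zero, and horizontal lines at times `c ≥ 0` are
null.

In both models, time and position are the same functions of the history (`isPeaked_pot`,
`IsGreedyServer.time_pos_eq`), so equality of the laws of finite histories yields equality of the
laws of the sequences. -/

/-- An arbitrary function whose outer law is dominated on closed sets by a probability measure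
is almost everywhere measurable and has that measure as its law. -/
theorem hasLaw_of_forall_isClosed_le {Ω S : Type*} [MeasurableSpace Ω] {P : Measure Ω}
    [IsProbabilityMeasure P] [TopologicalSpace S] [TopologicalSpace.PseudoMetrizableSpace S]
    [MeasurableSpace S] [BorelSpace S] [MeasurableSpace.CountablyGenerated S]
    [MeasurableSpace.SeparatesPoints S] [Nonempty S]
    {W : Measure S} [IsProbabilityMeasure W] {X : Ω → S}
    (h : ∀ F : Set S, IsClosed F → P (X ⁻¹' F) ≤ W F) : HasLaw X W P := by
  let := TopologicalSpace.pseudoMetrizableSpacePseudoMetric S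
  -- Open sets are increasing unions of closed sets, and continuity of `P` from below holds for sets
  -- that are not known to be measurable. Outer regularity of `W` then extends the bound to all
  -- sets.
  have hopen : ∀ U : Set S, IsOpen U → P (X ⁻¹' U) ≤ W U := by
    intro U hU
    obtain ⟨F, hF, hFU, hUn, hmono⟩ := hU.exists_iUnion_isClosed
    have : X ⁻¹' U = ⋃ n, X ⁻¹' (F n) := by rw [← preimage_iUnion, hUn]
    rw [this, Monotone.measure_iUnion (fun i j hij => preimage_mono (hmono hij))]
    exact iSup_le fun n => (h _ (hF n)).trans (measure_mono (hFU n))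
  have hmeas : ∀ B : Set S, P (X ⁻¹' B) ≤ W B := by
    intro B
    rw [B.measure_eq_iInf_isOpen W]
    exact le_iInf₂ fun U hBU => le_iInf fun hU =>
      (measure_mono (preimage_mono hBU)).trans (hopen U hU)
  have hnull : ∀ B : Set S, MeasurableSet B → NullMeasurableSet (X ⁻¹' B) P ∧
      P (X ⁻¹' B) = W B := by
    intro B hB
    have h1 := hmeas B
    have h2 := hmeas Bᶜ
    -- Subadditivity bounds the sum for `B` and its complement below by one, while the two upper
    -- bounds add up to one; so both are equalities.
    have h3 : (1 : ℝ≥0∞) ≤ P (X ⁻¹' B) + P (X ⁻¹' B)ᶜ := by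
      rw [← measure_univ (μ := P), ← union_compl_self (X ⁻¹' B)]
      exact measure_union_le _ _
    have h4 : W B + W Bᶜ = 1 := by rw [measure_add_measure_compl hB, measure_univ]
    have hfin : W Bᶜ ≠ ∞ := measure_ne_top _ _
    have heq : P (X ⁻¹' B) = W B := by
      refine le_antisymm h1 ?_
      have : W B + W Bᶜ ≤ P (X ⁻¹' B) + W Bᶜ := by
        rw [h4]; exact h3.trans (by gcongr; exact h2)
      exact (ENNReal.add_le_add_iff_right hfin).1 this
    have heq' : P (X ⁻¹' B)ᶜ = W Bᶜ := by
      refine le_antisymm h2 ?_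
      have : W B + W Bᶜ ≤ W B + P (X ⁻¹' B)ᶜ := by
        rw [h4]; exact h3.trans (by rw [heq])
      exact (ENNReal.add_le_add_iff_left (measure_ne_top _ _)).1 this
    refine ⟨?_, heq⟩
    -- The measurable hulls of the preimage and of its complement cover the space and have total
    -- mass one. Their overlap is therefore null, and the preimage is null measurable.
    have hM : P (toMeasurable P (X ⁻¹' B)) + P (toMeasurable P (X ⁻¹' B)ᶜ) = 1 := by
      rw [measure_toMeasurable, measure_toMeasurable, heq, heq', h4]
    set M := toMeasurable P (X ⁻¹' B)
    set N := toMeasurable P (X ⁻¹' B)ᶜ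
    have hsub : X ⁻¹' B ⊆ M := subset_toMeasurable _ _
    have hsub' : (X ⁻¹' B)ᶜ ⊆ N := subset_toMeasurable _ _
    have hMm : MeasurableSet M := measurableSet_toMeasurable _ _
    have hNm : MeasurableSet N := measurableSet_toMeasurable _ _
    have hcap : P (M ∩ N) = 0 := by
      have h5 := measure_union_add_inter M hNm (μ := P)
      have h6 : M ∪ N = univ := by
        ext x; simp only [mem_union, mem_univ, iff_true]
        by_cases hx : x ∈ X ⁻¹' B
        · exact Or.inl (hsub hx)
        · exact Or.inr (hsub' hx)
      rw [h6, measure_univ, hM] at h5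
      have : (1 : ℝ≥0∞) + P (M ∩ N) = 1 + 0 := by rw [h5, add_zero]
      exact (ENNReal.add_right_inj ENNReal.one_ne_top).1 this
    refine ⟨M, hMm, ?_⟩
    refine (hsub.eventuallyLE).antisymm ?_
    refine (ae_le_set.2 (measure_mono_null ?_ hcap))
    intro x hx
    exact ⟨hx.1, hsub' hx.2⟩
  have hae : AEMeasurable X P :=
    NullMeasurable.aemeasurable (fun B hB => (hnull B hB).1)
  refine ⟨hae, ?_⟩
  ext B hB
  rw [Measure.map_apply_of_aemeasurable hae hB, (hnull B hB).2]

/-- A separable metric space has countable measurable partitions of arbitrarily small mesh. -/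
theorem exists_measurable_code (X : Type*) [PseudoMetricSpace X] [SecondCountableTopology X]
    [Nonempty X] [MeasurableSpace X] [OpensMeasurableSpace X] {ε : ℝ} (hε : 0 < ε) :
    ∃ d : X → ℕ, Measurable d ∧ ∀ x y, d x = d y → dist x y < ε := by
  classical
  have hex : ∀ x : X, ∃ n, dist x (TopologicalSpace.denseSeq X n) < ε / 2 := fun x =>
    (TopologicalSpace.denseRange_denseSeq X).exists_dist_lt x (half_pos hε)
  -- The code is the index of the first point of a dense sequence at distance less than `ε / 2`.
  refine ⟨fun x => Nat.find (hex x), measurable_find _ fun n => ?_, fun x y hxy => ?_⟩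
  · exact (isOpen_lt (continuous_id.dist continuous_const) continuous_const).measurableSet
  · have h1 := Nat.find_spec (hex x)
    have h2 := Nat.find_spec (hex y)
    simp only at hxy
    rw [← hxy] at h2
    have := dist_triangle_right x y (TopologicalSpace.denseSeq X (Nat.find (hex x)))
    linarith

end GreedyServer

/-! ### A Mecke-type upper bound for paths of points with a void region. -/

namespace GreedyServer

section Mecke

variable {Ω E ι : Type*} [MeasurableSpace Ω] [MeasurableSpace E]

/-- The configurations for which there are distinct points `p i` of `A`, that together with the
marks `T i` lie in `K`, and such that `A` has no other points in the section of `R` at `(T, p)`. -/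
def pathEvent (A : Ω → Set E) (T : ι → Ω → ℝ) (K : Set (ι → ℝ × E)) (R : Set ((ι → ℝ × E) × E)) :
    Set Ω :=
  {ω | ∃ p : ι → E, (∀ i, p i ∈ A ω) ∧ Function.Injective p ∧ (fun i => (T i ω, p i)) ∈ K ∧
    ∀ q ∈ A ω, ((fun i => (T i ω, p i)), q) ∈ R → ∃ i, q = p i}

/-- `e^{-x}` as a function on `[0, ∞]`, with values in `[0, ∞]`. -/
noncomputable def expNeg (x : ℝ≥0∞) : ℝ≥0∞ := ENNReal.ofReal (Real.exp (-x.toReal))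

theorem expNeg_le_one (x : ℝ≥0∞) : expNeg x ≤ 1 := by
  rw [expNeg, ENNReal.ofReal_le_one, Real.exp_le_one_iff]
  simp

theorem expNeg_add {x y : ℝ≥0∞} (hx : x ≠ ∞) (hy : y ≠ ∞) :
    expNeg (x + y) = expNeg x * expNeg y := by
  rw [expNeg, expNeg, expNeg, ← ENNReal.ofReal_mul (Real.exp_pos _).le, ← Real.exp_add,
    ENNReal.toReal_add hx hy]
  ring_nf

theorem measurable_expNeg : Measurable expNeg := by
  unfold expNeg; fun_prop

/-- The cell discretization of the section of `R`. -/
def cellRegion (d₁ : ℝ → ℕ) (d₂ : E → ℕ) (R : Set ((ι → ℝ × E) × E)) (s : Set E)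
    (c : ι → ℕ × ℕ) : Set E :=
  s ∩ d₂ ⁻¹' {j | (∀ i, j ≠ (c i).2) ∧ ∀ h : ι → ℝ × E, (∀ i, (d₁ (h i).1, d₂ (h i).2) = c i) →
    ∀ q, d₂ q = j → (h, q) ∈ R}

theorem measurableSet_cellRegion {d₁ : ℝ → ℕ} {d₂ : E → ℕ} (hd₂ : Measurable d₂)
    (R : Set ((ι → ℝ × E) × E)) {s : Set E} (hs : MeasurableSet s) (c : ι → ℕ × ℕ) :
    MeasurableSet (cellRegion d₁ d₂ R s c) :=
  hs.inter (hd₂ (MeasurableSet.of_discrete))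

variable [Fintype ι] [MetricSpace E] [BorelSpace E]

/-- The cell regions approximate the section from inside. Openness of `R` puts each point of the
section into them eventually, unless it is one of the points `(h i).2`, and those are null.
Finiteness of the section supplies the domination. -/
theorem tendsto_measure_cellRegion {μ : Measure E} [NullSingletonClass μ]
    {d₁ : ℕ → ℝ → ℕ} {d₂ : ℕ → E → ℕ}
    (hd₂ : ∀ m, Measurable (d₂ m))
    (hd₁' : ∀ m x y, d₁ m x = d₁ m y → dist x y < 1 / ((m : ℝ) + 1))
    (hd₂' : ∀ m x y, d₂ m x = d₂ m y → dist x y < 1 / ((m : ℝ) + 1))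
    {R : Set ((ι → ℝ × E) × E)} (hR : IsOpen R) (h : ι → ℝ × E) (hfin : μ {q | (h, q) ∈ R} ≠ ∞)
    (o : E) :
    Tendsto (fun m : ℕ => μ (cellRegion (d₁ m) (d₂ m) R (Metric.closedBall o m)
      fun i => (d₁ m (h i).1, d₂ m (h i).2))) atTop (𝓝 (μ {q | (h, q) ∈ R})) := by
  have hRm : MeasurableSet {q | (h, q) ∈ R} :=
    (hR.preimage (by fun_prop : Continuous fun q : E => (h, q))).measurableSet
  refine tendsto_measure_of_ae_tendsto_indicator (B := {q | (h, q) ∈ R}) atTop hRm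
    (fun m => measurableSet_cellRegion (hd₂ m) R measurableSet_closedBall _) hRm hfin
    (Eventually.of_forall fun m q hq => hq.2.2 h (fun _ => rfl) q rfl) ?_
  have hp : ∀ᵐ q ∂μ, ∀ i, q ≠ (h i).2 := by
    rw [ae_all_iff]
    intro i
    simp [ae_iff]
  filter_upwards [hp] with q hq
  by_cases hqR : (h, q) ∈ R
  · obtain ⟨ε, hε, hball⟩ := Metric.isOpen_iff.1 hR _ hqR
    have h1 : ∀ᶠ m : ℕ in atTop, 1 / ((m : ℝ) + 1) < ε :=
      (tendsto_order.1 tendsto_one_div_add_atTop_nhds_zero_nat).2 _ hε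
    have h2 : ∀ᶠ m : ℕ in atTop, dist q o ≤ m :=
      (tendsto_natCast_atTop_atTop (R := ℝ)).eventually_ge_atTop _
    have h3 : ∀ᶠ m : ℕ in atTop, ∀ i, 1 / ((m : ℝ) + 1) < dist q (h i).2 := by
      rw [eventually_all]
      intro i
      exact (tendsto_order.1 tendsto_one_div_add_atTop_nhds_zero_nat).2 _ (dist_pos.2 (hq i))
    filter_upwards [h1, h2, h3] with m h1 h2 h3
    refine iff_of_true ⟨h2, ?_, ?_⟩ hqR
    · intro i hi
      exact lt_asymm (h3 i) (hd₂' m _ _ hi)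
    · intro h' hh' q' hq'
      refine hball ?_
      rw [Metric.mem_ball, Prod.dist_eq]
      refine max_lt ?_ ((hd₂' m _ _ hq').trans h1)
      refine (dist_pi_lt_iff hε).2 fun i => ?_
      rw [Prod.dist_eq]
      have := Prod.ext_iff.1 (hh' i)
      exact max_lt ((hd₁' m _ _ this.1).trans h1) ((hd₂' m _ _ this.2).trans h1)
  · exact Eventually.of_forall fun m =>
      iff_of_false (fun hm => hqR (hm.2.2 h (fun _ => rfl) q rfl)) hqR

variable [ProperSpace E] {P : Measure Ω} {τ : Measure ℝ} [IsProbabilityMeasure τ] {μ : Measure E}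
  [IsLocallyFiniteMeasure μ]

/-- Upper bound for the probability that some points in a grid of cells form a path. -/
theorem measure_pathEvent_le_lintegral_cell {A : Ω → Set E} {T : ι → Ω → ℝ}
    (hA : ∀ (J : ι → Set ℝ) (C : ι → Set E) (D : Set E), (∀ i, MeasurableSet (J i)) →
      (∀ i, MeasurableSet (C i)) → MeasurableSet D → (∀ i, μ (C i) ≠ ∞) → μ D ≠ ∞ →
      Pairwise (fun i j => Disjoint (C i) (C j)) → (∀ i, Disjoint (C i) D) →
      P {ω | (∀ i, T i ω ∈ J i) ∧ (∀ i, (A ω ∩ C i).Nonempty) ∧ A ω ∩ D = ∅} ≤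
        (∏ i, τ (J i) * μ (C i)) * expNeg (μ D))
    {d₁ : ℝ → ℕ} {d₂ : E → ℕ} (hd₁ : Measurable d₁) (hd₂ : Measurable d₂) {ε : ℝ}
    (hd₂' : ∀ x y, d₂ x = d₂ y → dist x y < ε)
    {K : Set (ι → ℝ × E)} (hK : ∀ h ∈ K, ∀ i j, i ≠ j → ε ≤ dist (h i).2 (h j).2)
    (R : Set ((ι → ℝ × E) × E)) (o : E) (r : ℝ) :
    P (pathEvent A T K R) ≤
      ∫⁻ h, {h | ∃ h' ∈ K, ∀ i, (d₁ (h' i).1, d₂ (h' i).2) = (d₁ (h i).1, d₂ (h i).2)}.indicator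
        (fun h => expNeg (μ (cellRegion d₁ d₂ R (Metric.closedBall o r)
          fun i => (d₁ (h i).1, d₂ (h i).2)))) h ∂(Measure.pi fun _ : ι => τ.prod μ) := by
  classical
  let code : (ι → ℝ × E) → (ι → ℕ × ℕ) := fun h i => (d₁ (h i).1, d₂ (h i).2)
  have hcode : Measurable code := by
    refine measurable_pi_lambda _ fun i => ?_
    exact (hd₁.comp (measurable_fst.comp (measurable_pi_apply i))).prodMk
      (hd₂.comp (measurable_snd.comp (measurable_pi_apply i)))
  let G : Set (ι → ℕ × ℕ) := {c | ∃ h' ∈ K, code h' = c}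
  let D : (ι → ℕ × ℕ) → Set E := cellRegion d₁ d₂ R (Metric.closedBall o r)
  let Ev : (ι → ℕ × ℕ) → Set Ω := fun c =>
    {ω | (∀ i, T i ω ∈ d₁ ⁻¹' {(c i).1}) ∧ (∀ i, (A ω ∩ d₂ ⁻¹' {(c i).2}).Nonempty) ∧
      A ω ∩ D c = ∅}
  -- A customer in the cell region would have to be one of the `p i`, but the region omits the cells
  -- of the path itself.
  have hsub : pathEvent A T K R ⊆ ⋃ c ∈ G, Ev c := by
    rintro ω ⟨p, hpA, -, hpK, hpR⟩
    refine mem_iUnion₂.2 ⟨code fun i => (T i ω, p i), ⟨_, hpK, rfl⟩, fun i => rfl,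
      fun i => ⟨p i, hpA i, rfl⟩, ?_⟩
    refine eq_empty_of_forall_notMem fun q hq => ?_
    obtain ⟨i, hi⟩ := hpR q hq.1 (hq.2.2.2 _ (fun _ => rfl) q rfl)
    exact hq.2.2.1 i (by rw [hi])
  have hfinC : ∀ j, μ (d₂ ⁻¹' {j}) ≠ ∞ := by
    intro j
    rcases (d₂ ⁻¹' {j}).eq_empty_or_nonempty with h0 | ⟨x, hx⟩
    · simp [h0]
    · refine ((measure_mono (fun y hy => ?_)).trans_lt
        (Metric.isBounded_closedBall (x := x) (r := ε)).measure_lt_top).ne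
      exact (hd₂' _ _ (by rw [mem_preimage.1 hy, mem_preimage.1 hx])).le
  have hEv : ∀ c ∈ G, P (Ev c) ≤
      expNeg (μ (D c)) * (Measure.pi fun _ : ι => τ.prod μ) (code ⁻¹' {c}) := by
    rintro c ⟨h', hh', rfl⟩
    have hpre : code ⁻¹' {code h'} =
        univ.pi fun i => (d₁ ⁻¹' {(code h' i).1}) ×ˢ (d₂ ⁻¹' {(code h' i).2}) := by
      ext h
      simp only [mem_preimage, mem_singleton_iff, Set.mem_pi, mem_univ, true_implies, mem_prod]
      exact ⟨fun hh i => by rw [← hh]; exact ⟨rfl, rfl⟩,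
        fun hh => funext fun i => Prod.ext (hh i).1 (hh i).2⟩
    rw [hpre, Measure.pi_pi, mul_comm]
    simp_rw [Measure.prod_prod]
    refine hA _ _ _ (fun i => hd₁ (measurableSet_singleton _))
      (fun i => hd₂ (measurableSet_singleton _))
      (measurableSet_cellRegion hd₂ R measurableSet_closedBall _) (fun i => hfinC _) ?_ ?_ ?_
    · exact ((measure_mono inter_subset_left).trans_lt
        (Metric.isBounded_closedBall (x := o) (r := r)).measure_lt_top).ne
    -- The mesh is at most the separation of the points of a path in `K`, so distinct points have
    -- distinct cells.
    · intro i j hij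
      refine disjoint_left.2 fun x hx hx' => ?_
      have : d₂ (h' i).2 = d₂ (h' j).2 := hx.symm.trans hx'
      exact absurd (hd₂' _ _ this) (not_lt.2 (hK h' hh' i j hij))
    · exact fun i => disjoint_left.2 fun x hx hx' => hx'.2.1 i hx
  calc P (pathEvent A T K R) ≤ P (⋃ c ∈ G, Ev c) := measure_mono hsub
    _ ≤ ∑' c : G, P (Ev c) := measure_biUnion_le _ (to_countable G) _
    _ = ∑' c, G.indicator (fun c => P (Ev c)) c := tsum_subtype G fun c => P (Ev c)
    _ ≤ ∑' c, G.indicator (fun c => expNeg (μ (D c))) c *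
          (Measure.pi fun _ : ι => τ.prod μ) (code ⁻¹' {c}) := by
        refine ENNReal.tsum_le_tsum fun c => ?_
        by_cases hc : c ∈ G
        · simpa only [indicator_of_mem hc] using hEv c hc
        · simp [indicator_of_notMem hc]
    -- The sum over grids of cells is an integral against the image of the product measure under the
    -- code.
    _ = ∫⁻ c, G.indicator (fun c => expNeg (μ (D c))) c
          ∂((Measure.pi fun _ : ι => τ.prod μ).map code) := by
        rw [lintegral_countable']
        refine tsum_congr fun c => ?_
        rw [Measure.map_apply hcode (measurableSet_singleton c)]
    _ = _ := by
        rw [lintegral_map .of_discrete hcode]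
        refine lintegral_congr fun h => ?_
        by_cases hh : code h ∈ G
        · rw [indicator_of_mem hh, indicator_of_mem]
          obtain ⟨h', h1, h2⟩ := hh
          exact ⟨h', h1, fun i => congrFun h2 i⟩
        · rw [indicator_of_notMem hh, indicator_of_notMem]
          rintro ⟨h', h1, h2⟩
          exact hh ⟨h', h1, funext h2⟩

variable [Nonempty E] [NullSingletonClass μ]

/-- The upper bound in the multivariate Mecke formula, for a bounded set of separated paths. -/
theorem measure_pathEvent_le_of_bounded {A : Ω → Set E} {T : ι → Ω → ℝ}
    (hA : ∀ (J : ι → Set ℝ) (C : ι → Set E) (D : Set E), (∀ i, MeasurableSet (J i)) →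
      (∀ i, MeasurableSet (C i)) → MeasurableSet D → (∀ i, μ (C i) ≠ ∞) → μ D ≠ ∞ →
      Pairwise (fun i j => Disjoint (C i) (C j)) → (∀ i, Disjoint (C i) D) →
      P {ω | (∀ i, T i ω ∈ J i) ∧ (∀ i, (A ω ∩ C i).Nonempty) ∧ A ω ∩ D = ∅} ≤
        (∏ i, τ (J i) * μ (C i)) * expNeg (μ D))
    {K : Set (ι → ℝ × E)} (hKc : IsClosed K) (hKb : Bornology.IsBounded K) {δ : ℝ} (hδ : 0 < δ)
    (hK : ∀ h ∈ K, ∀ i j, i ≠ j → δ ≤ dist (h i).2 (h j).2)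
    {R : Set ((ι → ℝ × E) × E)} (hR : IsOpen R) (hfin : ∀ h ∈ K, μ {q | (h, q) ∈ R} ≠ ∞) :
    P (pathEvent A T K R) ≤
      ∫⁻ h in K, expNeg (μ {q | (h, q) ∈ R}) ∂(Measure.pi fun _ : ι => τ.prod μ) := by
  have hpos : ∀ m : ℕ, (0 : ℝ) < 1 / ((m : ℝ) + 1) := fun m => by positivity
  choose d₁ hd₁ hd₁' using fun m : ℕ => exists_measurable_code ℝ (hpos m)
  choose d₂ hd₂ hd₂' using fun m : ℕ => exists_measurable_code E (hpos m)
  obtain ⟨o⟩ := ‹Nonempty E›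
  set ϑ := Measure.pi fun _ : ι => τ.prod μ
  let G : ℕ → Set (ι → ℝ × E) := fun m =>
    {h | ∃ h' ∈ K, ∀ i, (d₁ m (h' i).1, d₂ m (h' i).2) = (d₁ m (h i).1, d₂ m (h i).2)}
  let g : ℕ → (ι → ℝ × E) → ℝ≥0∞ := fun m h => expNeg (μ (cellRegion (d₁ m) (d₂ m) R
    (Metric.closedBall o m) fun i => (d₁ m (h i).1, d₂ m (h i).2)))
  have hGdist : ∀ m h, h ∈ G m → ∃ h' ∈ K, dist h h' < 1 / ((m : ℝ) + 1) := by
    rintro m h ⟨h', hh', heq⟩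
    refine ⟨h', hh', (dist_pi_lt_iff (hpos m)).2 fun i => ?_⟩
    have := Prod.ext_iff.1 (heq i)
    rw [Prod.dist_eq]
    exact max_lt (hd₁' m _ _ this.1.symm) (hd₂' m _ _ this.2.symm)
  have hev : ∀ᶠ m : ℕ in atTop, P (pathEvent A T K R) ≤ ∫⁻ h, (G m).indicator (g m) h ∂ϑ := by
    have h1 : ∀ᶠ m : ℕ in atTop, 1 / ((m : ℝ) + 1) < δ :=
      (tendsto_order.1 tendsto_one_div_add_atTop_nhds_zero_nat).2 _ hδ
    filter_upwards [h1] with m hm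
    exact measure_pathEvent_le_lintegral_cell hA (hd₁ m) (hd₂ m) (hd₂' m)
      (fun h hh i j hij => hm.le.trans (hK h hh i j hij)) R o m
  have hmeas : ∀ m, Measurable ((G m).indicator (g m)) := by
    intro m
    have hc : Measurable fun (h : ι → ℝ × E) i => (d₁ m (h i).1, d₂ m (h i).2) := by
      refine measurable_pi_lambda _ fun i => ?_
      exact ((hd₁ m).comp (measurable_fst.comp (measurable_pi_apply i))).prodMk
        ((hd₂ m).comp (measurable_snd.comp (measurable_pi_apply i)))
    refine Measurable.indicator ?_ ?_
    · exact (Measurable.of_discrete (f := fun c : ι → ℕ × ℕ => expNeg (μ (cellRegion (d₁ m) (d₂ m) R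
        (Metric.closedBall o m) c)))).comp hc
    · refine MeasurableSet.congr (hc (MeasurableSet.of_discrete
        (s := {c : ι → ℕ × ℕ | ∃ h' ∈ K, ∀ i, (d₁ m (h' i).1, d₂ m (h' i).2) = c i}))) ?_
      rfl
  -- The mesh is at most one, so all discretizations of `K` stay in a ball of radius `ρ + 1`, whose
  -- indicator is an integrable majorant.
  obtain ⟨ρ, hρ⟩ := hKb.subset_closedBall (fun _ : ι => ((0 : ℝ), o))
  let B := Metric.closedBall (fun _ : ι => ((0 : ℝ), o)) (ρ + 1)
  have hB : ϑ B ≠ ∞ := (Metric.isBounded_closedBall.measure_lt_top).ne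
  have hbound : ∀ m, (G m).indicator (g m) ≤ᵐ[ϑ] B.indicator 1 := by
    intro m
    refine Eventually.of_forall fun h => ?_
    by_cases hh : h ∈ G m
    · have hhB : h ∈ B := by
        obtain ⟨h', hK', hd⟩ := hGdist m h hh
        have h1 := hρ hK'
        have h2 : 1 / ((m : ℝ) + 1) ≤ 1 := by
          rw [div_le_one (by positivity)]; linarith [(Nat.cast_nonneg m : (0 : ℝ) ≤ m)]
        have h3 := dist_triangle h h' (fun _ : ι => ((0 : ℝ), o))
        rw [Metric.mem_closedBall] at h1
        rw [Metric.mem_closedBall]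
        linarith
      rw [indicator_of_mem hh, indicator_of_mem hhB]
      exact expNeg_le_one _
    · rw [indicator_of_notMem hh]; exact zero_le
  -- The bound holds for every fine mesh; the reverse Fatou lemma passes to the limit.
  calc P (pathEvent A T K R) ≤ limsup (fun m => ∫⁻ h, (G m).indicator (g m) h ∂ϑ) atTop :=
        le_limsup_of_frequently_le hev.frequently
    _ ≤ ∫⁻ h, limsup (fun m => (G m).indicator (g m) h) atTop ∂ϑ := by
        refine limsup_lintegral_le (B.indicator 1) hmeas hbound ?_
        rw [lintegral_indicator_one measurableSet_closedBall]
        exact hB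
    _ ≤ ∫⁻ h, K.indicator (fun h => expNeg (μ {q | (h, q) ∈ R})) h ∂ϑ := by
        refine lintegral_mono fun h => ?_
        by_cases hh : h ∈ K
        · rw [indicator_of_mem hh]
          have ht : Tendsto (fun m => g m h) atTop (𝓝 (expNeg (μ {q | (h, q) ∈ R}))) := by
            have h1 := tendsto_measure_cellRegion hd₂ hd₁' hd₂' hR h (hfin h hh) o
            have h2 := (ENNReal.tendsto_toReal (hfin h hh)).comp h1
            exact (ENNReal.continuous_ofReal.tendsto _).comp
              ((Real.continuous_exp.tendsto _).comp h2.neg)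
          rw [← ht.limsup_eq]
          exact limsup_le_limsup (Eventually.of_forall fun m => indicator_le_self _ _ h)
        -- Closedness of `K` is used here: a point at positive distance from `K` eventually shares
        -- no grid of cells with it.
        · rw [indicator_of_notMem hh]
          obtain ⟨ε, hε, hball⟩ := Metric.isOpen_iff.1 hKc.isOpen_compl h hh
          have h1 : ∀ᶠ m : ℕ in atTop, 1 / ((m : ℝ) + 1) < ε :=
            (tendsto_order.1 tendsto_one_div_add_atTop_nhds_zero_nat).2 _ hε
          have h0 : (fun m => (G m).indicator (g m) h) =ᶠ[atTop] fun _ => 0 := by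
            filter_upwards [h1] with m hm
            refine indicator_of_notMem (fun hG => ?_) _
            obtain ⟨h', hK', hd⟩ := hGdist m h hG
            exact hball (Metric.mem_ball'.2 (hd.trans hm)) hK'
          rw [limsup_congr h0]
          simp
    _ = _ := lintegral_indicator hKc.measurableSet _

/-- The upper bound in the multivariate Mecke formula. -/
theorem measure_pathEvent_le {A : Ω → Set E} {T : ι → Ω → ℝ}
    (hA : ∀ (J : ι → Set ℝ) (C : ι → Set E) (D : Set E), (∀ i, MeasurableSet (J i)) →
      (∀ i, MeasurableSet (C i)) → MeasurableSet D → (∀ i, μ (C i) ≠ ∞) → μ D ≠ ∞ →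
      Pairwise (fun i j => Disjoint (C i) (C j)) → (∀ i, Disjoint (C i) D) →
      P {ω | (∀ i, T i ω ∈ J i) ∧ (∀ i, (A ω ∩ C i).Nonempty) ∧ A ω ∩ D = ∅} ≤
        (∏ i, τ (J i) * μ (C i)) * expNeg (μ D))
    {K : Set (ι → ℝ × E)} (hKc : IsClosed K)
    {R : Set ((ι → ℝ × E) × E)} (hR : IsOpen R) (hfin : ∀ h ∈ K, μ {q | (h, q) ∈ R} ≠ ∞) :
    P (pathEvent A T K R) ≤
      ∫⁻ h in K, expNeg (μ {q | (h, q) ∈ R}) ∂(Measure.pi fun _ : ι => τ.prod μ) := by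
  obtain ⟨o⟩ := id ‹Nonempty E›
  -- Exhaustion by bounded sets of separated paths. The points of a path are distinct, so every path
  -- belongs to some `K' m`, and continuity from below needs no measurability of the events.
  let K' : ℕ → Set (ι → ℝ × E) := fun m => K ∩ Metric.closedBall (fun _ => ((0 : ℝ), o)) m ∩
    {h | ∀ i j, i ≠ j → 1 / ((m : ℝ) + 1) ≤ dist (h i).2 (h j).2}
  have hmono : Monotone K' := by
    intro m m' hm h hh
    have hm' : (m : ℝ) ≤ m' := Nat.cast_le.2 hm
    refine ⟨⟨hh.1.1, Metric.closedBall_subset_closedBall hm' hh.1.2⟩, fun i j hij => ?_⟩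
    exact (one_div_le_one_div_of_le (by positivity) (by linarith)).trans (hh.2 i j hij)
  have hU : pathEvent A T K R ⊆ ⋃ m, pathEvent A T (K' m) R := by
    rintro ω ⟨p, hpA, hinj, hpK, hpR⟩
    have h1 : ∀ᶠ m : ℕ in atTop,
        dist (fun i => (T i ω, p i)) (fun _ : ι => ((0 : ℝ), o)) ≤ m :=
      (tendsto_natCast_atTop_atTop (R := ℝ)).eventually_ge_atTop _
    have h2 : ∀ᶠ m : ℕ in atTop, ∀ i j, i ≠ j → 1 / ((m : ℝ) + 1) ≤ dist (p i) (p j) := by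
      rw [eventually_all]; intro i
      rw [eventually_all]; intro j
      by_cases hij : i = j
      · exact Eventually.of_forall fun m h => absurd hij h
      · have := (tendsto_order.1 (tendsto_one_div_add_atTop_nhds_zero_nat (𝕜 := ℝ))).2 _
          (dist_pos.2 (hinj.ne hij))
        exact this.mono fun m hm _ => hm.le
    obtain ⟨m, hm1, hm2⟩ := (h1.and h2).exists
    exact mem_iUnion.2 ⟨m, p, hpA, hinj, ⟨⟨hpK, hm1⟩, hm2⟩, hpR⟩
  refine (measure_mono hU).trans ?_
  rw [Monotone.measure_iUnion]
  · refine iSup_le fun m => ?_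
    refine (measure_pathEvent_le_of_bounded hA ?_ ?_ (δ := 1 / ((m : ℝ) + 1)) (by positivity)
      (fun h hh => hh.2) hR (fun h hh => hfin h hh.1.1)).trans ?_
    · refine (hKc.inter Metric.isClosed_closedBall).inter ?_
      simp only [ofPred_forall]
      refine isClosed_iInter fun i => isClosed_iInter fun j => isClosed_iInter fun _ => ?_
      exact isClosed_le continuous_const (by fun_prop)
    · exact Metric.isBounded_closedBall.subset (inter_subset_left.trans inter_subset_right)
    · exact lintegral_mono_set (inter_subset_left.trans inter_subset_left)
  · rintro m m' hm ω ⟨p, h1, h2, h3, h4⟩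
    exact ⟨p, h1, h2, hmono hm h3, h4⟩

end Mecke

end GreedyServer

/-! ### Void and hitting probabilities of Poisson processes. -/

namespace GreedyServer

section Counts

variable {Ω E : Type*} {ξ : Ω → Set E}

theorem count_eq_zero_iff {B : Set E} {ω : Ω} : count ξ B ω = 0 ↔ ξ ω ∩ B = ∅ := by
  rw [count, encard_eq_zero]

theorem measurable_count_pointSigma [MeasurableSpace E] {B : Set E} (hB : MeasurableSet B) :
    Measurable[pointSigma ξ] (count ξ B) := by
  intro s _
  exact (le_iSup (fun B : {B : Set E // MeasurableSet B} =>
    MeasurableSpace.comap (count ξ B.1) ⊤) ⟨B, hB⟩) _ ⟨s, trivial, rfl⟩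

end Counts

section PoissonFacts

/-- The joint law of either family is a product measure, and a product of pairs regroups as a pair
of products. This merges the counts of initial customers and of arrivals cell by cell. -/
theorem iIndepFun_prodMk {Ω ι α β : Type*} [Fintype ι] [MeasurableSpace Ω] [MeasurableSpace α]
    [MeasurableSpace β] {P : Measure Ω} [IsProbabilityMeasure P] {X : ι → Ω → α} {Y : ι → Ω → β}
    (hXm : ∀ i, Measurable (X i)) (hYm : ∀ i, Measurable (Y i))
    (hX : iIndepFun X P) (hY : iIndepFun Y P)
    (hXY : IndepFun (fun ω i => X i ω) (fun ω i => Y i ω) P) :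
    iIndepFun (fun i ω => (X i ω, Y i ω)) P := by
  have hm1 : ∀ i, IsProbabilityMeasure (P.map (X i)) := fun i =>
    Measure.isProbabilityMeasure_map (hXm i).aemeasurable
  have hm2 : ∀ i, IsProbabilityMeasure (P.map (Y i)) := fun i =>
    Measure.isProbabilityMeasure_map (hYm i).aemeasurable
  rw [iIndepFun_iff_map_fun_eq_pi_map (fun i => ((hXm i).prodMk (hYm i)).aemeasurable)]
  have hpair : ∀ i, P.map (fun ω => (X i ω, Y i ω)) = (P.map (X i)).prod (P.map (Y i)) := by
    intro i
    have := hXY.comp (measurable_pi_apply i) (measurable_pi_apply i)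
    exact this.map_prod_eq_prod_map_map (hXm i).aemeasurable (hYm i).aemeasurable
  simp_rw [hpair]
  have e := measurePreserving_arrowProdEquivProdArrow α β ι (fun i => P.map (X i))
    (fun i => P.map (Y i))
  rw [← (MeasurableEquiv.arrowProdEquivProdArrow α β ι).map_measurableEquiv_injective.eq_iff,
    e.map_eq, ← hX.map_fun_eq_pi_map fun i => (hXm i).aemeasurable,
    ← hY.map_fun_eq_pi_map fun i => (hYm i).aemeasurable,
    ← hXY.map_prod_eq_prod_map_map (measurable_pi_lambda _ hXm).aemeasurable
      (measurable_pi_lambda _ hYm).aemeasurable,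
    Measure.map_map (MeasurableEquiv.measurable _)
      (measurable_pi_lambda _ fun i => (hXm i).prodMk (hYm i))]
  rfl

variable {Ω E : Type*} [MeasurableSpace Ω] [MeasurableSpace E] {ξ : Ω → Set E} {μ : Measure E}
  {P : Measure Ω}

theorem IsPoissonProcess.measure_count_eq_zero (h : IsPoissonProcess ξ μ P) {B : Set E}
    (hB : MeasurableSet B) (hfin : μ B ≠ ∞) : P {ω | count ξ B ω = 0} = expNeg (μ B) := by
  have h1 : {ω | count ξ B ω = 0} = count ξ B ⁻¹' {0} := rfl
  rw [h1, ← Measure.map_apply (h.measurable_count B hB) (measurableSet_singleton _),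
    h.law_count B hB hfin.lt_top,
    Measure.map_apply .of_discrete (measurableSet_singleton _)]
  have h2 : (fun n : ℕ => (n : ℕ∞)) ⁻¹' {0} = {0} := by ext n; simp
  rw [h2, poissonMeasure_singleton, expNeg]
  simp [ENNReal.coe_toNNReal_eq_toReal]

/-- This is `1 - exp (-m) ≤ m`. It lets a cell that contains a point of the path be charged just its
intensity. -/
theorem IsPoissonProcess.measure_count_ne_zero_le [IsProbabilityMeasure P]
    (h : IsPoissonProcess ξ μ P) {B : Set E}
    (hB : MeasurableSet B) : P {ω | count ξ B ω ≠ 0} ≤ μ B := by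
  by_cases hfin : μ B = ∞
  · simp [hfin]
  have h1 : {ω | count ξ B ω ≠ 0} = {ω | count ξ B ω = 0}ᶜ := rfl
  have hm : MeasurableSet {ω | count ξ B ω = 0} :=
    h.measurable_count B hB (measurableSet_singleton 0)
  rw [h1, prob_compl_eq_one_sub hm, h.measure_count_eq_zero hB hfin, expNeg, tsub_le_iff_right]
  nth_rw 1 [← ENNReal.ofReal_toReal hfin]
  rw [← ENNReal.ofReal_add ENNReal.toReal_nonneg (Real.exp_pos _).le, ENNReal.one_le_ofReal]
  linarith [Real.add_one_le_exp (-(μ B).toReal)]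

theorem IsPoissonProcess.ae_inter_eq_empty [IsProbabilityMeasure P]
    (h : IsPoissonProcess ξ μ P) {B : Set E}
    (hB : MeasurableSet B) (h0 : μ B = 0) : ∀ᵐ ω ∂P, ξ ω ∩ B = ∅ := by
  have := h.measure_count_ne_zero_le hB
  rw [h0, nonpos_iff_eq_zero] at this
  filter_upwards [measure_eq_zero_iff_ae_notMem.1 this] with ω hω
  exact count_eq_zero_iff.1 (not_not.1 hω)

theorem IsPoissonProcess.ae_finite_inter (h : IsPoissonProcess ξ μ P) {B : Set E}
    (hB : MeasurableSet B) (hfin : μ B ≠ ∞) : ∀ᵐ ω ∂P, (ξ ω ∩ B).Finite := by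
  have h2 : P.map (count ξ B) {(⊤ : ℕ∞)} = 0 := by
    rw [h.law_count B hB hfin.lt_top,
      Measure.map_apply .of_discrete (measurableSet_singleton _)]
    have h2 : (fun n : ℕ => (n : ℕ∞)) ⁻¹' {(⊤ : ℕ∞)} = ∅ := by ext n; simp
    rw [h2, measure_empty]
  rw [Measure.map_apply (h.measurable_count B hB) (measurableSet_singleton _)] at h2
  filter_upwards [measure_eq_zero_iff_ae_notMem.1 h2] with ω hω
  rwa [mem_preimage, mem_singleton_iff, count, encard_eq_top_iff, not_infinite] at hω

theorem IsPoissonProcess.pointSigma_le (h : IsPoissonProcess ξ μ P) :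
    pointSigma ξ ≤ ‹MeasurableSpace Ω› := by
  refine iSup_le fun B => ?_
  rintro _ ⟨s, -, rfl⟩
  exact h.measurable_count B.1 B.2 .of_discrete

end PoissonFacts

/-! ### Initial customers and arrivals as one process in space-time. -/

section Customers

variable {Ω : Type*} [MeasurableSpace Ω] {P : Measure Ω} [IsProbabilityMeasure P]

/-- The customers, with the arrival time of those present at time `0` recorded as `-1`. -/
def markedCustomers (init : Set ℝ) (arr : Set (ℝ × ℝ)) : Set (ℝ × ℝ) :=
  (fun x : ℝ => (x, (-1 : ℝ))) '' init ∪ (arr ∩ {p | 0 < p.2})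

/-- The intensity measure of the customers: `μ₀` at height `-1`, and Lebesgue measure on the open
upper half plane. -/
noncomputable def intensity (μ₀ : Measure ℝ) : Measure (ℝ × ℝ) :=
  μ₀.map (fun x => (x, (-1 : ℝ))) + (volume : Measure (ℝ × ℝ)).restrict {p | 0 < p.2}

theorem measurableSet_snd_pos : MeasurableSet {p : ℝ × ℝ | 0 < p.2} :=
  measurableSet_lt measurable_const measurable_snd

theorem intensity_apply (μ₀ : Measure ℝ) {B : Set (ℝ × ℝ)} (hB : MeasurableSet B) :
    intensity μ₀ B = μ₀ ((fun x => (x, (-1 : ℝ))) ⁻¹' B) +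
      (volume : Measure (ℝ × ℝ)).restrict {p | 0 < p.2} (B ∩ {p | 0 < p.2}) := by
  rw [intensity, Measure.add_apply, Measure.map_apply (by fun_prop) hB,
    Measure.restrict_apply hB, Measure.restrict_apply (hB.inter measurableSet_snd_pos), inter_assoc,
    inter_self]

theorem markedCustomers_inter_eq_empty_iff {init : Set ℝ} {arr : Set (ℝ × ℝ)} {B : Set (ℝ × ℝ)} :
    markedCustomers init arr ∩ B = ∅ ↔ init ∩ (fun x => (x, (-1 : ℝ))) ⁻¹' B = ∅ ∧
      arr ∩ (B ∩ {p | 0 < p.2}) = ∅ := by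
  simp only [markedCustomers, eq_empty_iff_forall_notMem, mem_inter_iff, mem_union, mem_image,
    mem_preimage, not_and]
  constructor
  · intro h
    exact ⟨fun x hx hxB => h _ (Or.inl ⟨x, hx, rfl⟩) hxB,
      fun p hp hpB hp0 => h _ (Or.inr ⟨hp, hp0⟩) hpB⟩
  · rintro ⟨h1, h2⟩ p (⟨x, hx, rfl⟩ | hp) hpB
    · exact h1 x hx hpB
    · exact h2 p hp.1 hpB hp.2

variable {init : Ω → Set ℝ} {arr : Ω → Set (ℝ × ℝ)} {T : ℕ → Ω → ℝ} {τ : Measure ℝ}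
  {μ₀ : Measure ℝ}

/-- Independent Poisson processes of initial customers and arrivals hit disjoint cells with
probability at most the product of the intensities, times the void probability of a further set. -/
theorem measure_hit_le {n : ℕ} (h_init : IsPoissonProcess init μ₀ P)
    (h_arr : IsPoissonProcess arr ((volume : Measure (ℝ × ℝ)).restrict {p | 0 < p.2}) P)
    (h_ia : Indep (pointSigma init) (pointSigma arr) P)
    {C : Fin n → Set (ℝ × ℝ)} {D : Set (ℝ × ℝ)} (hC : ∀ i, MeasurableSet (C i))
    (hD : MeasurableSet D) (hDfin : intensity μ₀ D ≠ ∞)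
    (hCC : Pairwise fun i j => Disjoint (C i) (C j)) (hCD : ∀ i, Disjoint (C i) D) :
    MeasurableSet[pointSigma init ⊔ pointSigma arr]
      {ω | (∀ i, (markedCustomers (init ω) (arr ω) ∩ C i).Nonempty) ∧
        markedCustomers (init ω) (arr ω) ∩ D = ∅} ∧
    P {ω | (∀ i, (markedCustomers (init ω) (arr ω) ∩ C i).Nonempty) ∧
        markedCustomers (init ω) (arr ω) ∩ D = ∅} ≤
      (∏ i, intensity μ₀ (C i)) * expNeg (intensity μ₀ D) := by
  -- The void set takes index `0` and the cells to be hit take the successors, so that one disjoint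
  -- family serves both.
  let B : Fin (n + 1) → Set (ℝ × ℝ) := Fin.cons D C
  have hB : ∀ i, MeasurableSet (B i) := fun i => Fin.cases hD hC i
  have hBB : Pairwise fun i j => Disjoint (B i) (B j) := by
    intro i j hij
    induction i using Fin.cases with
    | zero =>
      induction j using Fin.cases with
      | zero => exact absurd rfl hij
      | succ j => exact (hCD j).symm
    | succ i =>
      induction j using Fin.cases with
      | zero => exact hCD i
      | succ j => exact hCC fun h => hij (congrArg _ h)
  have hB₁ : ∀ i, MeasurableSet ((fun x : ℝ => (x, (-1 : ℝ))) ⁻¹' B i) :=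
    fun i => (by fun_prop : Measurable fun x : ℝ => (x, (-1 : ℝ))) (hB i)
  have hB₂ : ∀ i, MeasurableSet (B i ∩ {p | 0 < p.2}) := fun i =>
    (hB i).inter measurableSet_snd_pos
  let X : Fin (n + 1) → Ω → ℕ∞ := fun i => count init ((fun x : ℝ => (x, (-1 : ℝ))) ⁻¹' B i)
  let Y : Fin (n + 1) → Ω → ℕ∞ := fun i => count arr (B i ∩ {p | 0 < p.2})
  have hXm : ∀ i, Measurable (X i) := fun i => h_init.measurable_count _ (hB₁ i)
  have hYm : ∀ i, Measurable (Y i) := fun i => h_arr.measurable_count _ (hB₂ i)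
  have hX : iIndepFun X P := h_init.indep_count _ _ hB₁ fun i j hij => (hBB hij).preimage _
  have hY : iIndepFun Y P := h_arr.indep_count _ _ hB₂ fun i j hij =>
    (hBB hij).mono inter_subset_left inter_subset_left
  have hXY : IndepFun (fun ω i => X i ω) (fun ω i => Y i ω) P := by
    rw [IndepFun_iff_Indep]
    refine indep_of_indep_of_le_left (indep_of_indep_of_le_right h_ia ?_) ?_
    · refine Measurable.comap_le ?_
      exact @measurable_pi_lambda _ _ _ (pointSigma arr) _ _ fun i =>
        measurable_count_pointSigma (hB₂ i)
    · refine Measurable.comap_le ?_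
      exact @measurable_pi_lambda _ _ _ (pointSigma init) _ _ fun i =>
        measurable_count_pointSigma (hB₁ i)
  have hI := iIndepFun_prodMk hXm hYm hX hY hXY
  let S : Fin (n + 1) → Set (ℕ∞ × ℕ∞) := Fin.cons {(0, 0)} fun _ => {(0, 0)}ᶜ
  have hzero : ∀ i ω, markedCustomers (init ω) (arr ω) ∩ B i = ∅ ↔ (X i ω, Y i ω) = (0, 0) := by
    intro i ω
    rw [markedCustomers_inter_eq_empty_iff, Prod.mk.injEq, count_eq_zero_iff, count_eq_zero_iff]
  have hev : {ω | (∀ i, (markedCustomers (init ω) (arr ω) ∩ C i).Nonempty) ∧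
      markedCustomers (init ω) (arr ω) ∩ D = ∅} = ⋂ i, (fun ω => (X i ω, Y i ω)) ⁻¹' S i := by
    ext ω
    rw [mem_iInter, Fin.forall_fin_succ]
    refine and_comm.trans (and_congr (hzero 0 ω) (forall_congr' fun i => ?_))
    rw [nonempty_iff_ne_empty]
    exact (hzero i.succ ω).not
  rw [hev]
  refine ⟨?_, ?_⟩
  · refine @MeasurableSet.iInter _ _ (pointSigma init ⊔ pointSigma arr) _ _ fun i => ?_
    have h1 : Measurable[pointSigma init ⊔ pointSigma arr] (X i) :=
      (measurable_count_pointSigma (hB₁ i)).mono le_sup_left le_rfl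
    have h2 : Measurable[pointSigma init ⊔ pointSigma arr] (Y i) :=
      (measurable_count_pointSigma (hB₂ i)).mono le_sup_right le_rfl
    exact (h1.prodMk h2) .of_discrete
  · rw [hI.meas_iInter fun i => ⟨S i, .of_discrete, rfl⟩, Fin.prod_univ_succ, mul_comm]
    -- Hits are estimated by the union bound over the two processes, whereas the void probability is
    -- exact.
    refine mul_le_mul' (Finset.prod_le_prod' fun i _ => ?_) (le_of_eq ?_)
    · have hsub : (fun ω => (X i.succ ω, Y i.succ ω)) ⁻¹' S i.succ ⊆
          {ω | X i.succ ω ≠ 0} ∪ {ω | Y i.succ ω ≠ 0} := by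
        intro ω hω
        have hω' : (X i.succ ω, Y i.succ ω) ≠ (0, 0) := hω
        rw [ne_eq, Prod.mk.injEq, not_and_or] at hω'
        exact hω'
      refine (measure_mono hsub).trans ((measure_union_le _ _).trans ?_)
      rw [intensity_apply _ (hC i)]
      exact add_le_add (h_init.measure_count_ne_zero_le (hB₁ i.succ))
        (h_arr.measure_count_ne_zero_le (hB₂ i.succ))
    · have hsplit : (fun ω => (X 0 ω, Y 0 ω)) ⁻¹' S 0 = X 0 ⁻¹' {0} ∩ Y 0 ⁻¹' {0} := by
        ext ω
        exact Prod.mk_inj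
      have hXY0 : IndepFun (X 0) (Y 0) P :=
        hXY.comp (measurable_pi_apply (0 : Fin (n + 1))) (measurable_pi_apply (0 : Fin (n + 1)))
      rw [hsplit, hXY0.measure_inter_preimage_eq_mul _ _ .of_discrete .of_discrete]
      rw [intensity_apply _ hD] at hDfin ⊢
      rw [ENNReal.add_ne_top] at hDfin
      rw [expNeg_add hDfin.1 hDfin.2]
      exact congrArg₂ _ (h_init.measure_count_eq_zero (hB₁ 0) hDfin.1)
        (h_arr.measure_count_eq_zero (hB₂ 0) hDfin.2)

/-- The same with independent marks. -/
theorem measure_marked_hit_le (h_init : IsPoissonProcess init μ₀ P)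
    (h_arr : IsPoissonProcess arr ((volume : Measure (ℝ × ℝ)).restrict {p | 0 < p.2}) P)
    (hT_meas : ∀ n, Measurable (T n)) (hT_law : ∀ n, HasLaw (T n) τ P) (hT_indep : iIndepFun T P)
    (h_indep : iIndep ![pointSigma init, pointSigma arr,
      ⨆ n, MeasurableSpace.comap (T n) inferInstance] P) {n : ℕ}
    {J : Fin n → Set ℝ} {C : Fin n → Set (ℝ × ℝ)} {D : Set (ℝ × ℝ)}
    (hJ : ∀ i, MeasurableSet (J i)) (hC : ∀ i, MeasurableSet (C i))
    (hD : MeasurableSet D) (hDfin : intensity μ₀ D ≠ ∞)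
    (hCC : Pairwise fun i j => Disjoint (C i) (C j)) (hCD : ∀ i, Disjoint (C i) D) :
    P {ω | (∀ i : Fin n, T i ω ∈ J i) ∧
        (∀ i, (markedCustomers (init ω) (arr ω) ∩ C i).Nonempty) ∧
        markedCustomers (init ω) (arr ω) ∩ D = ∅} ≤
      (∏ i, τ (J i) * intensity μ₀ (C i)) * expNeg (intensity μ₀ D) := by
  let m : Fin 3 → MeasurableSpace Ω := ![pointSigma init, pointSigma arr,
      ⨆ n, MeasurableSpace.comap (T n) inferInstance]
  have hTle : (⨆ n, MeasurableSpace.comap (T n) inferInstance) ≤ ‹MeasurableSpace Ω› :=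
    iSup_le fun n => (hT_meas n).comap_le
  have hle : ∀ i, m i ≤ ‹MeasurableSpace Ω› := by
    intro i
    fin_cases i
    exacts [h_init.pointSigma_le, h_arr.pointSigma_le, hTle]
  have h_ia : Indep (pointSigma init) (pointSigma arr) P :=
    h_indep.indep (i := 0) (j := 1) (by decide)
  have h_iaT : Indep (pointSigma init ⊔ pointSigma arr)
      (⨆ n, MeasurableSpace.comap (T n) inferInstance) P := by
    -- The two point processes are grouped against the service times.
    have := indep_iSup_of_disjoint (m := m) hle h_indep (S := {0, 1}) (T := {2})
      (by simp)
    refine indep_of_indep_of_le_left (indep_of_indep_of_le_right this ?_) ?_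
    · exact le_iSup₂_of_le (f := fun i (_ : i ∈ ({2} : Set (Fin 3))) => m i) 2 rfl le_rfl
    · refine sup_le ?_ ?_
      · exact le_iSup₂_of_le (f := fun i (_ : i ∈ ({0, 1} : Set (Fin 3))) => m i) 0 (by simp) le_rfl
      · exact le_iSup₂_of_le (f := fun i (_ : i ∈ ({0, 1} : Set (Fin 3))) => m i) 1 (by simp) le_rfl
  obtain ⟨hm, hb⟩ := measure_hit_le h_init h_arr h_ia hC hD hDfin hCC hCD
  have hTev : MeasurableSet[⨆ n, MeasurableSpace.comap (T n) inferInstance]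
      (⋂ i : Fin n, T i ⁻¹' J i) := by
    refine @MeasurableSet.iInter _ _ (⨆ n, MeasurableSpace.comap (T n) inferInstance) _ _
      fun i => ?_
    exact (le_iSup (fun n => MeasurableSpace.comap (T n) inferInstance) (i : ℕ)) _ ⟨J i, hJ i, rfl⟩
  have hsplit : {ω | (∀ i : Fin n, T i ω ∈ J i) ∧
        (∀ i, (markedCustomers (init ω) (arr ω) ∩ C i).Nonempty) ∧
        markedCustomers (init ω) (arr ω) ∩ D = ∅} =
      {ω | (∀ i, (markedCustomers (init ω) (arr ω) ∩ C i).Nonempty) ∧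
        markedCustomers (init ω) (arr ω) ∩ D = ∅} ∩ ⋂ i : Fin n, T i ⁻¹' J i := by
    ext ω
    rw [inter_comm, mem_inter_iff, mem_iInter]
    exact Iff.rfl
  have hTP : P (⋂ i : Fin n, T i ⁻¹' J i) = ∏ i, τ (J i) := by
    have := hT_indep.precomp (g := fun i : Fin n => (i : ℕ)) Fin.val_injective
    rw [this.meas_iInter fun i => ⟨J i, hJ i, rfl⟩]
    refine Finset.prod_congr rfl fun i _ => ?_
    exact (hT_law i).measure_eq (hJ i)
  rw [hsplit, (Indep_iff _ _ P).1 h_iaT _ _ hm hTev, hTP, Finset.prod_mul_distrib, mul_right_comm,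
    mul_comm]
  calc (∏ i, τ (J i)) * P _ ≤ (∏ i, τ (J i)) *
        ((∏ i, intensity μ₀ (C i)) * expNeg (intensity μ₀ D)) := mul_le_mul_right hb _
    _ = _ := by ring

end Customers

end GreedyServer

/-! ### Peaked functions and the law of a single step. -/

namespace GreedyServer

noncomputable section

/-- `u` is unimodal, and attains its maximum `M` exactly at `x`. -/
structure IsPeaked (u : ℝ → ℝ) (x M : ℝ) : Prop where
  eq : u x = M
  lt : ∀ y, y ≠ x → u y < M
  mono : MonotoneOn u (Iio x)
  anti : AntitoneOn u (Ioi x)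

/-- The integral of `M + T - u` over the interval of radius `r` around `x`. -/
def area (u : ℝ → ℝ) (x M T r : ℝ) : ℝ := ∫ s in (x - r)..(x + r), (M + T - u s)

namespace IsPeaked

variable {u : ℝ → ℝ} {x M T : ℝ}

theorem le (h : IsPeaked u x M) (y : ℝ) : u y ≤ M := by
  rcases eq_or_ne y x with rfl | hy
  · exact h.eq.le
  · exact (h.lt y hy).le

theorem peak_eq (h : IsPeaked u x M) : peak u = x := by
  have h1 : ∃ x : ℝ, ∀ y : ℝ, u y ≤ u x := ⟨x, fun y => h.eq ▸ h.le y⟩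
  by_contra hne
  have h2 := Classical.epsilon_spec h1 x
  rw [h.eq] at h2
  exact absurd (h.lt _ hne) (not_lt.2 h2)

theorem height_eq (h : IsPeaked u x M) : height u = M := by
  rw [height, h.peak_eq, h.eq]

/-- Unimodality as quasiconcavity. It makes superlevel sets order-connected, whence measurability,
and bounds `u` from below on compact intervals, whence integrability. -/
theorem min_le (h : IsPeaked u x M) {a y b : ℝ} (hay : a ≤ y) (hyb : y ≤ b) :
    min (u a) (u b) ≤ u y := by
  rcases lt_trichotomy y x with hy | rfl | hy
  · exact (min_le_left _ _).trans (h.mono (hay.trans_lt hy) hy hay)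
  · exact h.eq.symm ▸ (min_le_left _ _).trans (h.le a)
  · exact (min_le_right _ _).trans (h.anti hy (hy.trans_le hyb) hyb)

theorem measurable (h : IsPeaked u x M) : Measurable u := by
  refine measurable_of_Ioi fun c => OrdConnected.measurableSet (ordConnected_def.2 ?_)
  intro a ha b hb y hy
  exact (lt_min ha hb).trans_le (h.min_le hy.1 hy.2)

theorem intervalIntegrable (h : IsPeaked u x M) (a b : ℝ) : IntervalIntegrable u volume a b := by
  wlog hab : a ≤ b generalizing a b
  · exact (this b a (le_of_not_ge hab)).symm
  rw [intervalIntegrable_iff_integrableOn_Ioc_of_le hab]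
  refine Measure.integrableOn_of_bounded (M := max (|M|) |min (u a) (u b)|)
    measure_Ioc_lt_top.ne h.measurable.aestronglyMeasurable ?_
  refine (ae_restrict_mem measurableSet_Ioc).mono fun y hy => ?_
  rw [Real.norm_eq_abs, max_comm]
  exact abs_le_max_abs_abs (h.min_le hy.1.le hy.2) (h.le y)

theorem intervalIntegrable_sub (h : IsPeaked u x M) (T a b : ℝ) :
    IntervalIntegrable (fun s => M + T - u s) volume a b :=
  intervalIntegrable_const.sub (h.intervalIntegrable a b)

theorem sub_pos (h : IsPeaked u x M) (hT : 0 ≤ T) {y : ℝ} (hy : y ≠ x) : 0 < M + T - u y := by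
  linarith [h.lt y hy]

theorem sub_nonneg (h : IsPeaked u x M) (hT : 0 ≤ T) (y : ℝ) : 0 ≤ M + T - u y := by
  linarith [h.le y]

theorem area_eq (h : IsPeaked u x M) (T r : ℝ) : area u x M T r =
    (∫ s in x..(x + r), (M + T - u s)) - ∫ s in x..(x - r), (M + T - u s) :=
  (intervalIntegral.integral_interval_sub_left (h.intervalIntegrable_sub T _ _)
    (h.intervalIntegrable_sub T _ _)).symm

theorem continuous_area (h : IsPeaked u x M) (T : ℝ) : Continuous (area u x M T) := by
  have h1 := intervalIntegral.continuous_primitive (h.intervalIntegrable_sub T) x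
  rw [show area u x M T = _ from funext (h.area_eq T)]
  exact (h1.comp (continuous_const.add continuous_id)).sub
    (h1.comp (continuous_const.sub continuous_id))

/-- Both ends of the interval move outwards, each sweeping its own integrand. This derivative `a +
b` is the Jacobian of the substitution `E = area z`. -/
theorem hasDerivAt_area (h : IsPeaked u x M) (T : ℝ) {r : ℝ} (h1 : ContinuousAt u (x + r))
    (h2 : ContinuousAt u (x - r)) :
    HasDerivAt (area u x M T) ((M + T - u (x - r)) + (M + T - u (x + r))) r := by
  have hm : StronglyMeasurable fun s => M + T - u s :=
    (measurable_const.sub h.measurable).stronglyMeasurable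
  have d1 := intervalIntegral.integral_hasDerivAt_right (h.intervalIntegrable_sub T x (x + r))
    hm.stronglyMeasurableAtFilter (continuousAt_const.sub h1)
  have d2 := intervalIntegral.integral_hasDerivAt_right (h.intervalIntegrable_sub T x (x - r))
    hm.stronglyMeasurableAtFilter (continuousAt_const.sub h2)
  rw [show area u x M T = _ from funext (h.area_eq T)]
  have e1 : HasDerivAt (fun r : ℝ => x + r) 1 r := (hasDerivAt_id r).const_add x
  have e2 : HasDerivAt (fun r : ℝ => x - r) (-1) r := (hasDerivAt_id r).const_sub x
  refine ((d1.comp r e1).sub (d2.comp r e2)).congr_deriv ?_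
  ring

theorem area_zero : area u x M T 0 = 0 := by simp [area]

/-- The integrand is positive away from the peak, even for `T = 0`. Strict gain on the right-hand
strip is enough. -/
theorem strictMonoOn_area (h : IsPeaked u x M) (hT : 0 ≤ T) :
    StrictMonoOn (area u x M T) (Ici 0) := by
  intro r hr r' hr' hlt
  have hr : 0 ≤ r := hr
  have hi := h.intervalIntegrable_sub T
  have hsplit : area u x M T r' = (∫ s in (x - r')..(x - r), (M + T - u s)) + area u x M T r +
      ∫ s in (x + r)..(x + r'), (M + T - u s) := by
    rw [area, area, intervalIntegral.integral_add_adjacent_intervals (hi _ _) (hi _ _),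
      intervalIntegral.integral_add_adjacent_intervals (hi _ _) (hi _ _)]
  have p1 : 0 < ∫ s in (x + r)..(x + r'), (M + T - u s) :=
    intervalIntegral.intervalIntegral_pos_of_pos_on (hi _ _)
      (fun s hs => h.sub_pos hT (by linarith [hs.1] : x < s).ne') (by linarith)
  have p2 : 0 ≤ ∫ s in (x - r')..(x - r), (M + T - u s) :=
    intervalIntegral.integral_nonneg (by linarith) fun s _ => h.sub_nonneg hT s
  linarith

/-- By monotonicity on the right, the integrand stays above its positive value at `x + 1`, so the
area grows at least linearly. -/
theorem tendsto_area (h : IsPeaked u x M) (hT : 0 ≤ T) :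
    Tendsto (area u x M T) atTop atTop := by
  set c := M + T - u (x + 1)
  have hc : 0 < c := h.sub_pos hT (by linarith : x < x + 1).ne'
  have hi := h.intervalIntegrable_sub T
  have hb : ∀ r, 1 ≤ r → c * (r - 1) ≤ area u x M T r := by
    intro r hr
    have hsplit : area u x M T r = (∫ s in (x - r)..(x + 1), (M + T - u s)) +
        ∫ s in (x + 1)..(x + r), (M + T - u s) := by
      rw [area, intervalIntegral.integral_add_adjacent_intervals (hi _ _) (hi _ _)]
    have p2 : 0 ≤ ∫ s in (x - r)..(x + 1), (M + T - u s) :=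
      intervalIntegral.integral_nonneg (by linarith) fun s _ => h.sub_nonneg hT s
    have p1 : ∫ s in (x + 1)..(x + r), c ≤ ∫ s in (x + 1)..(x + r), (M + T - u s) := by
      refine intervalIntegral.integral_mono_on (by linarith) intervalIntegrable_const (hi _ _) ?_
      intro s hs
      have : u s ≤ u (x + 1) := h.anti (by simp) (by simp; linarith [hs.1]) hs.1
      simp only [c]; linarith
    rw [intervalIntegral.integral_const, smul_eq_mul] at p1
    linarith
  refine tendsto_atTop_mono' atTop ((eventually_ge_atTop 1).mono hb) ?_
  exact (tendsto_atTop_add_const_right _ (-1) tendsto_id).const_mul_atTop hc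

theorem exists_area_eq (h : IsPeaked u x M) (hT : 0 ≤ T) {E : ℝ} (hE : 0 < E) :
    ∃ z, 0 < z ∧ area u x M T z = E := by
  obtain ⟨r, hr, hr0⟩ := ((h.tendsto_area hT).eventually_ge_atTop E |>.and
    (eventually_ge_atTop 0)).exists
  obtain ⟨z, hz, hzE⟩ := intermediate_value_Icc hr0 (h.continuous_area T).continuousOn
    (show E ∈ Icc (area u x M T 0) (area u x M T r) from ⟨by rw [area_zero]; exact hE.le, hr⟩)
  refine ⟨z, lt_of_le_of_ne hz.1 ?_, hzE⟩
  rintro rfl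
  rw [area_zero] at hzE
  exact hE.ne hzE

theorem radius_spec (h : IsPeaked u x M) (hT : 0 ≤ T) {E : ℝ} (hE : 0 < E) :
    0 < radius T E u ∧ area u x M T (radius T E u) = E := by
  have := Classical.epsilon_spec (p := fun z : ℝ =>
    0 < z ∧ ∫ x in (peak u - z)..(peak u + z), (height u + T - u x) = E) (by
      rw [h.peak_eq, h.height_eq]; simpa only [area] using h.exists_area_eq hT hE)
  refine ⟨this.1, ?_⟩
  have h2 : ∫ x in (peak u - radius T E u)..(peak u + radius T E u), (height u + T - u x) = E :=
    this.2
  rwa [h.peak_eq, h.height_eq] at h2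

theorem area_pos (h : IsPeaked u x M) (hT : 0 ≤ T) {z : ℝ} (hz : 0 < z) : 0 < area u x M T z := by
  rw [← area_zero (u := u) (x := x) (M := M) (T := T)]
  exact h.strictMonoOn_area hT self_mem_Ici hz.le hz

theorem radius_area (h : IsPeaked u x M) (hT : 0 ≤ T) {z : ℝ} (hz : 0 < z) :
    radius T (area u x M T z) u = z := by
  have := h.radius_spec hT (h.area_pos hT hz)
  exact (h.strictMonoOn_area hT).injOn (mem_Ici.2 this.1.le) (mem_Ici.2 hz.le) this.2

/-- The radius is defined by choice; its sublevel sets are nevertheless explicit, and this is how it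
is shown to be measurable. -/
theorem radius_le_iff (h : IsPeaked u x M) (hT : 0 ≤ T) {E : ℝ} (hE : 0 < E) {r : ℝ}
    (hr : 0 ≤ r) : radius T E u ≤ r ↔ E ≤ area u x M T r := by
  have := h.radius_spec hT hE
  rw [← (h.strictMonoOn_area hT).le_iff_le this.1.le hr, this.2]

/-- Each monotone branch has countably many discontinuities, so the derivative of the area exists
off a null set of radii. -/
theorem countable_not_continuousAt (h : IsPeaked u x M) : {y | ¬ ContinuousAt u y}.Countable := by
  refine ((h.mono.countable_not_continuousWithinAt.union
    h.anti.countable_not_continuousWithinAt).union (countable_singleton x)).mono ?_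
  intro y hy
  rcases lt_trichotomy y x with hlt | rfl | hlt
  · exact Or.inl (Or.inl ⟨hlt, fun hc => hy (hc.continuousAt (Iio_mem_nhds hlt))⟩)
  · exact Or.inr rfl
  · exact Or.inl (Or.inr ⟨hlt, fun hc => hy (hc.continuousAt (Ioi_mem_nhds hlt))⟩)

theorem newPoint_eq (h : IsPeaked u x M) (w : ℝ × ℝ × ℝ) : newPoint w u =
    if w.2.2 ≤ (M + w.1 - u (x - radius w.1 w.2.1 u)) / ((M + w.1 - u (x - radius w.1 w.2.1 u)) +
      (M + w.1 - u (x + radius w.1 w.2.1 u))) then x - radius w.1 w.2.1 u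
    else x + radius w.1 w.2.1 u := by
  rw [newPoint, h.peak_eq, h.height_eq]

theorem abs_newPoint_sub (h : IsPeaked u x M) {w : ℝ × ℝ × ℝ} (hT : 0 ≤ w.1) (hE : 0 < w.2.1) :
    |newPoint w u - x| = radius w.1 w.2.1 u := by
  have h1 := (h.radius_spec hT hE).1
  rw [h.newPoint_eq]
  split_ifs
  · rw [show x - radius w.1 w.2.1 u - x = -radius w.1 w.2.1 u by ring, abs_neg, abs_of_pos h1]
  · rw [add_sub_cancel_left, abs_of_pos h1]

end IsPeaked

theorem lintegral_uniform_ite {p : ℝ} (hp0 : 0 ≤ p) (hp1 : p ≤ 1) (a b : ℝ≥0∞) :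
    ∫⁻ U in Icc (0 : ℝ) 1, (if U ≤ p then a else b) =
      ENNReal.ofReal p * a + ENNReal.ofReal (1 - p) * b := by
  have h1 : ∀ U : ℝ, (if U ≤ p then a else b) =
      (Iic p).indicator (fun _ => a) U + (Ioi p).indicator (fun _ => b) U := by
    intro U
    by_cases hU : U ≤ p
    · simp [hU]
    · simp [hU, not_le.1 hU]
  simp_rw [h1]
  rw [lintegral_add_left (measurable_const.indicator measurableSet_Iic),
    lintegral_indicator measurableSet_Iic, lintegral_indicator measurableSet_Ioi,
    lintegral_const, lintegral_const, Measure.restrict_apply_univ, Measure.restrict_apply_univ,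
    Measure.restrict_apply measurableSet_Iic, Measure.restrict_apply measurableSet_Ioi]
  have e1 : Iic p ∩ Icc (0 : ℝ) 1 = Icc 0 p := by
    ext U; simp only [mem_inter_iff, mem_Iic, mem_Icc]
    exact ⟨fun h => ⟨h.2.1, h.1⟩, fun h => ⟨h.2, h.1, h.2.trans hp1⟩⟩
  have e2 : Ioi p ∩ Icc (0 : ℝ) 1 = Ioc p 1 := by
    ext U; simp only [mem_inter_iff, mem_Ioi, mem_Icc, mem_Ioc]
    exact ⟨fun h => ⟨h.1, h.2.2⟩, fun h => ⟨h.1, hp0.trans h.1.le, h.2⟩⟩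
  rw [e1, e2]
  simp [mul_comm]

/-- No measurability of `f` is required, because the formula is applied to integrands that involve
`radius` before their measurability is known. -/
theorem lintegral_expMeasure (f : ℝ → ℝ≥0∞) :
    ∫⁻ E, f E ∂(expMeasure 1) = ∫⁻ E in Ioi (0 : ℝ), ENNReal.ofReal (Real.exp (-E)) * f E := by
  have h0 : expMeasure 1 = volume.withDensity (exponentialPDF 1) := rfl
  have hm : Measurable (exponentialPDF 1) :=
    ENNReal.measurable_ofReal.comp (measurable_exponentialPDFReal 1)
  rw [h0, lintegral_withDensity_eq_lintegral_mul_non_measurable _ hm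
    (Eventually.of_forall fun E => ENNReal.ofReal_lt_top), setLIntegral_congr Ioi_ae_eq_Ici,
    ← lintegral_indicator measurableSet_Ici]
  refine lintegral_congr fun E => ?_
  by_cases hE : 0 ≤ E
  · rw [indicator_of_mem (mem_Ici.2 hE), Pi.mul_apply, exponentialPDF_of_nonneg hE]
    simp
  · rw [indicator_of_notMem (by simpa using hE), Pi.mul_apply, exponentialPDF_of_neg (not_le.1 hE),
      zero_mul]

theorem lintegral_symm_abs (x : ℝ) {f : ℝ → ℝ≥0∞} (hf : Measurable f) :
    ∫⁻ y, f y = ∫⁻ z in Ioi (0 : ℝ), (f (x - z) + f (x + z)) := by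
  rw [← lintegral_add_left_eq_self f x, ← lintegral_add_compl _ (measurableSet_Ioi (a := (0 : ℝ))),
    lintegral_add_right _ (by fun_prop), add_comm, compl_Ioi]
  congr 1
  rw [setLIntegral_congr Ioi_ae_eq_Ici, ← lintegral_indicator measurableSet_Iic,
    ← lintegral_indicator measurableSet_Ici, ← lintegral_neg_eq_self]
  refine lintegral_congr fun z => ?_
  by_cases hz : 0 ≤ z
  · rw [indicator_of_mem (by simpa using hz), indicator_of_mem (mem_Ici.2 hz), sub_eq_add_neg]
  · rw [indicator_of_notMem (by simpa using hz), indicator_of_notMem (by simpa using hz)]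

/-- The law of the new point, for a given service time. -/
theorem IsPeaked.lintegral_newPoint {u : ℝ → ℝ} {x M T : ℝ} (h : IsPeaked u x M) (hT : 0 ≤ T)
    {φ : ℝ → ℝ≥0∞} (hφ : Measurable φ) :
    ∫⁻ E, (∫⁻ U in Icc (0 : ℝ) 1, φ (newPoint (T, E, U) u)) ∂(expMeasure 1) =
      ∫⁻ y, ENNReal.ofReal (M + T - u y) * ENNReal.ofReal (Real.exp (-area u x M T |y - x|)) *
        φ y := by
  -- Radii at which an endpoint hits a discontinuity. They and their areas are countable, hence
  -- negligible on both sides of the substitution.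
  let N : Set ℝ := {z | ¬ ContinuousAt u (x + z)} ∪ {z | ¬ ContinuousAt u (x - z)}
  have hN : N.Countable :=
    (h.countable_not_continuousAt.preimage (add_right_injective x)).union
      (h.countable_not_continuousAt.preimage sub_right_injective)
  let s : Set ℝ := Ioi 0 \ N
  have hs : MeasurableSet s := measurableSet_Ioi.diff hN.measurableSet
  have hsae : s =ᵐ[volume] Ioi (0 : ℝ) := sdiff_null_ae_eq_self (hN.measure_zero _)
  have himg : area u x M T '' s =ᵐ[volume] Ioi (0 : ℝ) := by
    refine EventuallyLE.antisymm (LE.le.eventuallyLE ?_) (ae_le_set.2 ?_)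
    · rintro _ ⟨z, hz, rfl⟩
      exact h.area_pos hT hz.1
    · refine measure_mono_null ?_ ((hN.image (area u x M T)).measure_zero volume)
      rintro E ⟨hE, hEs⟩
      obtain ⟨z, hz, rfl⟩ := h.exists_area_eq hT hE
      exact ⟨z, by_contra fun hzN => hEs ⟨z, ⟨hz, hzN⟩, rfl⟩, rfl⟩
  rw [lintegral_expMeasure, ← setLIntegral_congr himg,
    lintegral_image_eq_lintegral_abs_deriv_mul hs (f' := fun z =>
      (M + T - u (x - z)) + (M + T - u (x + z))) (fun z hz => (h.hasDerivAt_area T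
        (not_not.1 fun hc => hz.2 (Or.inl hc)) (not_not.1 fun hc => hz.2 (Or.inr hc))
        ).hasDerivWithinAt)
      ((h.strictMonoOn_area hT).injOn.mono fun z hz => mem_Ici.2 (le_of_lt (mem_Ioi.1 hz.1))),
    setLIntegral_congr hsae, lintegral_symm_abs x]
  · refine setLIntegral_congr_fun measurableSet_Ioi fun z hz => ?_
    have hz : 0 < z := hz
    set a := M + T - u (x - z)
    set b := M + T - u (x + z)
    have ha : 0 < a := h.sub_pos hT (by linarith : x - z < x).ne
    have hb : 0 < b := h.sub_pos hT (by linarith : x < x + z).ne'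
    have hin : ∫⁻ U in Icc (0 : ℝ) 1, φ (newPoint (T, area u x M T z, U) u) =
        ENNReal.ofReal (a / (a + b)) * φ (x - z) + ENNReal.ofReal (b / (a + b)) * φ (x + z) := by
      have h1 : 1 - a / (a + b) = b / (a + b) := by field_simp; ring
      rw [← h1, ← lintegral_uniform_ite (by positivity)
        ((div_le_one (by positivity)).2 (by linarith))]
      refine lintegral_congr fun U => ?_
      rw [h.newPoint_eq]
      simp only [h.radius_area hT hz]
      exact apply_ite φ _ _ _
    -- The Jacobian `a + b` cancels the normalization of the two side probabilities and leaves `a`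
    -- and `b`, the values of `M + T - u` at the two candidate points.
    have e1 : ENNReal.ofReal (a + b) * ENNReal.ofReal (a / (a + b)) = ENNReal.ofReal a := by
      rw [← ENNReal.ofReal_mul (by positivity)]; congr 1; field_simp
    have e2 : ENNReal.ofReal (a + b) * ENNReal.ofReal (b / (a + b)) = ENNReal.ofReal b := by
      rw [← ENNReal.ofReal_mul (by positivity)]; congr 1; field_simp
    have e3 : |x - z - x| = z := by
      rw [show x - z - x = -z by ring, abs_neg, abs_of_pos hz]
    have e4 : |x + z - x| = z := by rw [add_sub_cancel_left, abs_of_pos hz]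
    rw [hin, abs_of_pos (by positivity : 0 < a + b), e3, e4, ← e1, ← e2]
    ring
  · have hm : Measurable fun y => area u x M T |y - x| :=
      (h.continuous_area T).measurable.comp (by fun_prop)
    have := h.measurable
    fun_prop

end

end GreedyServer

namespace GreedyServer

noncomputable section

/-! ### Histories: sequences of service times and positions -/

/-- The position after `n` moves, along the sequence `σ` of service times and new positions. -/
def pos (σ : ℕ → ℝ × ℝ) : ℕ → ℝ
  | 0 => 0
  | n + 1 => (σ n).2

/-- The time at which service `n` starts. -/
def time (v : ℝ) (σ : ℕ → ℝ × ℝ) : ℕ → ℝ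
  | 0 => 0
  | n + 1 => time v σ n + (σ n).1 + |(σ n).2 - pos σ n| / v

open Classical in
/-- The potential after `n` moves along `σ`. -/
def pot (v : ℝ) (u₀ : ℝ → ℝ) (σ : ℕ → ℝ × ℝ) : ℕ → ℝ → ℝ
  | 0 => u₀
  | n + 1 => fun s =>
    if s = (σ n).2 then time v σ (n + 1)
    else if |s - pos σ n| ≤ |(σ n).2 - pos σ n| then time v σ n + (σ n).1
    else pot v u₀ σ n s

/-- Histories whose first `n` service times are nonnegative. -/
def Good (n : ℕ) : Set (ℕ → ℝ × ℝ) := {σ | ∀ k < n, 0 ≤ (σ k).1}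

variable {v : ℝ} {u₀ : ℝ → ℝ} {σ σ' : ℕ → ℝ × ℝ} {n : ℕ}

/-- Quantities at stage `n` read only the entries before `n`. Overwriting entry `n` therefore does
not disturb them. -/
theorem pos_congr (h : ∀ k < n, σ k = σ' k) : pos σ n = pos σ' n := by
  cases n with
  | zero => rfl
  | succ n => rw [pos, pos, h n n.lt_succ_self]

theorem time_congr (h : ∀ k < n, σ k = σ' k) : time v σ n = time v σ' n := by
  induction n with
  | zero => rfl
  | succ n ih =>
    have h' : ∀ k < n, σ k = σ' k := fun k hk => h k (hk.trans n.lt_succ_self)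
    rw [time, time, h n n.lt_succ_self, ih h', pos_congr h']

theorem pot_congr (h : ∀ k < n, σ k = σ' k) : pot v u₀ σ n = pot v u₀ σ' n := by
  induction n with
  | zero => rfl
  | succ n ih =>
    have h' : ∀ k < n, σ k = σ' k := fun k hk => h k (hk.trans n.lt_succ_self)
    funext s
    simp only [pot]
    rw [h n n.lt_succ_self, ih h', pos_congr h', time_congr h', time_congr h]

theorem good_congr (h : ∀ k < n, σ k = σ' k) : σ ∈ Good n ↔ σ' ∈ Good n := by
  refine forall₂_congr fun k hk => ?_
  rw [h k hk]

theorem update_agree (σ : ℕ → ℝ × ℝ) (n : ℕ) (x : ℝ × ℝ) :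
    ∀ k < n, Function.update σ n x k = σ k :=
  fun _ hk => Function.update_of_ne hk.ne _ _

theorem good_succ_iff : σ ∈ Good (n + 1) ↔ σ ∈ Good n ∧ 0 ≤ (σ n).1 := by
  constructor
  · exact fun h => ⟨fun k hk => h k (hk.trans n.lt_succ_self), h n n.lt_succ_self⟩
  · rintro ⟨h1, h2⟩ k hk
    rcases Nat.lt_succ_iff_lt_or_eq.1 hk with hk | rfl
    exacts [h1 k hk, h2]

theorem measurable_pos (n : ℕ) : Measurable fun σ : ℕ → ℝ × ℝ => pos σ n := by
  cases n with
  | zero => exact measurable_const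
  | succ n => exact measurable_snd.comp (measurable_pi_apply n)

theorem measurable_time (n : ℕ) : Measurable fun σ : ℕ → ℝ × ℝ => time v σ n := by
  induction n with
  | zero => exact measurable_const
  | succ n ih =>
    have := measurable_pos n
    simp only [time]
    fun_prop

theorem measurable_pot (hu₀ : Measurable u₀) (n : ℕ) :
    Measurable fun q : (ℕ → ℝ × ℝ) × ℝ => pot v u₀ q.1 n q.2 := by
  induction n with
  | zero => exact hu₀.comp measurable_snd
  | succ n ih =>
    have h1 := measurable_pos n
    have h2 := measurable_time (v := v) n
    have h3 := measurable_time (v := v) (n + 1)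
    simp only [pot]
    refine Measurable.ite (measurableSet_eq_fun ?_ ?_) ?_
      (Measurable.ite (measurableSet_le ?_ ?_) ?_ ih) <;> fun_prop

theorem measurableSet_good (n : ℕ) : MeasurableSet (Good n) := by
  simp only [Good, ofPred_forall]
  exact MeasurableSet.iInter fun k => MeasurableSet.iInter fun _ =>
    measurableSet_le measurable_const (by fun_prop)

/-- The plateau at `M + T` dominates all old values and the spike at `y` lies above it; outside the
plateau the old monotone branches survive. The point `y` is arbitrary, as a history may list any
positions. -/
theorem IsPeaked.update {u : ℝ → ℝ} {x M T y : ℝ} (h : IsPeaked u x M) (hv : 0 < v) (hT : 0 ≤ T)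
    {u' : ℝ → ℝ} (h1 : u' y = M + T + |y - x| / v)
    (h2 : ∀ s, s ≠ y → |s - x| ≤ |y - x| → u' s = M + T)
    (h3 : ∀ s, s ≠ y → |y - x| < |s - x| → u' s = u s) :
    IsPeaked u' y (M + T + |y - x| / v) := by
  have hle : ∀ s, s ≠ y → u' s ≤ M + T := by
    intro s hs
    rcases le_or_gt |s - x| |y - x| with hs' | hs'
    · exact (h2 s hs hs').le
    · rw [h3 s hs hs']; linarith [h.le s]
  have hlt : ∀ s, s ≠ y → u' s < M + T + |y - x| / v := by
    intro s hs
    -- If `y = x` the spike has no extra height, but the plateau is the single point `x`, and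
    -- strictness comes from the old peak.
    rcases eq_or_ne y x with rfl | hy
    · have := h.lt s hs
      rw [h3 s hs (by simpa [sub_eq_zero] using hs), sub_self, abs_zero, zero_div]
      linarith
    · have := div_pos (abs_pos.2 (sub_ne_zero.2 hy)) hv
      linarith [hle s hs]
  refine ⟨h1, hlt, ?_, ?_⟩
  · intro a ha b hb hab
    have ha : a < y := ha
    have hb : b < y := hb
    rcases le_or_gt |b - x| |y - x| with hb' | hb'
    · rw [h2 b hb.ne hb']; exact hle a ha.ne
    · have hbx : b < x := by
        by_contra hc
        rw [abs_of_nonneg (by linarith), abs_of_nonneg (by linarith)] at hb'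
        linarith
      have ha' : |y - x| < |a - x| := by
        rw [abs_of_neg (by linarith : a - x < 0)]
        rw [abs_of_neg (by linarith : b - x < 0)] at hb'
        linarith
      rw [h3 a ha.ne ha', h3 b hb.ne hb']
      exact h.mono (by simp; linarith) hbx hab
  · intro a ha b hb hab
    have ha : y < a := ha
    have hb : y < b := hb
    rcases le_or_gt |a - x| |y - x| with ha' | ha'
    · rw [h2 a ha.ne' ha']; exact hle b hb.ne'
    · have hax : x < a := by
        by_contra hc
        rw [abs_of_nonpos (by linarith), abs_of_nonpos (by linarith)] at ha'
        linarith
      have hb' : |y - x| < |b - x| := by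
        rw [abs_of_pos (by linarith : 0 < b - x)]
        rw [abs_of_pos (by linarith : 0 < a - x)] at ha'
        linarith
      rw [h3 a ha.ne' ha', h3 b hb.ne' hb']
      exact h.anti hax (by simp; linarith) hab

/-- Peak and height of the potential are the position and time computed from the history; the
comparison with the server rests on this identification. -/
theorem isPeaked_pot (hv : 0 < v) (hu₀ : IsPeaked u₀ 0 0) (hσ : σ ∈ Good n) :
    IsPeaked (pot v u₀ σ n) (pos σ n) (time v σ n) := by
  induction n with
  | zero => exact hu₀
  | succ n ih =>
    rw [good_succ_iff] at hσ
    refine (ih hσ.1).update (y := (σ n).2) hv hσ.2 ?_ ?_ ?_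
    · simp [pot, time]
    · intro s hs hs'
      simp [pot, hs, hs']
    · intro s hs hs'
      simp [pot, hs, not_le.2 hs']

theorem IsPeaked.step_eq {u : ℝ → ℝ} {x M : ℝ} (h : IsPeaked u x M) {w : ℝ × ℝ × ℝ}
    (hT : 0 ≤ w.1) (hE : 0 < w.2.1) (s : ℝ) :
    step v w u s = if s = newPoint w u then M + w.1 + |newPoint w u - x| / v
      else if |s - x| ≤ |newPoint w u - x| then M + w.1 else u s := by
  rw [h.abs_newPoint_sub hT hE, step, h.peak_eq, h.height_eq]
  have : s ∈ Icc (x - radius w.1 w.2.1 u) (x + radius w.1 w.2.1 u) ↔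
      |s - x| ≤ radius w.1 w.2.1 u := by
    rw [mem_Icc, abs_le]
    constructor <;> rintro ⟨h1, h2⟩ <;> constructor <;> linarith
  simp only [this]

/-! ### The law of the histories -/

/-- The absolute value on the radius keeps the interval oriented, so the area is a parametric
integral of a jointly measurable indicator. -/
theorem measurable_area (hu₀ : Measurable u₀) (n : ℕ) :
    Measurable fun q : (ℕ → ℝ × ℝ) × ℝ × ℝ =>
      area (pot v u₀ q.1 n) (pos q.1 n) (time v q.1 n) q.2.1 |q.2.2| := by
  have h1 := measurable_pos n
  have h2 := measurable_time (v := v) n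
  have h3 := measurable_pot (v := v) hu₀ n
  let f : ((ℕ → ℝ × ℝ) × ℝ × ℝ) × ℝ → ℝ :=
    {p | pos p.1.1 n - |p.1.2.2| < p.2 ∧ p.2 ≤ pos p.1.1 n + |p.1.2.2|}.indicator
      fun p => time v p.1.1 n + p.1.2.1 - pot v u₀ p.1.1 n p.2
  have hf : Measurable f := by
    refine Measurable.indicator ?_ ?_
    · have h4 : Measurable fun p : ((ℕ → ℝ × ℝ) × ℝ × ℝ) × ℝ => pot v u₀ p.1.1 n p.2 :=
        h3.comp (by fun_prop : Measurable fun p : ((ℕ → ℝ × ℝ) × ℝ × ℝ) × ℝ => (p.1.1, p.2))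
      fun_prop
    · have h5 : MeasurableSet {p : ((ℕ → ℝ × ℝ) × ℝ × ℝ) × ℝ | pos p.1.1 n - |p.1.2.2| < p.2} :=
        measurableSet_lt (by fun_prop) (by fun_prop)
      have h6 : MeasurableSet {p : ((ℕ → ℝ × ℝ) × ℝ × ℝ) × ℝ | p.2 ≤ pos p.1.1 n + |p.1.2.2|} :=
        measurableSet_le (by fun_prop) (by fun_prop)
      exact h5.inter h6
  have heq : (fun q : (ℕ → ℝ × ℝ) × ℝ × ℝ =>
      area (pot v u₀ q.1 n) (pos q.1 n) (time v q.1 n) q.2.1 |q.2.2|) =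
      fun q => ∫ s, f (q, s) := by
    funext q
    have hq : pos q.1 n - |q.2.2| ≤ pos q.1 n + |q.2.2| := by linarith [abs_nonneg q.2.2]
    rw [area, intervalIntegral.integral_of_le hq, ← integral_indicator measurableSet_Ioc]
    rfl
  rw [heq]
  exact hf.stronglyMeasurable.integral_prod_right'.measurable

/-- The density of the next service time and position, given the history. -/
def stepDensity (v : ℝ) (u₀ : ℝ → ℝ) (n : ℕ) (q : (ℕ → ℝ × ℝ) × ℝ × ℝ) : ℝ≥0∞ :=
  ENNReal.ofReal (time v q.1 n + q.2.1 - pot v u₀ q.1 n q.2.2) * ENNReal.ofReal (Real.exp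
    (-area (pot v u₀ q.1 n) (pos q.1 n) (time v q.1 n) q.2.1 |q.2.2 - pos q.1 n|))

theorem measurable_stepDensity (hu₀ : Measurable u₀) (n : ℕ) :
    Measurable (stepDensity v u₀ n) := by
  have h1 := measurable_pos n
  have h2 := measurable_time (v := v) n
  have h3 : Measurable fun q : (ℕ → ℝ × ℝ) × ℝ × ℝ => pot v u₀ q.1 n q.2.2 :=
    (measurable_pot (v := v) hu₀ n).comp
      (by fun_prop : Measurable fun q : (ℕ → ℝ × ℝ) × ℝ × ℝ => (q.1, q.2.2))
  have h4 : Measurable fun q : (ℕ → ℝ × ℝ) × ℝ × ℝ =>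
      area (pot v u₀ q.1 n) (pos q.1 n) (time v q.1 n) q.2.1 |q.2.2 - pos q.1 n| :=
    (measurable_area (v := v) hu₀ n).comp (by fun_prop :
      Measurable fun q : (ℕ → ℝ × ℝ) × ℝ × ℝ => (q.1, q.2.1, q.2.2 - pos q.1 n))
  unfold stepDensity
  fun_prop

/-- The law of the first `n` service times and new positions, continued by zeros. -/
def historyLaw (v : ℝ) (u₀ : ℝ → ℝ) (τ : Measure ℝ) : ℕ → Measure (ℕ → ℝ × ℝ)
  | 0 => Measure.dirac 0
  | n + 1 => (((historyLaw v u₀ τ n).prod (τ.prod volume)).withDensity (stepDensity v u₀ n)).map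
      fun q => Function.update q.1 n q.2

theorem measurable_update_history (n : ℕ) :
    Measurable fun q : (ℕ → ℝ × ℝ) × ℝ × ℝ => Function.update q.1 n q.2 := by
  refine measurable_pi_lambda _ fun k => ?_
  by_cases hk : k = n
  · subst hk; simpa using measurable_snd
  · simp only [Function.update_of_ne hk]
    fun_prop

variable {τ : Measure ℝ}

theorem lintegral_historyLaw_succ [SFinite τ] (hu₀ : Measurable u₀) (n : ℕ)
    {f : (ℕ → ℝ × ℝ) → ℝ≥0∞} (hf : Measurable f) :
    ∫⁻ σ, f σ ∂(historyLaw v u₀ τ (n + 1)) = ∫⁻ σ, (∫⁻ T, (∫⁻ y, stepDensity v u₀ n (σ, T, y) *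
      f (Function.update σ n (T, y))) ∂τ) ∂(historyLaw v u₀ τ n) := by
  have hd := measurable_stepDensity (v := v) hu₀ n
  have hfu : Measurable fun q : (ℕ → ℝ × ℝ) × ℝ × ℝ => f (Function.update q.1 n q.2) :=
    hf.comp (measurable_update_history n)
  rw [historyLaw, lintegral_map hf (measurable_update_history n),
    lintegral_withDensity_eq_lintegral_mul _ hd hfu, lintegral_prod _ (hd.mul hfu).aemeasurable]
  refine lintegral_congr fun σ => ?_
  exact lintegral_prod _ ((hd.mul hfu).comp measurable_prodMk_left).aemeasurable

open Classical in
/-- The new point, made measurable by the value `0` outside the good histories. -/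
def nextPoint (v : ℝ) (u₀ : ℝ → ℝ) (n : ℕ) (q : (ℕ → ℝ × ℝ) × ℝ × ℝ × ℝ) : ℝ :=
  if q.1 ∈ Good n ∧ 0 ≤ q.2.1 ∧ 0 < q.2.2.1 then newPoint q.2 (pot v u₀ q.1 n) else 0

/-- The condition `radius ≤ r` amounts to `E ≤ area r`, a comparison of measurable functions. The
default `0` keeps this valid outside the good inputs. -/
theorem measurable_nextPoint (hv : 0 < v) (hu₀ : IsPeaked u₀ 0 0) (n : ℕ) :
    Measurable (nextPoint v u₀ n) := by
  classical
  have h1 := measurable_pos n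
  have h2 := measurable_time (v := v) n
  let G : Set ((ℕ → ℝ × ℝ) × ℝ × ℝ × ℝ) := {q | q.1 ∈ Good n ∧ 0 ≤ q.2.1 ∧ 0 < q.2.2.1}
  have hG : MeasurableSet G := by
    have h3 : MeasurableSet {q : (ℕ → ℝ × ℝ) × ℝ × ℝ × ℝ | 0 ≤ q.2.1} :=
      measurableSet_le measurable_const (by fun_prop)
    have h4 : MeasurableSet {q : (ℕ → ℝ × ℝ) × ℝ × ℝ × ℝ | 0 < q.2.2.1} :=
      measurableSet_lt measurable_const (by fun_prop)
    exact (measurable_fst (measurableSet_good n)).inter (h3.inter h4)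
  let ρ : ((ℕ → ℝ × ℝ) × ℝ × ℝ × ℝ) → ℝ := fun q =>
    if q ∈ G then radius q.2.1 q.2.2.1 (pot v u₀ q.1 n) else 0
  have hρ : Measurable ρ := by
    refine measurable_of_Iic fun r => ?_
    by_cases hr : 0 ≤ r
    · have : ρ ⁻¹' Iic r = Gᶜ ∪ (G ∩ {q | q.2.2.1 ≤
          area (pot v u₀ q.1 n) (pos q.1 n) (time v q.1 n) q.2.1 |r|}) := by
        ext q
        by_cases hq : q ∈ G
        · have := (isPeaked_pot hv hu₀ hq.1).radius_le_iff hq.2.1 hq.2.2 hr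
          simp [ρ, hq, this, abs_of_nonneg hr]
        · simp [ρ, hq, hr]
      rw [this]
      refine hG.compl.union (hG.inter (measurableSet_le (by fun_prop) ?_))
      exact (measurable_area hu₀.measurable n).comp (by fun_prop :
        Measurable fun q : (ℕ → ℝ × ℝ) × ℝ × ℝ × ℝ => (q.1, q.2.1, r))
    · have : ρ ⁻¹' Iic r = ∅ := by
        refine eq_empty_of_forall_notMem fun q hq => hr (le_trans ?_ hq)
        by_cases hq : q ∈ G
        · simpa [ρ, hq] using ((isPeaked_pot hv hu₀ hq.1).radius_spec hq.2.1 hq.2.2).1.le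
        · simp [ρ, hq]
      rw [this]; exact MeasurableSet.empty
  have hpot : ∀ g : (ℕ → ℝ × ℝ) × ℝ × ℝ × ℝ → ℝ, Measurable g →
      Measurable fun q : (ℕ → ℝ × ℝ) × ℝ × ℝ × ℝ => pot v u₀ q.1 n (g q) := fun g hg =>
    (measurable_pot (v := v) hu₀.measurable n).comp (measurable_fst.prodMk hg)
  have hm := hpot (fun q => pos q.1 n - ρ q) (by fun_prop)
  have hp := hpot (fun q => pos q.1 n + ρ q) (by fun_prop)
  have heq : nextPoint v u₀ n = fun q => if q ∈ G then
      (if q.2.2.2 ≤ (time v q.1 n + q.2.1 - pot v u₀ q.1 n (pos q.1 n - ρ q)) /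
        ((time v q.1 n + q.2.1 - pot v u₀ q.1 n (pos q.1 n - ρ q)) +
          (time v q.1 n + q.2.1 - pot v u₀ q.1 n (pos q.1 n + ρ q)))
        then pos q.1 n - ρ q else pos q.1 n + ρ q) else 0 := by
    funext q
    by_cases hq : q ∈ G
    · have hρq : ρ q = radius q.2.1 q.2.2.1 (pot v u₀ q.1 n) := if_pos hq
      rw [if_pos hq, hρq, ← (isPeaked_pot hv hu₀ hq.1).newPoint_eq]
      exact if_pos hq
    · rw [if_neg hq]; exact if_neg hq
  rw [heq]
  refine Measurable.ite hG (Measurable.ite (measurableSet_le ?_ ?_) ?_ ?_) measurable_const <;>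
    fun_prop

/-- The history generated by the triples `w`, up to `n` and continued by zeros. -/
def history (v : ℝ) (u₀ : ℝ → ℝ) (w : ℕ → ℝ × ℝ × ℝ) : ℕ → (ℕ → ℝ × ℝ)
  | 0 => 0
  | n + 1 => Function.update (history v u₀ w n) n
      ((w n).1, nextPoint v u₀ n (history v u₀ w n, w n))

theorem measurable_history (hv : 0 < v) (hu₀ : IsPeaked u₀ 0 0) (n : ℕ) :
    Measurable fun w : ℕ → ℝ × ℝ × ℝ => history v u₀ w n := by
  induction n with
  | zero => exact measurable_const
  | succ n ih =>
    have h1 := measurable_nextPoint hv hu₀ n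
    exact (measurable_update_history n).comp (by fun_prop : Measurable fun w : ℕ → ℝ × ℝ × ℝ =>
      (history v u₀ w n, (w n).1, nextPoint v u₀ n (history v u₀ w n, w n)))

theorem history_congr {w w' : ℕ → ℝ × ℝ × ℝ} (h : ∀ k < n, w k = w' k) :
    history v u₀ w n = history v u₀ w' n := by
  induction n with
  | zero => rfl
  | succ n ih =>
    rw [history, history, ih fun k hk => h k (hk.trans n.lt_succ_self), h n n.lt_succ_self]

theorem history_agree (w : ℕ → ℝ × ℝ × ℝ) {m : ℕ} (hnm : n ≤ m) :
    ∀ k < n, history v u₀ w m k = history v u₀ w n k := by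
  induction m, hnm using Nat.le_induction with
  | base => exact fun _ _ => rfl
  | succ m hm ih => exact fun k hk => (update_agree _ m _ k (hk.trans_le hm)).trans (ih k hk)

/-- The dictionary between potentials and histories: iterating the operator is the same as recording
service times and new points and rebuilding the potential from them. -/
theorem history_good_and_potentialSeq_eq (hv : 0 < v) (hu₀ : IsPeaked u₀ 0 0)
    {w : ℕ → ℝ × ℝ × ℝ} (hw : ∀ k, 0 ≤ (w k).1 ∧ 0 < (w k).2.1) (n : ℕ) :
    history v u₀ w n ∈ Good n ∧ potentialSeq v u₀ w n = pot v u₀ (history v u₀ w n) n := by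
  induction n with
  | zero => exact ⟨fun k hk => absurd hk k.not_lt_zero, rfl⟩
  | succ n ih =>
    obtain ⟨hg, hp⟩ := ih
    have hpk := isPeaked_pot hv hu₀ hg
    have hnext : nextPoint v u₀ n (history v u₀ w n, w n) =
        newPoint (w n) (pot v u₀ (history v u₀ w n) n) := if_pos ⟨hg, hw n⟩
    set σ := history v u₀ w n
    have hhist : history v u₀ w (n + 1) = Function.update σ n
        ((w n).1, newPoint (w n) (pot v u₀ σ n)) := by rw [history, hnext]
    have hagree := update_agree σ n ((w n).1, newPoint (w n) (pot v u₀ σ n))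
    refine ⟨?_, ?_⟩
    · rw [hhist, good_succ_iff, good_congr hagree, Function.update_self]
      exact ⟨hg, (hw n).1⟩
    · rw [potentialSeq, hp, hhist]
      funext s
      rw [hpk.step_eq (hw n).1 (hw n).2]
      simp only [pot, time]
      rw [pos_congr hagree, time_congr hagree, pot_congr hagree, Function.update_self]

variable {Ω' : Type*} [MeasurableSpace Ω'] {P' : Measure Ω'} {w : ℕ → Ω' → ℝ × ℝ × ℝ}

theorem ae_expMeasure_pos : ∀ᵐ E ∂(expMeasure 1), 0 < E := by
  have : expMeasure 1 (Iic 0) = 0 := by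
    rw [← lintegral_indicator_one measurableSet_Iic, lintegral_expMeasure]
    refine (setLIntegral_congr_fun measurableSet_Ioi fun E hE => ?_).trans lintegral_zero
    rw [indicator_of_notMem (by simpa using hE), mul_zero]
  filter_upwards [measure_eq_zero_iff_ae_notMem.1 this] with E hE
  simpa using hE

theorem ae_triple [SFinite τ] (hτ : ∀ᵐ s ∂τ, 0 ≤ s)
    (hw_law : ∀ n, HasLaw (w n)
      (τ.prod ((expMeasure 1).prod (volume.restrict (Icc (0 : ℝ) 1)))) P') :
    ∀ᵐ ω ∂P', ∀ k, 0 ≤ (w k ω).1 ∧ 0 < (w k ω).2.1 := by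
  have := isProbabilityMeasure_expMeasure one_pos
  have h1 : ∀ᵐ q ∂(τ.prod ((expMeasure 1).prod (volume.restrict (Icc (0 : ℝ) 1)))), 0 ≤ q.1 :=
    Measure.quasiMeasurePreserving_fst.ae hτ
  have h2 : ∀ᵐ q ∂(τ.prod ((expMeasure 1).prod (volume.restrict (Icc (0 : ℝ) 1)))), 0 < q.2.1 :=
    Measure.quasiMeasurePreserving_snd.ae (Measure.quasiMeasurePreserving_fst.ae ae_expMeasure_pos)
  rw [ae_all_iff]
  intro k
  rw [← (hw_law k).map_eq] at h1 h2
  exact (ae_of_ae_map (hw_law k).aemeasurable h1).and (ae_of_ae_map (hw_law k).aemeasurable h2)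

/-- Each new triple is independent of the history so far, and for a fixed history and service time
the next point has the density of `IsPeaked.lintegral_newPoint`, which is `stepDensity`. -/
theorem hasLaw_history [IsProbabilityMeasure P'] [IsProbabilityMeasure τ] (hv : 0 < v)
    (hu₀ : IsPeaked u₀ 0 0) (hτ : ∀ᵐ s ∂τ, 0 ≤ s)
    (hw_law : ∀ n, HasLaw (w n)
      (τ.prod ((expMeasure 1).prod (volume.restrict (Icc (0 : ℝ) 1)))) P')
    (hw_indep : iIndepFun w P') (n : ℕ) :
    HasLaw (fun ω => history v u₀ (fun k => w k ω) n) (historyLaw v u₀ τ n) P' := by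
  have hexp := isProbabilityMeasure_expMeasure one_pos
  have hwm : ∀ k, AEMeasurable (w k) P' := fun k => (hw_law k).aemeasurable
  have hmeas : ∀ n, AEMeasurable (fun ω => history v u₀ (fun k => w k ω) n) P' := fun n =>
    (measurable_history hv hu₀ n).comp_aemeasurable (aemeasurable_pi_lambda _ hwm)
  induction n with
  | zero =>
    refine ⟨hmeas 0, ?_⟩
    change P'.map (fun _ => (0 : ℕ → ℝ × ℝ)) = _
    rw [Measure.map_const, measure_univ, one_smul]
    rfl
  | succ n ih =>
    refine ⟨hmeas (n + 1), Measure.ext_of_lintegral _ fun f hf => ?_⟩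
    have hind : IndepFun (fun ω => history v u₀ (fun k => w k ω) n) (w n) P' := by
      have h1 := hw_indep.indepFun_finset₀ (Finset.range n) {n} (by simp) hwm
      -- Padding the first `n` triples by zeros does not change the history up to `n`, and exhibits
      -- it as a function of those triples alone.
      let e : (Finset.range n → ℝ × ℝ × ℝ) → ℕ → ℝ × ℝ × ℝ := fun a k =>
        if h : k ∈ Finset.range n then a ⟨k, h⟩ else 0
      have he : Measurable e := by
        refine measurable_pi_lambda _ fun k => ?_
        by_cases h : k ∈ Finset.range n
        · simp only [e, dif_pos h]
          exact measurable_pi_apply _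
        · simp only [e, dif_neg h]
          exact measurable_const
      have h2 := h1.comp ((measurable_history hv hu₀ n).comp he)
        (measurable_pi_apply (⟨n, Finset.mem_singleton_self n⟩ : ({n} : Finset ℕ)))
      refine h2.congr (Eventually.of_forall fun ω => ?_) (Eventually.of_forall fun ω => rfl)
      refine history_congr fun k hk => ?_
      simp [e, hk]
    have hgood : ∀ᵐ σ ∂(historyLaw v u₀ τ n), σ ∈ Good n := by
      rw [← ih.map_eq]
      refine (ae_map_iff (p := (· ∈ Good n)) (hmeas n) (measurableSet_good n)).2 ?_
      filter_upwards [ae_triple hτ hw_law] with ω hω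
      exact (history_good_and_potentialSeq_eq hv hu₀ hω n).1
    let g : (ℕ → ℝ × ℝ) × ℝ × ℝ × ℝ → ℝ≥0∞ := fun q =>
      f (Function.update q.1 n (q.2.1, nextPoint v u₀ n q))
    have hg : Measurable g := by
      have h1 := measurable_nextPoint hv hu₀ n
      exact hf.comp ((measurable_update_history n).comp (by fun_prop :
        Measurable fun q : (ℕ → ℝ × ℝ) × ℝ × ℝ × ℝ => (q.1, q.2.1, nextPoint v u₀ n q)))
    have hL : ∫⁻ σ, f σ ∂(P'.map fun ω => history v u₀ (fun k => w k ω) (n + 1)) =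
        ∫⁻ q, g q ∂((historyLaw v u₀ τ n).prod
          (τ.prod ((expMeasure 1).prod (volume.restrict (Icc (0 : ℝ) 1))))) := by
      rw [lintegral_map' hf.aemeasurable (hmeas (n + 1)), ← ih.map_eq, ← (hw_law n).map_eq,
        ← hind.map_prod_eq_prod_map_map (hmeas n) (hwm n),
        lintegral_map' hg.aemeasurable ((hmeas n).prodMk (hwm n))]
      rfl
    rw [hL, lintegral_prod _ hg.aemeasurable,
      lintegral_historyLaw_succ hu₀.measurable n hf]
    refine lintegral_congr_ae ?_
    filter_upwards [hgood] with σ hσ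
    have hg1 : Measurable fun q => g (σ, q) := hg.comp measurable_prodMk_left
    rw [lintegral_prod _ hg1.aemeasurable]
    refine lintegral_congr_ae ?_
    filter_upwards [hτ] with T hT
    have hg2 : Measurable fun q => g (σ, T, q) := hg1.comp measurable_prodMk_left
    rw [lintegral_prod _ hg2.aemeasurable]
    have hpk := isPeaked_pot hv hu₀ hσ
    have hφ : Measurable fun y => f (Function.update σ n (T, y)) :=
      hf.comp ((measurable_update_history n).comp (by fun_prop :
        Measurable fun y : ℝ => (σ, T, y)))
    refine Eq.trans ?_ (hpk.lintegral_newPoint hT hφ)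
    refine lintegral_congr_ae ?_
    filter_upwards [ae_expMeasure_pos] with E hE
    refine lintegral_congr fun U => ?_
    have : nextPoint v u₀ n (σ, T, E, U) = newPoint (T, E, U) (pot v u₀ σ n) :=
      if_pos ⟨hσ, hT, hE⟩
    simp only [g, this]

end

end GreedyServer

namespace GreedyServer

noncomputable section

variable {v : ℝ} {u₀ : ℝ → ℝ} {σ σ' : ℕ → ℝ × ℝ} {n : ℕ} {τ : Measure ℝ}

/-! ### The explored region -/

/-- The customers (given by position and arrival time) that would have been preferred at one of the
first `n` choices. -/
def region (v : ℝ) (n : ℕ) (σ : ℕ → ℝ × ℝ) : Set (ℝ × ℝ) :=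
  {q | ∃ j < n, |q.1 - pos σ j| < |(σ j).2 - pos σ j| ∧ q.2 < time v σ j + (σ j).1}

theorem region_congr (h : ∀ k < n, σ k = σ' k) : region v n σ = region v n σ' := by
  ext q
  refine exists_congr fun j => and_congr_right fun hj => ?_
  have h' : ∀ k < j, σ k = σ' k := fun k hk => h k (hk.trans hj)
  rw [h j hj, pos_congr h', time_congr h']

theorem mem_region_succ {q : ℝ × ℝ} : q ∈ region v (n + 1) σ ↔
    q ∈ region v n σ ∨ |q.1 - pos σ n| < |(σ n).2 - pos σ n| ∧ q.2 < time v σ n + (σ n).1 := by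
  constructor
  · rintro ⟨j, hj, h⟩
    rcases Nat.lt_succ_iff_lt_or_eq.1 hj with hj | rfl
    exacts [Or.inl ⟨j, hj, h⟩, Or.inr h]
  · rintro (⟨j, hj, h⟩ | h)
    exacts [⟨j, hj.trans n.lt_succ_self, h⟩, ⟨n, n.lt_succ_self, h⟩]

theorem continuous_pos (n : ℕ) : Continuous fun σ : ℕ → ℝ × ℝ => pos σ n := by
  cases n with
  | zero => exact continuous_const
  | succ n => exact continuous_snd.comp (continuous_apply n)

theorem continuous_time (n : ℕ) : Continuous fun σ : ℕ → ℝ × ℝ => time v σ n := by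
  induction n with
  | zero => exact continuous_const
  | succ n ih =>
    have := continuous_pos n
    simp only [time]
    fun_prop

theorem isOpen_region (v : ℝ) (n : ℕ) :
    IsOpen {p : (ℕ → ℝ × ℝ) × ℝ × ℝ | p.2 ∈ region v n p.1} := by
  have : {p : (ℕ → ℝ × ℝ) × ℝ × ℝ | p.2 ∈ region v n p.1} = ⋃ j, ⋃ (_ : j < n),
      {p : (ℕ → ℝ × ℝ) × ℝ × ℝ | |p.2.1 - pos p.1 j| < |(p.1 j).2 - pos p.1 j|} ∩
      {p : (ℕ → ℝ × ℝ) × ℝ × ℝ | p.2.2 < time v p.1 j + (p.1 j).1} := by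
    ext p
    simp only [region, mem_ofPred_eq, mem_iUnion, mem_inter_iff, exists_prop]
  rw [this]
  refine isOpen_iUnion fun j => isOpen_iUnion fun _ => ?_
  have h1 := continuous_pos j
  have h2 := continuous_time (v := v) j
  exact (isOpen_lt (by fun_prop) (by fun_prop)).inter (isOpen_lt (by fun_prop) (by fun_prop))

theorem measurableSet_region (v : ℝ) (n : ℕ) (σ : ℕ → ℝ × ℝ) : MeasurableSet (region v n σ) :=
  ((isOpen_region v n).preimage (by fun_prop : Continuous fun q : ℝ × ℝ => (σ, q))).measurableSet

theorem time_le_succ (hv : 0 < v) (n : ℕ) (σ : ℕ → ℝ × ℝ) :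
    time v σ n + (σ n).1 ≤ time v σ (n + 1) := by
  have : 0 ≤ |(σ n).2 - pos σ n| / v := by positivity
  rw [time]; linarith

theorem time_le (hv : 0 < v) (hσ : σ ∈ Good n) {j : ℕ} (hj : j < n) :
    time v σ j + (σ j).1 ≤ time v σ n := by
  induction n with
  | zero => exact absurd hj j.not_lt_zero
  | succ n ih =>
    rw [good_succ_iff] at hσ
    rcases Nat.lt_succ_iff_lt_or_eq.1 hj with hj | rfl
    · linarith [ih hσ.1 hj, time_le_succ hv n σ, hσ.2]
    · exact time_le_succ hv j σ

theorem time_nonneg (hv : 0 < v) (hσ : σ ∈ Good n) : 0 ≤ time v σ n := by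
  induction n with
  | zero => exact le_rfl
  | succ n ih =>
    rw [good_succ_iff] at hσ
    linarith [ih hσ.1, time_le_succ hv n σ, hσ.2]

/-- The intensity of the unexplored customers at position `s` that arrive up to time `c`. -/
theorem fiber_intensity (hv : 0 < v) (hu₀ : ∀ s, u₀ s ≤ 0) (hσ : σ ∈ Good n) {c s : ℝ}
    (hc : time v σ n ≤ c) (hs : ∀ k < n, |s - pos σ k| ≠ |(σ k).2 - pos σ k|) :
    ENNReal.ofReal (-u₀ s) * (region v n σ)ᶜ.indicator 1 (s, (-1 : ℝ)) +
      volume (Ioc 0 c \ {r | (s, r) ∈ region v n σ}) = ENNReal.ofReal (c - pot v u₀ σ n s) := by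
  induction n with
  | zero =>
    have h0 : region v 0 σ = ∅ := eq_empty_of_forall_notMem fun q ⟨j, hj, _⟩ => j.not_lt_zero hj
    have hc : 0 ≤ c := hc
    simp only [h0, pot]
    rw [indicator_of_mem (by simp)]
    have h1 : {r : ℝ | (s, r) ∈ (∅ : Set (ℝ × ℝ))} = ∅ := by ext; simp
    rw [h1, sdiff_empty, Real.volume_Ioc, Pi.one_apply, mul_one,
      ← ENNReal.ofReal_add (by linarith [hu₀ s]) (by linarith)]
    congr 1; ring
  | succ n ih =>
    have hσ' := good_succ_iff.1 hσ
    have hsy : s ≠ (σ n).2 := fun h => hs n n.lt_succ_self (by rw [h])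
    have hb := time_le_succ hv n σ
    have ht := time_nonneg hv hσ'.1
    -- A column within reach of the last choice is explored exactly below the time of that choice,
    -- which is the new value of the potential there. A column out of reach is unaffected.
    rcases lt_or_gt_of_ne (hs n n.lt_succ_self) with hlt | hgt
    · have hmem : ∀ r, (s, r) ∈ region v (n + 1) σ ↔ r < time v σ n + (σ n).1 := by
        intro r
        rw [mem_region_succ]
        constructor
        · rintro (⟨j, hj, -, h⟩ | ⟨-, h⟩)
          · exact h.trans_le ((time_le hv hσ'.1 hj).trans (by linarith [hσ'.2]))
          · exact h
        · exact fun h => Or.inr ⟨hlt, h⟩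
      rw [indicator_of_notMem (notMem_compl_iff.2 ((hmem _).2 (by linarith [hσ'.2]))),
        mul_zero, zero_add]
      have hset : {r | (s, r) ∈ region v (n + 1) σ} = Iio (time v σ n + (σ n).1) := ext hmem
      have hpot : pot v u₀ σ (n + 1) s = time v σ n + (σ n).1 := by simp [pot, hsy, hlt.le]
      rw [hset, hpot, ← Real.volume_Ioc]
      refine measure_congr ?_
      have hnull : ∀ᵐ r : ℝ, r ≠ time v σ n + (σ n).1 := by simp [ae_iff]
      filter_upwards [hnull] with r hr
      refine propext ?_
      change (r ∈ Ioc 0 c ∧ ¬ r < _) ↔ r ∈ Ioc _ _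
      rw [mem_Ioc, mem_Ioc, not_lt]
      constructor
      · exact fun h => ⟨lt_of_le_of_ne h.2 hr.symm, h.1.2⟩
      · exact fun h => ⟨⟨lt_of_le_of_lt (by linarith [hσ'.2]) h.1, h.2⟩, h.1.le⟩
    · have hmem : ∀ r, (s, r) ∈ region v (n + 1) σ ↔ (s, r) ∈ region v n σ := by
        intro r
        rw [mem_region_succ]
        exact or_iff_left fun h => absurd h.1 (not_lt.2 hgt.le)
      have hpot : pot v u₀ σ (n + 1) s = pot v u₀ σ n s := by simp [pot, hsy, not_le.2 hgt]
      rw [hpot, ← ih hσ'.1 (by linarith [hσ'.2]) fun k hk => hs k (hk.trans n.lt_succ_self)]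
      simp only [hmem]
      congr 2
      by_cases h : (s, (-1 : ℝ)) ∈ region v n σ
      · rw [indicator_of_notMem (notMem_compl_iff.2 h),
          indicator_of_notMem (notMem_compl_iff.2 ((hmem _).2 h))]
      · rw [indicator_of_mem (mem_compl h),
          indicator_of_mem (mem_compl fun h' => h ((hmem _).1 h'))]

/-! ### The intensity measure -/

/-- The intensity measure of the customers present at time `0`. -/
def initMeasure (u₀ : ℝ → ℝ) : Measure ℝ := volume.withDensity fun x => ENNReal.ofReal (-u₀ x)

theorem lintegral_intensity (hu₀ : Measurable u₀) {F : ℝ × ℝ → ℝ≥0∞} (hF : Measurable F) :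
    ∫⁻ p, F p ∂(intensity (initMeasure u₀)) =
      ∫⁻ s, (ENNReal.ofReal (-u₀ s) * F (s, -1) + ∫⁻ r in Ioi (0 : ℝ), F (s, r)) := by
  have hF1 : Measurable fun s : ℝ => F (s, -1) := hF.comp (by fun_prop)
  have hset : {p : ℝ × ℝ | 0 < p.2} = univ ×ˢ Ioi 0 := by ext p; simp
  rw [intensity, lintegral_add_measure, lintegral_map hF (by fun_prop), initMeasure,
    lintegral_withDensity_eq_lintegral_mul _ (by fun_prop) hF1, hset, Measure.volume_eq_prod,
    ← Measure.prod_restrict, Measure.restrict_univ, lintegral_prod _ hF.aemeasurable,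
    lintegral_add_left (by fun_prop)]
  rfl

theorem initMeasure_Icc_lt_top {u : ℝ → ℝ} {x M : ℝ} (h : IsPeaked u x M) (a b : ℝ) :
    initMeasure u (Icc a b) < ∞ := by
  rw [initMeasure, withDensity_apply _ measurableSet_Icc]
  rcases le_or_gt a b with hab | hab
  · have := ((intervalIntegrable_iff_integrableOn_Icc_of_le hab).1
      (h.intervalIntegrable a b)).neg
    exact this.lintegral_lt_top
  · simp [Icc_eq_empty (not_le.2 hab)]

theorem isLocallyFiniteMeasure_intensity {x M : ℝ} (h : IsPeaked u₀ x M) :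
    IsLocallyFiniteMeasure (intensity (initMeasure u₀)) := by
  refine ⟨fun p => ⟨Icc (p.1 - 1) (p.1 + 1) ×ˢ Icc (p.2 - 1) (p.2 + 1), ?_, ?_⟩⟩
  · exact prod_mem_nhds (Icc_mem_nhds (by linarith) (by linarith))
      (Icc_mem_nhds (by linarith) (by linarith))
  · rw [intensity_apply _ (measurableSet_Icc.prod measurableSet_Icc)]
    refine ENNReal.add_lt_top.2 ⟨?_, ?_⟩
    · exact (measure_mono fun s hs => hs.1).trans_lt (initMeasure_Icc_lt_top h _ _)
    · refine (Measure.restrict_apply_le _ _).trans_lt ((measure_mono inter_subset_left).trans_lt ?_)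
      rw [Measure.volume_eq_prod, Measure.prod_prod]
      exact ENNReal.mul_lt_top measure_Icc_lt_top measure_Icc_lt_top

theorem nullSingletonClass_intensity : NullSingletonClass (intensity (initMeasure u₀)) := by
  refine ⟨fun p => ?_⟩
  rw [intensity_apply _ (measurableSet_singleton p), add_eq_zero]
  refine ⟨measure_mono_null (t := {p.1}) (fun s hs => ?_) ?_, ?_⟩
  · exact congrArg Prod.fst hs
  · exact withDensity_absolutelyContinuous _ _ (by simp)
  · exact measure_mono_null inter_subset_left
      (Measure.absolutelyContinuous_of_le Measure.restrict_le_self (by simp))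

/-- At an edge column the strict inequality in `region` and the weak one in `pot` disagree, so
finitely many positions are discarded. -/
theorem ae_ne_boundary (σ : ℕ → ℝ × ℝ) (n : ℕ) :
    ∀ᵐ s : ℝ, ∀ k < n, |s - pos σ k| ≠ |(σ k).2 - pos σ k| := by
  rw [ae_all_iff]; intro k
  have h : ∀ᵐ s : ℝ, s ≠ pos σ k + |(σ k).2 - pos σ k| ∧ s ≠ pos σ k - |(σ k).2 - pos σ k| := by
    rw [eventually_and]
    exact ⟨by simp [ae_iff], by simp [ae_iff]⟩
  filter_upwards [h] with s hs _ heq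
  rcases abs_choice (s - pos σ k) with h' | h'
  · exact hs.1 (by linarith)
  · exact hs.2 (by linarith)

/-- Integration over columns by `fiber_intensity`. It replaces a sum over unexplored customers by
the position density `c - pot`. -/
theorem lintegral_unexplored (hv : 0 < v) (hu₀ : IsPeaked u₀ 0 0) (hσ : σ ∈ Good n) {c : ℝ}
    (hc : time v σ n ≤ c) {φ : ℝ → ℝ≥0∞} (hφ : Measurable φ) :
    ∫⁻ p, {p | p.2 ≤ c ∧ p ∉ region v n σ}.indicator (fun p => φ p.1) p
      ∂(intensity (initMeasure u₀)) = ∫⁻ s, ENNReal.ofReal (c - pot v u₀ σ n s) * φ s := by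
  have hcm : MeasurableSet {p : ℝ × ℝ | p.2 ≤ c} := measurableSet_le measurable_snd measurable_const
  have hset : MeasurableSet {p | p.2 ≤ c ∧ p ∉ region v n σ} :=
    hcm.inter (measurableSet_region v n σ).compl
  have hφ' : Measurable fun p : ℝ × ℝ => φ p.1 := hφ.comp measurable_fst
  rw [lintegral_intensity hu₀.measurable (hφ'.indicator hset)]
  refine lintegral_congr_ae ?_
  filter_upwards [ae_ne_boundary σ n] with s hs
  rw [← fiber_intensity hv hu₀.le hσ hc hs, add_mul]
  have hc0 := (time_nonneg hv hσ).trans hc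
  congr 1
  · by_cases h : (s, (-1 : ℝ)) ∈ region v n σ
    · rw [indicator_of_notMem (fun h' => h'.2 h), indicator_of_notMem (notMem_compl_iff.2 h)]
      simp
    · have hmem : (s, (-1 : ℝ)) ∈ {p : ℝ × ℝ | p.2 ≤ c ∧ p ∉ region v n σ} :=
        ⟨(by linarith : (-1 : ℝ) ≤ c), h⟩
      rw [indicator_of_mem hmem, indicator_of_mem (mem_compl h)]
      simp
  · have hm : MeasurableSet {r | (s, r) ∈ region v n σ} :=
      (by fun_prop : Measurable fun r : ℝ => (s, r)) (measurableSet_region v n σ)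
    have hB : MeasurableSet ({r | r ≤ c} \ {r | (s, r) ∈ region v n σ}) :=
      measurableSet_Iic.diff hm
    have e1 : ∀ r, {p | p.2 ≤ c ∧ p ∉ region v n σ}.indicator (fun p => φ p.1) (s, r) =
        ({r | r ≤ c} \ {r | (s, r) ∈ region v n σ}).indicator (fun _ => φ s) r := fun r => rfl
    simp_rw [e1]
    rw [lintegral_indicator_const hB, Measure.restrict_apply hB, mul_comm]
    congr 2
    ext r
    exact ⟨fun h => ⟨⟨h.2, h.1.1⟩, h.1.2⟩, fun h => ⟨⟨h.1.2, h.2⟩, h.1.1⟩⟩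

theorem intensity_horizontal (c : ℝ) (hc : 0 ≤ c) :
    intensity (initMeasure u₀) {p | p.2 = c} = 0 := by
  have hm : MeasurableSet {p : ℝ × ℝ | p.2 = c} :=
    measurableSet_eq_fun measurable_snd measurable_const
  rw [intensity_apply _ hm, add_eq_zero]
  refine ⟨?_, measure_mono_null inter_subset_left
    (Measure.absolutelyContinuous_of_le Measure.restrict_le_self ?_)⟩
  · have : (fun x : ℝ => (x, (-1 : ℝ))) ⁻¹' {p | p.2 = c} = ∅ :=
      eq_empty_of_forall_notMem fun x (hx : (-1 : ℝ) = c) => by linarith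
    rw [this, measure_empty]
  · have : {p : ℝ × ℝ | p.2 = c} = univ ×ˢ {c} := by ext p; simp
    rw [this, Measure.volume_eq_prod, Measure.prod_prod]
    simp

theorem IsPeaked.area_nonneg {u : ℝ → ℝ} {x M T r : ℝ} (h : IsPeaked u x M) (hT : 0 ≤ T)
    (hr : 0 ≤ r) : 0 ≤ area u x M T r :=
  intervalIntegral.integral_nonneg (by linarith) fun s _ => h.sub_nonneg hT s

/-- The intensity of the customers newly explored by one more choice. -/
theorem intensity_slab (hv : 0 < v) (hu₀ : IsPeaked u₀ 0 0) (hσ : σ ∈ Good n) {T z : ℝ}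
    (hT : 0 ≤ T) (hz : 0 ≤ z) :
    intensity (initMeasure u₀) ({q | |q.1 - pos σ n| < z ∧ q.2 < time v σ n + T} \ region v n σ) =
      ENNReal.ofReal (area (pot v u₀ σ n) (pos σ n) (time v σ n) T z) := by
  have hpk := isPeaked_pot hv hu₀ hσ
  set c := time v σ n + T
  have hc0 : 0 ≤ c := add_nonneg (time_nonneg hv hσ) hT
  -- The strict and the weak time bound differ on the line at height `c`, which is null since `c ≥
  -- 0` avoids the mass at `-1`.
  have hae : ({q | |q.1 - pos σ n| < z ∧ q.2 < c} \ region v n σ : Set (ℝ × ℝ))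
      =ᵐ[intensity (initMeasure u₀)]
      ({p | p.2 ≤ c ∧ p ∉ region v n σ} ∩ {p | |p.1 - pos σ n| < z} : Set (ℝ × ℝ)) := by
    have hne : ∀ᵐ p ∂(intensity (initMeasure u₀)), p.2 ≠ c :=
      measure_eq_zero_iff_ae_notMem.1 (intensity_horizontal c hc0)
    filter_upwards [hne] with p hp
    refine propext ?_
    change ((_ ∧ _) ∧ _) ↔ ((_ ∧ _) ∧ _)
    constructor
    · exact fun h => ⟨⟨h.1.2.le, h.2⟩, h.1.1⟩
    · exact fun h => ⟨⟨h.2, lt_of_le_of_ne h.1.1 hp⟩, h.1.2⟩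
  have hset1 : MeasurableSet {p : ℝ × ℝ | p.2 ≤ c ∧ p ∉ region v n σ} :=
    (measurableSet_le measurable_snd measurable_const : MeasurableSet {p : ℝ × ℝ | p.2 ≤ c}).inter
      (measurableSet_region v n σ).compl
  have hset2 : MeasurableSet {p : ℝ × ℝ | |p.1 - pos σ n| < z} :=
    measurableSet_lt (by fun_prop) measurable_const
  have hset3 : {s : ℝ | |s - pos σ n| < z} = Ioo (pos σ n - z) (pos σ n + z) := by
    ext s
    rw [mem_Ioo]
    change |s - pos σ n| < z ↔ _
    rw [abs_lt]
    constructor <;> rintro ⟨h1, h2⟩ <;> constructor <;> linarith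
  have hφ : Measurable ({s : ℝ | |s - pos σ n| < z}.indicator (1 : ℝ → ℝ≥0∞)) :=
    measurable_one.indicator (hset3 ▸ measurableSet_Ioo)
  have hL := lintegral_unexplored hv hu₀ hσ (c := c) (by simp only [c]; linarith) hφ
  have e1 : ∀ p : ℝ × ℝ, {p | p.2 ≤ c ∧ p ∉ region v n σ}.indicator
      (fun p : ℝ × ℝ => {s : ℝ | |s - pos σ n| < z}.indicator (1 : ℝ → ℝ≥0∞) p.1) p =
      ({p | p.2 ≤ c ∧ p ∉ region v n σ} ∩ {p | |p.1 - pos σ n| < z}).indicator 1 p := by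
    intro p
    rw [← indicator_indicator]
    rfl
  simp_rw [e1] at hL
  rw [lintegral_indicator_one (hset1.inter hset2)] at hL
  rw [measure_congr hae, hL, area, intervalIntegral.integral_of_le (by linarith),
    ofReal_integral_eq_lintegral_ofReal (hpk.intervalIntegrable_sub T _ _).1
      (Eventually.of_forall fun s => hpk.sub_nonneg hT s),
    ← setLIntegral_congr Ioo_ae_eq_Ioc, ← lintegral_indicator measurableSet_Ioo, ← hset3]
  refine lintegral_congr fun s => ?_
  by_cases hs : s ∈ {s : ℝ | |s - pos σ n| < z}
  · rw [indicator_of_mem hs, indicator_of_mem hs, Pi.one_apply, mul_one]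
  · rw [indicator_of_notMem hs, indicator_of_notMem hs, mul_zero]

theorem region_succ_eq (n : ℕ) (σ : ℕ → ℝ × ℝ) : region v (n + 1) σ = region v n σ ∪
    ({q | |q.1 - pos σ n| < |(σ n).2 - pos σ n| ∧ q.2 < time v σ n + (σ n).1} \
      region v n σ) := by
  rw [union_sdiff_self]
  ext q
  exact mem_region_succ

/-- Each choice adds a disjoint slab, so the exponential of the total intensity factors into the
survival factors of the single steps. -/
theorem intensity_region_succ (hv : 0 < v) (hu₀ : IsPeaked u₀ 0 0) (hσ : σ ∈ Good (n + 1)) :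
    intensity (initMeasure u₀) (region v (n + 1) σ) = intensity (initMeasure u₀) (region v n σ) +
      ENNReal.ofReal (area (pot v u₀ σ n) (pos σ n) (time v σ n) (σ n).1
        |(σ n).2 - pos σ n|) := by
  rw [good_succ_iff] at hσ
  rw [region_succ_eq, measure_union' disjoint_sdiff_self_right (measurableSet_region v n σ),
    intensity_slab hv hu₀ hσ.1 hσ.2 (abs_nonneg _)]

theorem intensity_region_ne_top (hv : 0 < v) (hu₀ : IsPeaked u₀ 0 0) (hσ : σ ∈ Good n) :
    intensity (initMeasure u₀) (region v n σ) ≠ ∞ := by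
  induction n with
  | zero =>
    have h0 : region v 0 σ = ∅ := eq_empty_of_forall_notMem fun q ⟨j, hj, _⟩ => j.not_lt_zero hj
    simp [h0]
  | succ n ih =>
    rw [intensity_region_succ hv hu₀ hσ]
    exact ENNReal.add_ne_top.2 ⟨ih (good_succ_iff.1 hσ).1, ENNReal.ofReal_ne_top⟩

end

end GreedyServer

namespace GreedyServer

noncomputable section

variable {v : ℝ} {u₀ : ℝ → ℝ} {σ σ' : ℕ → ℝ × ℝ} {n : ℕ} {τ : Measure ℝ}

/-! ### Finite paths of service times and customers -/

/-- The history of a path of service times and customers, continued by zeros. -/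
def toHist {n : ℕ} (h : Fin n → ℝ × ℝ × ℝ) : ℕ → ℝ × ℝ := fun k =>
  if hk : k < n then ((h ⟨k, hk⟩).1, (h ⟨k, hk⟩).2.1) else 0

theorem toHist_apply (h : Fin n → ℝ × ℝ × ℝ) (k : Fin n) :
    toHist h k = ((h k).1, (h k).2.1) := dif_pos k.2

theorem toHist_snoc (h : Fin n → ℝ × ℝ × ℝ) (x : ℝ × ℝ × ℝ) :
    toHist (Fin.snoc h x : Fin (n + 1) → ℝ × ℝ × ℝ) =
      Function.update (toHist h) n (x.1, x.2.1) := by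
  funext k
  rcases lt_trichotomy k n with hk | rfl | hk
  · rw [Function.update_of_ne hk.ne]
    have h1 := toHist_apply (Fin.snoc h x : Fin (n + 1) → ℝ × ℝ × ℝ) (Fin.castSucc ⟨k, hk⟩)
    rw [Fin.snoc_castSucc] at h1
    exact h1.trans (toHist_apply h ⟨k, hk⟩).symm
  · rw [Function.update_self]
    have h1 := toHist_apply (Fin.snoc h x : Fin (k + 1) → ℝ × ℝ × ℝ) (Fin.last k)
    rwa [Fin.snoc_last] at h1
  · rw [Function.update_of_ne hk.ne', toHist, toHist, dif_neg (by lia), dif_neg (by lia)]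

theorem continuous_toHist (n : ℕ) :
    Continuous fun h : Fin n → ℝ × ℝ × ℝ => toHist h := by
  refine continuous_pi fun k => ?_
  by_cases hk : k < n
  · simp only [toHist, dif_pos hk]
    fun_prop
  · simp only [toHist, dif_neg hk]
    exact continuous_const

/-- The paths in which each customer is present and unexplored when chosen. -/
def pathSet (v : ℝ) (n : ℕ) : Set (Fin n → ℝ × ℝ × ℝ) :=
  {h | ∀ k : Fin n, 0 ≤ (h k).1 ∧ (h k).2.2 ≤ time v (toHist h) k + (h k).1 ∧
    (h k).2 ∉ region v k (toHist h)}

/-- Presence is a weak inequality, and being unexplored is the complement of an open condition. The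
Mecke bound needs this closedness, together with openness of the region. -/
theorem isClosed_pathSet (v : ℝ) (n : ℕ) : IsClosed (pathSet v n) := by
  have h1 : pathSet v n = ⋂ k : Fin n, {h | 0 ≤ (h k).1} ∩
      ({h | (h k).2.2 ≤ time v (toHist h) k + (h k).1} ∩
        {h | (h k).2 ∉ region v k (toHist h)}) := by
    ext h
    simp only [pathSet, mem_ofPred_eq, mem_iInter, mem_inter_iff]
  rw [h1]
  refine isClosed_iInter fun k => ?_
  have h2 := continuous_toHist n
  have h3 := (continuous_time (v := v) k).comp h2
  refine (isClosed_le (by fun_prop) (by fun_prop)).inter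
    ((isClosed_le (by fun_prop) (h3.add (by fun_prop))).inter ?_)
  exact ((isOpen_region v k).preimage (by fun_prop :
    Continuous fun h : Fin n → ℝ × ℝ × ℝ => (toHist h, (h k).2))).isClosed_compl

/-- The explored region as a function of the path. -/
def regionSet (v : ℝ) (n : ℕ) : Set ((Fin n → ℝ × ℝ × ℝ) × ℝ × ℝ) :=
  {p | p.2 ∈ region v n (toHist p.1)}

theorem isOpen_regionSet (v : ℝ) (n : ℕ) : IsOpen (regionSet v n) := by
  have := continuous_toHist n
  exact (isOpen_region v n).preimage (by fun_prop :
    Continuous fun p : (Fin n → ℝ × ℝ × ℝ) × ℝ × ℝ => (toHist p.1, p.2))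

theorem toHist_mem_good {h : Fin n → ℝ × ℝ × ℝ} (hh : h ∈ pathSet v n) : toHist h ∈ Good n := by
  intro k hk
  rw [toHist_apply h ⟨k, hk⟩]
  exact (hh ⟨k, hk⟩).1

theorem snoc_mem_pathSet {h : Fin n → ℝ × ℝ × ℝ} {x : ℝ × ℝ × ℝ} :
    (Fin.snoc h x : Fin (n + 1) → ℝ × ℝ × ℝ) ∈ pathSet v (n + 1) ↔
      h ∈ pathSet v n ∧ 0 ≤ x.1 ∧ x.2.2 ≤ time v (toHist h) n + x.1 ∧
        x.2 ∉ region v n (toHist h) := by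
  have hag := update_agree (toHist h) n (x.1, x.2.1)
  simp only [pathSet, mem_ofPred_eq, Fin.forall_fin_succ', Fin.snoc_castSucc, Fin.snoc_last,
    Fin.val_castSucc, Fin.val_last, toHist_snoc]
  refine and_congr (forall_congr' fun k => ?_) ?_
  · have hk : ∀ j < (k : ℕ), Function.update (toHist h) n (x.1, x.2.1) j = toHist h j :=
      fun j hj => hag j (hj.trans k.2)
    rw [time_congr hk, region_congr hk]
  · rw [time_congr hag, region_congr hag]

/-- The last step is integrated innermost, to match the recursion of `historyLaw`. -/
theorem lintegral_pi_snoc {α : Type*} [MeasurableSpace α] (ν : Measure α) [SigmaFinite ν] (n : ℕ)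
    {F : (Fin (n + 1) → α) → ℝ≥0∞} (hF : Measurable F) :
    ∫⁻ h, F h ∂(Measure.pi fun _ : Fin (n + 1) => ν) =
      ∫⁻ h, (∫⁻ x, F (Fin.snoc h x) ∂ν) ∂(Measure.pi fun _ : Fin n => ν) := by
  have e := (measurePreserving_piFinSuccAbove (fun _ : Fin (n + 1) => ν) (Fin.last n)).symm
  have hm : Measurable fun z => F
      ((MeasurableEquiv.piFinSuccAbove (fun _ : Fin (n + 1) => α) (Fin.last n)).symm z) :=
    hF.comp e.measurable
  rw [← e.lintegral_comp hF, lintegral_prod_symm _ hm.aemeasurable]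
  refine lintegral_congr fun h => lintegral_congr fun x => ?_
  exact congrArg F (Fin.insertNth_last' x h)

/-- Integrating the path density against the intensity gives the law of the histories. -/
theorem lintegral_pathSet (hv : 0 < v) (hu₀ : IsPeaked u₀ 0 0) [IsProbabilityMeasure τ]
    (hτ : ∀ᵐ s ∂τ, 0 ≤ s) (n : ℕ) {f : (ℕ → ℝ × ℝ) → ℝ≥0∞} (hf : Measurable f) :
    ∫⁻ h, (pathSet v n).indicator (fun h =>
        expNeg (intensity (initMeasure u₀) (region v n (toHist h))) * f (toHist h)) h
      ∂(Measure.pi fun _ : Fin n => τ.prod (intensity (initMeasure u₀))) =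
    ∫⁻ σ, f σ ∂(historyLaw v u₀ τ n) := by
  have := isLocallyFiniteMeasure_intensity hu₀
  have hmeas : ∀ (n : ℕ) {f : (ℕ → ℝ × ℝ) → ℝ≥0∞}, Measurable f →
      Measurable ((pathSet v n).indicator (fun h =>
        expNeg (intensity (initMeasure u₀) (region v n (toHist h))) * f (toHist h))) := by
    intro n f hf
    refine Measurable.indicator ?_ (isClosed_pathSet v n).measurableSet
    have h1 := measurable_measure_prodMk_left (ν := intensity (initMeasure u₀))
      (isOpen_regionSet v n).measurableSet
    exact (measurable_expNeg.comp h1).mul (hf.comp (continuous_toHist n).measurable)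
  induction n generalizing f with
  | zero =>
    have h0 : ∀ h : Fin 0 → ℝ × ℝ × ℝ, toHist h = 0 := fun h => by
      funext k; exact dif_neg k.not_lt_zero
    have h1 : region v 0 0 = ∅ := eq_empty_of_forall_notMem fun q ⟨j, hj, _⟩ => j.not_lt_zero hj
    have h2 : ∀ h : Fin 0 → ℝ × ℝ × ℝ, h ∈ pathSet v 0 := fun h k => k.elim0
    simp only [h0, h1, historyLaw, lintegral_dirac' _ hf, measure_empty]
    rw [lintegral_congr (g := fun _ => f 0) fun h => by
      rw [indicator_of_mem (h2 h)]; simp [expNeg]]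
    rw [lintegral_const, Measure.pi_univ]
    simp
  | succ n ih =>
    let G : (ℕ → ℝ × ℝ) → ℝ≥0∞ := fun σ => ∫⁻ T, (∫⁻ y, stepDensity v u₀ n (σ, T, y) *
      f (Function.update σ n (T, y))) ∂τ
    have hG : Measurable G := by
      have h1 : Measurable fun q : (ℕ → ℝ × ℝ) × ℝ × ℝ =>
          stepDensity v u₀ n q * f (Function.update q.1 n q.2) :=
        (measurable_stepDensity hu₀.measurable n).mul (hf.comp (measurable_update_history n))
      have h2 : Measurable fun q : ((ℕ → ℝ × ℝ) × ℝ) × ℝ =>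
          stepDensity v u₀ n (q.1.1, q.1.2, q.2) *
            f (Function.update q.1.1 n (q.1.2, q.2)) :=
        h1.comp (by fun_prop : Measurable fun q : ((ℕ → ℝ × ℝ) × ℝ) × ℝ => (q.1.1, q.1.2, q.2))
      exact h2.lintegral_prod_right'.lintegral_prod_right'
    rw [lintegral_pi_snoc _ n (hmeas (n + 1) hf), lintegral_historyLaw_succ hu₀.measurable n hf,
      ← ih hG]
    refine lintegral_congr fun h => ?_
    set σ := toHist h
    by_cases hh : h ∈ pathSet v n
    · rw [indicator_of_mem hh]
      have hσ : σ ∈ Good n := toHist_mem_good hh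
      have hcomp : Measurable fun x : ℝ × ℝ × ℝ => (pathSet v (n + 1)).indicator (fun h =>
          expNeg (intensity (initMeasure u₀) (region v (n + 1) (toHist h))) * f (toHist h))
          (Fin.snoc h x) := by
        refine (hmeas (n + 1) hf).comp (measurable_pi_lambda _ fun k => ?_)
        refine Fin.lastCases ?_ (fun k => ?_) k
        · simp only [Fin.snoc_last]; exact measurable_id
        · simp only [Fin.snoc_castSucc]; exact measurable_const
      rw [lintegral_prod _ hcomp.aemeasurable,
        ← lintegral_const_mul' _ _ (ne_top_of_le_ne_top ENNReal.one_ne_top (expNeg_le_one _))]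
      refine lintegral_congr_ae ?_
      filter_upwards [hτ] with T hT
      have hpk := isPeaked_pot hv hu₀ hσ
      have hfy : Measurable fun y : ℝ => f (Function.update σ n (T, y)) :=
        hf.comp ((measurable_update_history n).comp (by fun_prop : Measurable fun y : ℝ =>
          (σ, T, y)))
      have hay : Measurable fun y : ℝ => area (pot v u₀ σ n) (pos σ n) (time v σ n) T
          |y - pos σ n| := (hpk.continuous_area T).measurable.comp (by fun_prop)
      have hφ : Measurable fun y : ℝ => expNeg (intensity (initMeasure u₀) (region v n σ)) *
          (ENNReal.ofReal (Real.exp (-area (pot v u₀ σ n) (pos σ n) (time v σ n) T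
            |y - pos σ n|)) * f (Function.update σ n (T, y))) := by fun_prop
      -- The integrand depends on the last customer only through its position; integrating out the
      -- arrival time produces the first factor of `stepDensity`, and the new slab produces the
      -- second.
      have hU := lintegral_unexplored hv hu₀ hσ (c := time v σ n + T) (by linarith) hφ
      calc _ = ∫⁻ p, {p | p.2 ≤ time v σ n + T ∧ p ∉ region v n σ}.indicator (fun p : ℝ × ℝ =>
            expNeg (intensity (initMeasure u₀) (region v n σ)) *
          (ENNReal.ofReal (Real.exp (-area (pot v u₀ σ n) (pos σ n) (time v σ n) T
            |p.1 - pos σ n|)) * f (Function.update σ n (T, p.1)))) p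
            ∂(intensity (initMeasure u₀)) := by
            refine lintegral_congr fun p => ?_
            by_cases hp : p.2 ≤ time v σ n + T ∧ p ∉ region v n σ
            · rw [indicator_of_mem (snoc_mem_pathSet.2 ⟨hh, hT, hp⟩), indicator_of_mem
                (show p ∈ {p : ℝ × ℝ | p.2 ≤ time v σ n + T ∧ p ∉ region v n σ} from hp),
                toHist_snoc]
              have hag := update_agree σ n (T, p.1)
              have hg : Function.update σ n (T, p.1) ∈ Good (n + 1) := by
                rw [good_succ_iff, good_congr hag, Function.update_self]
                exact ⟨hσ, hT⟩
              rw [intensity_region_succ hv hu₀ hg, region_congr hag, pot_congr hag, pos_congr hag,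
                time_congr hag, Function.update_self,
                expNeg_add (intensity_region_ne_top hv hu₀ hσ) ENNReal.ofReal_ne_top, mul_assoc]
              congr 2
              rw [expNeg, ENNReal.toReal_ofReal (hpk.area_nonneg hT (abs_nonneg _))]
            · rw [indicator_of_notMem fun h' => hp (snoc_mem_pathSet.1 h').2.2,
                indicator_of_notMem (show p ∉ {p : ℝ × ℝ | p.2 ≤ time v σ n + T ∧
                  p ∉ region v n σ} from hp)]
        _ = _ := by
            rw [hU, ← lintegral_const_mul' _ _
              (ne_top_of_le_ne_top ENNReal.one_ne_top (expNeg_le_one _))]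
            refine lintegral_congr fun y => ?_
            rw [stepDensity]
            ring
    · rw [indicator_of_notMem hh]
      refine (lintegral_congr fun x => ?_).trans lintegral_zero
      exact indicator_of_notMem (fun h' => hh (snoc_mem_pathSet.1 h').1) _

/-- The upper bound for the law of a path, in terms of the law of the histories. -/
theorem setLIntegral_pathSet (hv : 0 < v) (hu₀ : IsPeaked u₀ 0 0) [IsProbabilityMeasure τ]
    (hτ : ∀ᵐ s ∂τ, 0 ≤ s) (n : ℕ) {F : Set (ℕ → ℝ × ℝ)} (hF : MeasurableSet F) :
    ∫⁻ h in pathSet v n ∩ (fun h => toHist h) ⁻¹' F,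
        expNeg (intensity (initMeasure u₀) {q | (h, q) ∈ regionSet v n})
      ∂(Measure.pi fun _ : Fin n => τ.prod (intensity (initMeasure u₀))) =
    historyLaw v u₀ τ n F := by
  have hm : MeasurableSet (pathSet v n ∩ (fun h => toHist h) ⁻¹' F) :=
    (isClosed_pathSet v n).measurableSet.inter ((continuous_toHist n).measurable hF)
  rw [← lintegral_indicator_one hF, ← lintegral_pathSet hv hu₀ hτ n (measurable_one.indicator hF),
    ← lintegral_indicator hm]
  refine lintegral_congr fun h => ?_
  by_cases hh : h ∈ pathSet v n
  · rw [indicator_of_mem (a := h) hh]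
    by_cases hF' : toHist h ∈ F
    · have hhF : h ∈ pathSet v n ∩ (fun h => toHist h) ⁻¹' F := ⟨hh, hF'⟩
      rw [indicator_of_mem hhF,
        indicator_of_mem hF', Pi.one_apply, mul_one]
      rfl
    · rw [indicator_of_notMem (fun h' => hF' h'.2), indicator_of_notMem hF', mul_zero]
  · rw [indicator_of_notMem hh, indicator_of_notMem (fun h' => hh h'.1)]

variable {Ω : Type*} [MeasurableSpace Ω] {P : Measure Ω} [IsProbabilityMeasure P]
  {init : Ω → Set ℝ} {arr : Ω → Set (ℝ × ℝ)} {T : ℕ → Ω → ℝ}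

/-- A random history that is almost surely produced by a path of customers is distributed as the
histories generated by the operators acting on potentials. -/
theorem hasLaw_of_path (hv : 0 < v) (hu₀ : IsPeaked u₀ 0 0) [IsProbabilityMeasure τ]
    (hτ : ∀ᵐ s ∂τ, 0 ≤ s) (h_init : IsPoissonProcess init (initMeasure u₀) P)
    (h_arr : IsPoissonProcess arr ((volume : Measure (ℝ × ℝ)).restrict {p | 0 < p.2}) P)
    (hT_meas : ∀ n, Measurable (T n)) (hT_law : ∀ n, HasLaw (T n) τ P) (hT_indep : iIndepFun T P)
    (h_indep : iIndep ![pointSigma init, pointSigma arr,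
      ⨆ n, MeasurableSpace.comap (T n) inferInstance] P)
    (n : ℕ) [IsProbabilityMeasure (historyLaw v u₀ τ n)] {p : Ω → ℕ → ℝ × ℝ}
    (hp : ∀ᵐ ω ∂P, (∀ k, p ω k ∈ markedCustomers (init ω) (arr ω)) ∧ Function.Injective (p ω) ∧
      (fun k : Fin n => (T k ω, p ω k)) ∈ pathSet v n ∧
      ∀ q ∈ markedCustomers (init ω) (arr ω),
        q ∈ region v n (toHist fun k : Fin n => (T k ω, p ω k)) → ∃ k : Fin n, q = p ω k) :
    HasLaw (fun ω => toHist fun k : Fin n => (T k ω, p ω k)) (historyLaw v u₀ τ n) P := by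
  have := isLocallyFiniteMeasure_intensity hu₀
  have := nullSingletonClass_intensity (u₀ := u₀)
  -- The choice `p` carries no measurability, so only outer probabilities of closed events are
  -- estimated.
  refine hasLaw_of_forall_isClosed_le fun F hF => ?_
  have hFm : MeasurableSet F := hF.measurableSet
  let K : Set (Fin n → ℝ × ℝ × ℝ) := pathSet v n ∩ (fun h => toHist h) ⁻¹' F
  have hK : IsClosed K := (isClosed_pathSet v n).inter (hF.preimage (continuous_toHist n))
  have hfin : ∀ h ∈ K, intensity (initMeasure u₀) {q | (h, q) ∈ regionSet v n} ≠ ∞ := by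
    intro h hh
    have h1 := intensity_region_ne_top hv hu₀ (toHist_mem_good hh.1)
    exact h1
  have hmecke : P (pathEvent (fun ω => markedCustomers (init ω) (arr ω)) (fun k : Fin n => T k) K
      (regionSet v n)) ≤ _ :=
    measure_pathEvent_le (τ := τ) (μ := intensity (initMeasure u₀))
      (fun J C D hJ hC hD _ hDfin hCC hCD => measure_marked_hit_le h_init h_arr hT_meas hT_law
      hT_indep h_indep hJ hC hD hDfin hCC hCD) hK (isOpen_regionSet v n) hfin
  refine le_trans ?_ (hmecke.trans (setLIntegral_pathSet hv hu₀ hτ n hFm).le)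
  refine measure_mono_ae ?_
  filter_upwards [hp] with ω hω hF'
  exact ⟨fun k => p ω k, fun k => hω.1 k, hω.2.1.comp Fin.val_injective, ⟨hω.2.2.1, hF'⟩,
    hω.2.2.2⟩

end

end GreedyServer

namespace GreedyServer

noncomputable section

/-! ### The path of a greedy server -/

open Classical in
/-- Records the arrival time of a customer present at time `0` as `-1`. -/
def mark (q : ℝ × ℝ) : ℝ × ℝ := (q.1, if q.2 ≤ 0 then -1 else q.2)

variable {v : ℝ} {init : Set ℝ} {arr : Set (ℝ × ℝ)} {T t : ℕ → ℝ} {c : ℕ → ℝ × ℝ} {𝒮 : ℝ → ℝ}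

theorem snd_eq_zero_or_pos (harr : ∀ q ∈ arr, 0 < q.2) {q : ℝ × ℝ}
    (hq : q ∈ customers init arr) : q.2 = 0 ∨ 0 < q.2 := by
  rcases hq with ⟨x, -, rfl⟩ | hq
  exacts [Or.inl rfl, Or.inr (harr q hq)]

theorem mark_mem_markedCustomers (harr : ∀ q ∈ arr, 0 < q.2) {q : ℝ × ℝ}
    (hq : q ∈ customers init arr) : mark q ∈ markedCustomers init arr := by
  rcases hq with ⟨x, hx, rfl⟩ | hq
  · refine Or.inl ⟨x, hx, ?_⟩
    simp [mark]
  · refine Or.inr ?_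
    have : mark q = q := by simp [mark, not_le.2 (harr q hq)]
    rw [this]
    exact ⟨hq, harr q hq⟩

theorem exists_mark_eq {q : ℝ × ℝ} (hq : q ∈ markedCustomers init arr) :
    ∃ q' ∈ customers init arr, mark q' = q := by
  rcases hq with ⟨x, hx, rfl⟩ | ⟨hq, hq0⟩
  · exact ⟨(x, 0), Or.inl ⟨x, hx, rfl⟩, by simp [mark]⟩
  · have hq0 : 0 < q.2 := hq0
    exact ⟨q, Or.inr hq, by simp [mark, not_le.2 hq0]⟩

/-- Arrivals have positive times, so marking merges no initial customer with an arrival. -/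
theorem mark_injOn (harr : ∀ q ∈ arr, 0 < q.2) : InjOn mark (customers init arr) := by
  intro q hq q' hq' h
  have h1 : (mark q).1 = (mark q').1 := congrArg Prod.fst h
  have h2 : (mark q).2 = (mark q').2 := congrArg Prod.snd h
  refine Prod.ext h1 ?_
  simp only [mark] at h2
  rcases snd_eq_zero_or_pos harr hq with h3 | h3 <;>
    rcases snd_eq_zero_or_pos harr hq' with h4 | h4
  · rw [h3, h4]
  · rw [if_pos h3.le, if_neg (not_le.2 h4)] at h2; linarith
  · rw [if_neg (not_le.2 h3), if_pos h4.le] at h2; linarith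
  · rwa [if_neg (not_le.2 h3), if_neg (not_le.2 h4)] at h2

theorem mark_snd_le (q : ℝ × ℝ) {a : ℝ} (ha : 0 ≤ a) (h : q.2 ≤ a) : (mark q).2 ≤ a := by
  simp only [mark]
  split_ifs
  · linarith
  · exact h

theorem le_of_mark_snd_lt {q : ℝ × ℝ} {a : ℝ} (ha : 0 ≤ a) (h : (mark q).2 < a) : q.2 ≤ a := by
  simp only [mark] at h
  split_ifs at h with h0
  · exact h0.trans ha
  · exact h.le

namespace IsGreedyServer

theorem pos_next (h : IsGreedyServer v (customers init arr) T t c 𝒮) (hv : 0 < v) (n : ℕ) :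
    𝒮 (t (n + 1)) = (c n).1 := by
  have hle : t n + T n ≤ t (n + 1) := by
    rw [h.next_time]
    linarith [div_nonneg (abs_nonneg ((c n).1 - 𝒮 (t n))) hv.le]
  have hd : v * (t (n + 1) - (t n + T n)) = |(c n).1 - 𝒮 (t n)| := by
    rw [h.next_time, add_sub_cancel_left, mul_div_cancel₀ _ hv.ne']
  rw [h.travel n _ ⟨hle, le_rfl⟩, hd, sign_mul_abs, add_sub_cancel]

theorem time_pos_eq (h : IsGreedyServer v (customers init arr) T t c 𝒮) (hv : 0 < v) (n : ℕ)
    {σ : ℕ → ℝ × ℝ} (hσ : ∀ k < n, σ k = (T k, (c k).1)) :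
    time v σ n = t n ∧ pos σ n = 𝒮 (t n) := by
  induction n with
  | zero => exact ⟨h.time_zero.symm, by rw [h.time_zero, h.pos_zero]; rfl⟩
  | succ n ih =>
    obtain ⟨h1, h2⟩ := ih fun k hk => hσ k (hk.trans n.lt_succ_self)
    rw [h.pos_next hv, time, pos, hσ n n.lt_succ_self, h1, h2, h.next_time]
    exact ⟨rfl, rfl⟩

/-- A customer in the explored region has been chosen before. -/
theorem exists_eq_of_mem_region (h : IsGreedyServer v (customers init arr) T t c 𝒮) (hv : 0 < v)
    (hT : ∀ n, 0 ≤ T n) {n : ℕ} {σ : ℕ → ℝ × ℝ} (hσ : ∀ k < n, σ k = (T k, (c k).1))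
    {q : ℝ × ℝ} (hq : q ∈ customers init arr) (hreg : mark q ∈ region v n σ) :
    ∃ i < n, q = c i := by
  obtain ⟨j, hj, h1, h2⟩ := hreg
  by_contra! hne
  have hσj : ∀ k < j, σ k = (T k, (c k).1) := fun k hk => hσ k (hk.trans hj)
  obtain ⟨ht, hx⟩ := h.time_pos_eq hv j hσj
  have hgood : σ ∈ Good j := fun k hk => by rw [hσj k hk]; exact hT k
  have ht0 : 0 ≤ t j + T j := add_nonneg (ht ▸ time_nonneg hv hgood) (hT j)
  rw [hσ j hj, hx] at h1
  rw [hσ j hj, ht] at h2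
  -- An explored customer not chosen before was waiting at choice `j` and strictly nearer than the
  -- one chosen, contrary to greediness.
  have hw : q ∈ waiting (customers init arr) T t c j :=
    ⟨hq, le_of_mark_snd_lt ht0 h2, fun k hk => (hne k (hk.trans hj)).symm⟩
  exact absurd h1 (not_lt.2 (h.next_nearest j q hw))

/-- The marked customers chosen by a greedy server form a path. -/
theorem isPath (h : IsGreedyServer v (customers init arr) T t c 𝒮) (hv : 0 < v)
    (hT : ∀ n, 0 ≤ T n) (harr : ∀ q ∈ arr, 0 < q.2) (n : ℕ) :
    (∀ k, mark (c k) ∈ markedCustomers init arr) ∧ Function.Injective (fun k => mark (c k)) ∧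
      (fun k : Fin n => (T k, mark (c k))) ∈ pathSet v n ∧
      ∀ q ∈ markedCustomers init arr,
        q ∈ region v n (toHist fun k : Fin n => (T k, mark (c k))) →
          ∃ k : Fin n, q = mark (c k) := by
  have hσ : ∀ k < n, toHist (fun k : Fin n => (T k, mark (c k))) k = (T k, (c k).1) :=
    fun k hk => toHist_apply _ ⟨k, hk⟩
  have hmem : ∀ k, c k ∈ customers init arr := fun k => (h.next_waiting k).1
  have hlt : ∀ i j, i < j → c i ≠ c j := fun i j hij => (h.next_waiting j).2.2 i hij
  refine ⟨fun k => mark_mem_markedCustomers harr (hmem k), ?_, fun k => ⟨hT k, ?_, ?_⟩, ?_⟩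
  · intro i j hij
    have hij := mark_injOn harr (hmem i) (hmem j) hij
    rcases lt_trichotomy i j with hlt' | rfl | hlt'
    exacts [absurd hij (hlt i j hlt'), rfl, absurd hij.symm (hlt j i hlt')]
  · have hσk : ∀ j < (k : ℕ), toHist (fun k : Fin n => (T k, mark (c k))) j = (T j, (c j).1) :=
      fun j hj => hσ j (hj.trans k.2)
    have hgood : toHist (fun k : Fin n => (T k, mark (c k))) ∈ Good k :=
      fun j hj => by rw [hσk j hj]; exact hT j
    have h1 := time_nonneg hv hgood
    rw [(h.time_pos_eq hv k hσk).1] at h1 ⊢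
    exact mark_snd_le _ (add_nonneg h1 (hT k)) (h.next_waiting k).2.1
  · intro hreg
    obtain ⟨i, hi, hci⟩ := h.exists_eq_of_mem_region hv hT
      (fun j (hj : j < (k : ℕ)) => hσ j (hj.trans k.2)) (hmem k) hreg
    exact hlt i k hi hci.symm
  · intro q hq hreg
    obtain ⟨q', hq', rfl⟩ := exists_mark_eq hq
    obtain ⟨i, hi, rfl⟩ := h.exists_eq_of_mem_region hv hT hσ hq' hreg
    exact ⟨⟨i, hi⟩, rfl⟩

end IsGreedyServer

end

end GreedyServer

namespace GreedyServer

noncomputable section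

/-! ### Existence of the greedy server -/

section Existence

variable {v : ℝ} {T : ℕ → ℝ}

/-- The service times, positions and served customers of a server that, at position `x` and time
`a`, after having served the customers `S`, chooses the customer `f x a S`. -/
def serverState (v : ℝ) (T : ℕ → ℝ) (f : ℝ → ℝ → Finset (ℝ × ℝ) → ℝ × ℝ) :
    ℕ → ℝ × ℝ × Finset (ℝ × ℝ)
  | 0 => (0, 0, ∅)
  | n + 1 =>
    let s := serverState v T f n
    let q := f s.2.1 (s.1 + T n) s.2.2
    (s.1 + T n + |q.1 - s.2.1| / v, q.1, insert q s.2.2)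

/-- Position functions interpolate sequences of starting times and positions of services. -/
theorem exists_position (hv : 0 < v) (hT : ∀ n, 0 ≤ T n) {t X : ℕ → ℝ}
    (ht : ∀ n, t (n + 1) = t n + T n + |X (n + 1) - X n| / v) :
    ∃ 𝒮 : ℝ → ℝ, (∀ n, ∀ s ∈ Icc (t n) (t n + T n), 𝒮 s = X n) ∧
      ∀ n, ∀ s ∈ Icc (t n + T n) (t (n + 1)),
        𝒮 s = X n + (SignType.sign (X (n + 1) - X n) : ℝ) * (v * (s - (t n + T n))) := by
  classical
  have hd : ∀ n, 0 ≤ |X (n + 1) - X n| / v := fun n => div_nonneg (abs_nonneg _) hv.le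
  have hmono : Monotone t := monotone_nat_of_le_succ fun n => by
    rw [ht]; linarith [hT n, hd n]
  let g : ℕ → ℝ → ℝ := fun n s =>
    X n + (SignType.sign (X (n + 1) - X n) : ℝ) * (v * max 0 (s - (t n + T n)))
  have hg0 : ∀ n s, s ≤ t n + T n → g n s = X n := fun n s hs => by
    simp only [g]
    rw [max_eq_left (by linarith)]
    ring
  have hg1 : ∀ n, g n (t (n + 1)) = X (n + 1) := fun n => by
    simp only [g]
    rw [ht n, add_sub_cancel_left, max_eq_right (hd n), mul_div_cancel₀ _ hv.ne', sign_mul_abs,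
      add_sub_cancel]
  -- Several services may start at one time when durations and distances vanish. The positions then
  -- coincide, so the pieces of the trajectory are consistent.
  have hX : ∀ n m, n ≤ m → t m ≤ t n → X m = X n := by
    intro n m hnm
    induction m, hnm using Nat.le_induction with
    | base => exact fun _ => rfl
    | succ m hm ih =>
      intro hle
      have h1 : t n ≤ t m := hmono hm
      have h2 : |X (m + 1) - X m| / v = 0 := by
        have := ht m
        linarith [hT m, hd m]
      have h3 : |X (m + 1) - X m| = 0 := (div_eq_zero_iff.1 h2).resolve_right hv.ne'
      rw [← ih ((hmono m.le_succ).trans hle), ← sub_eq_zero, ← abs_eq_zero, h3]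
  have hcons : ∀ n m s, n < m → s ∈ Icc (t n) (t (n + 1)) → s ∈ Icc (t m) (t (m + 1)) →
      g n s = g m s := by
    intro n m s hnm hn hm
    have h1 : t (n + 1) ≤ t m := hmono hnm
    have h2 : s = t (n + 1) := le_antisymm hn.2 (h1.trans hm.1)
    have h3 : t m ≤ t (n + 1) := hm.1.trans hn.2
    rw [hg0 m s (by linarith [hT m]), h2, hg1, hX (n + 1) m hnm h3]
  let 𝒮 : ℝ → ℝ := fun s =>
    if h : ∃ n, s ∈ Icc (t n) (t (n + 1)) then g h.choose s else 0
  have h𝒮 : ∀ n s, s ∈ Icc (t n) (t (n + 1)) → 𝒮 s = g n s := by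
    intro n s hs
    have hex : ∃ n, s ∈ Icc (t n) (t (n + 1)) := ⟨n, hs⟩
    have h1 : 𝒮 s = g hex.choose s := dif_pos hex
    rw [h1]
    rcases lt_trichotomy hex.choose n with hlt | heq | hlt
    · exact hcons _ _ s hlt hex.choose_spec hs
    · rw [heq]
    · exact (hcons _ _ s hlt hs hex.choose_spec).symm
  refine ⟨𝒮, fun n s hs => ?_, fun n s hs => ?_⟩
  · rw [h𝒮 n s ⟨hs.1, hs.2.trans (by rw [ht]; linarith [hd n])⟩, hg0 n s hs.2]
  · rw [h𝒮 n s ⟨by linarith [hs.1, hT n], hs.2⟩]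
    simp only [g]
    rw [max_eq_right (by linarith [hs.1])]

/-- Infinitely many initial customers leave one, `p₀`, unserved; local finiteness leaves finitely
many candidates at least as near as `p₀`. -/
theorem exists_nearest {A : Set (ℝ × ℝ)}
    (hfin : ∀ r : ℝ, (A ∩ {q | |q.1| ≤ r ∧ q.2 ≤ r}).Finite)
    (hinf : (A ∩ {q | q.2 ≤ 0}).Infinite) (x a : ℝ) (ha : 0 ≤ a) (S : Finset (ℝ × ℝ)) :
    ∃ q ∈ A, q.2 ≤ a ∧ q ∉ S ∧ ∀ p ∈ A, p.2 ≤ a → p ∉ S → |q.1 - x| ≤ |p.1 - x| := by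
  obtain ⟨p₀, ⟨hp₀, hp₀'⟩, hp₀S⟩ := hinf.exists_notMem_finset S
  have hp₀' : p₀.2 ≤ 0 := hp₀'
  let W : Set (ℝ × ℝ) := {p ∈ A | p.2 ≤ a ∧ p ∉ S ∧ |p.1 - x| ≤ |p₀.1 - x|}
  have hW : W.Finite := by
    refine (hfin (max (|x| + |p₀.1 - x|) a)).subset fun p hp => ⟨hp.1, ?_, ?_⟩
    · refine le_trans ?_ (le_max_left _ _)
      have := abs_add_le x (p.1 - x)
      rw [add_sub_cancel] at this
      linarith [hp.2.2.2]
    · exact hp.2.1.trans (le_max_right _ _)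
  have hp₀W : p₀ ∈ W := ⟨hp₀, hp₀'.trans ha, hp₀S, le_rfl⟩
  obtain ⟨q, hq, hmin⟩ := exists_min_image W (fun p => |p.1 - x|) hW ⟨p₀, hp₀W⟩
  refine ⟨q, hq.1, hq.2.1, hq.2.2.1, fun p hp hpa hpS => ?_⟩
  rcases le_total |p.1 - x| |p₀.1 - x| with h | h
  · exact hmin p ⟨hp, hpa, hpS, h⟩
  · exact hq.2.2.2.trans h

theorem exists_isGreedyServer (hv : 0 < v) (hT : ∀ n, 0 ≤ T n) {A : Set (ℝ × ℝ)}
    (hfin : ∀ r : ℝ, (A ∩ {q | |q.1| ≤ r ∧ q.2 ≤ r}).Finite)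
    (hinf : (A ∩ {q | q.2 ≤ 0}).Infinite) :
    ∃ (t : ℕ → ℝ) (c : ℕ → ℝ × ℝ) (𝒮 : ℝ → ℝ), IsGreedyServer v A T t c 𝒮 := by
  -- Guarding by `0 ≤ a` makes the choice function total; negative times get an irrelevant default.
  have hex : ∀ x a S, ∃ q : ℝ × ℝ, 0 ≤ a → q ∈ A ∧ q.2 ≤ a ∧ q ∉ S ∧
      ∀ p ∈ A, p.2 ≤ a → p ∉ S → |q.1 - x| ≤ |p.1 - x| := fun x a S => by
    by_cases ha : 0 ≤ a
    · obtain ⟨q, hq⟩ := exists_nearest hfin hinf x a ha S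
      exact ⟨q, fun _ => hq⟩
    · exact ⟨0, fun h => absurd h ha⟩
  choose f hf using hex
  let s := serverState v T f
  let t : ℕ → ℝ := fun n => (s n).1
  let X : ℕ → ℝ := fun n => (s n).2.1
  let c : ℕ → ℝ × ℝ := fun n => f (X n) (t n + T n) (s n).2.2
  have hXc : ∀ n, X (n + 1) = (c n).1 := fun n => rfl
  have htime : ∀ n, t (n + 1) = t n + T n + |X (n + 1) - X n| / v := fun n => rfl
  have ht0 : ∀ n, 0 ≤ t n := by
    intro n
    induction n with
    | zero => exact le_rfl
    | succ n ih =>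
      rw [htime]
      linarith [hT n, div_nonneg (abs_nonneg (X (n + 1) - X n)) hv.le]
  have hS : ∀ n p, p ∈ (s n).2.2 ↔ ∃ k < n, c k = p := by
    intro n
    induction n with
    | zero => exact fun p => by simp [s, serverState]
    | succ n ih =>
      intro p
      have h1 : (s (n + 1)).2.2 = insert (c n) (s n).2.2 := rfl
      rw [h1, Finset.mem_insert, ih, Nat.exists_lt_succ_right, or_comm, eq_comm]
  have hw : ∀ n p, p ∈ waiting A T t c n ↔ p ∈ A ∧ p.2 ≤ t n + T n ∧ p ∉ (s n).2.2 := by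
    intro n p
    rw [hS]
    push Not
    rfl
  have hc := fun n => hf (X n) (t n + T n) (s n).2.2 (add_nonneg (ht0 n) (hT n))
  obtain ⟨𝒮, h𝒮, h𝒮'⟩ := exists_position hv hT htime
  have hpos : ∀ n, 𝒮 (t n) = X n := fun n =>
    h𝒮 n _ ⟨le_rfl, by linarith [hT n]⟩
  refine ⟨t, c, 𝒮, rfl, hpos 0, fun n r hr => (h𝒮 n r hr).trans (hpos n).symm,
    fun n => (hw n _).2 ⟨(hc n).1, (hc n).2.1, (hc n).2.2.1⟩, fun n p hp => ?_, fun n => ?_,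
    fun n r hr => ?_⟩
  · obtain ⟨h1, h2, h3⟩ := (hw n p).1 hp
    rw [hpos]
    exact (hc n).2.2.2 p h1 h2 h3
  · rw [hpos]; rfl
  · rw [hpos]; exact h𝒮' n r hr

end Existence

section AlmostSure

variable {Ω : Type*} [MeasurableSpace Ω] {P : Measure Ω}
  {u₀ : ℝ → ℝ} {init : Ω → Set ℝ} {arr : Ω → Set (ℝ × ℝ)}

theorem ae_arrival_pos [IsProbabilityMeasure P]
    (h_arr : IsPoissonProcess arr ((volume : Measure (ℝ × ℝ)).restrict {p | 0 < p.2}) P) :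
    ∀ᵐ ω ∂P, ∀ q ∈ arr ω, 0 < q.2 := by
  have h0 : (volume : Measure (ℝ × ℝ)).restrict {p | 0 < p.2} {p | 0 < p.2}ᶜ = 0 := by
    rw [Measure.restrict_apply measurableSet_snd_pos.compl, compl_inter_self, measure_empty]
  filter_upwards [h_arr.ae_inter_eq_empty measurableSet_snd_pos.compl h0] with ω hω q hq
  by_contra hq0
  exact notMem_empty q (hω ▸ ⟨hq, hq0⟩)

/-- To the right of `1` the intensity is at least `-u₀ 1 > 0`, so every half-line beyond it has
infinite mass and almost surely contains a point. The initial customers are then unbounded, hence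
infinite. -/
theorem ae_infinite_init (hu₀ : IsPeaked u₀ 0 0)
    (h_init : IsPoissonProcess init (initMeasure u₀) P) : ∀ᵐ ω ∂P, (init ω).Infinite := by
  have hc : 0 < -u₀ 1 := by linarith [hu₀.lt 1 one_ne_zero]
  have hne : ∀ n : ℕ, ∀ᵐ ω ∂P, (init ω ∩ Ici ((n : ℝ) + 1)).Nonempty := by
    intro n
    have hbound : ∀ m : ℕ, P {ω | ¬ (init ω ∩ Ici ((n : ℝ) + 1)).Nonempty} ≤
        ENNReal.ofReal (Real.exp (-(-u₀ 1 * m))) := by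
      intro m
      have hfin := (initMeasure_Icc_lt_top hu₀ ((n : ℝ) + 1) (n + 1 + m)).ne
      have hle : ENNReal.ofReal (-u₀ 1 * m) ≤ initMeasure u₀ (Icc ((n : ℝ) + 1) (n + 1 + m)) := by
        rw [initMeasure, withDensity_apply _ measurableSet_Icc]
        calc ENNReal.ofReal (-u₀ 1 * m)
            = ∫⁻ _ in Icc ((n : ℝ) + 1) (n + 1 + m), ENNReal.ofReal (-u₀ 1) := by
              rw [setLIntegral_const, Real.volume_Icc, add_sub_cancel_left,
                ENNReal.ofReal_mul hc.le]
          _ ≤ _ := by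
              refine setLIntegral_mono' measurableSet_Icc fun x hx => ?_
              have hx1 : (1 : ℝ) ≤ x := le_trans (by linarith [n.cast_nonneg (α := ℝ)]) hx.1
              refine ENNReal.ofReal_le_ofReal (neg_le_neg ?_)
              exact hu₀.anti (by simp) (by simp; linarith) hx1
      calc P {ω | ¬ (init ω ∩ Ici ((n : ℝ) + 1)).Nonempty}
          ≤ P {ω | count init (Icc ((n : ℝ) + 1) (n + 1 + m)) ω = 0} := by
            refine measure_mono fun ω hω => count_eq_zero_iff.2 ?_
            exact subset_eq_empty (inter_subset_inter_right _ Icc_subset_Ici_self)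
              (not_nonempty_iff_eq_empty.1 hω)
        _ = expNeg (initMeasure u₀ (Icc ((n : ℝ) + 1) (n + 1 + m))) :=
            h_init.measure_count_eq_zero measurableSet_Icc hfin
        _ ≤ _ := by
            refine ENNReal.ofReal_le_ofReal (Real.exp_le_exp.2 (neg_le_neg ?_))
            exact (ENNReal.ofReal_le_iff_le_toReal hfin).1 hle
    have hlim : Tendsto (fun m : ℕ => ENNReal.ofReal (Real.exp (-(-u₀ 1 * m)))) atTop (𝓝 0) := by
      have h1 : Tendsto (fun m : ℕ => Real.exp (-(-u₀ 1 * m))) atTop (𝓝 0) :=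
        Real.tendsto_exp_neg_atTop_nhds_zero.comp
          (tendsto_natCast_atTop_atTop.const_mul_atTop hc)
      simpa using ENNReal.tendsto_ofReal h1
    exact le_antisymm (ge_of_tendsto' hlim hbound) bot_le
  filter_upwards [ae_all_iff.2 hne] with ω hω hfin
  obtain ⟨b, hb⟩ := hfin.bddAbove
  obtain ⟨n, hn⟩ := exists_nat_ge b
  obtain ⟨x, hx, hxn⟩ := hω n
  have : (n : ℝ) + 1 ≤ x := hxn
  linarith [hb hx]

theorem ae_finite_customers [IsProbabilityMeasure P] (hu₀ : IsPeaked u₀ 0 0)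
    (h_init : IsPoissonProcess init (initMeasure u₀) P)
    (h_arr : IsPoissonProcess arr ((volume : Measure (ℝ × ℝ)).restrict {p | 0 < p.2}) P) :
    ∀ᵐ ω ∂P, ∀ r : ℝ, (customers (init ω) (arr ω) ∩ {q | |q.1| ≤ r ∧ q.2 ≤ r}).Finite := by
  have h1 : ∀ n : ℕ, ∀ᵐ ω ∂P, (init ω ∩ Icc (-(n : ℝ)) n).Finite := fun n =>
    h_init.ae_finite_inter measurableSet_Icc (initMeasure_Icc_lt_top hu₀ _ _).ne
  have h2 : ∀ n : ℕ, ∀ᵐ ω ∂P, (arr ω ∩ Icc (-(n : ℝ)) n ×ˢ Icc (0 : ℝ) n).Finite := fun n => by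
    refine h_arr.ae_finite_inter (measurableSet_Icc.prod measurableSet_Icc) (ne_of_lt ?_)
    refine (Measure.restrict_apply_le _ _).trans_lt ?_
    rw [Measure.volume_eq_prod, Measure.prod_prod]
    exact ENNReal.mul_lt_top measure_Icc_lt_top measure_Icc_lt_top
  filter_upwards [ae_all_iff.2 h1, ae_all_iff.2 h2, ae_arrival_pos h_arr] with ω hω₁ hω₂ hω₃ r
  obtain ⟨n, hn⟩ := exists_nat_ge r
  refine (((hω₁ n).image fun x => (x, (0 : ℝ))).union (hω₂ n)).subset ?_
  rintro q ⟨⟨x, hx, rfl⟩ | hq, hqr⟩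
  · exact Or.inl ⟨x, ⟨hx, abs_le.1 (hqr.1.trans hn)⟩, rfl⟩
  · exact Or.inr ⟨hq, abs_le.1 (hqr.1.trans hn), (hω₃ q hq).le, hqr.2.trans hn⟩

theorem ae_exists_isGreedyServer [IsProbabilityMeasure P] {v : ℝ} (hv : 0 < v) {T : ℕ → Ω → ℝ}
    (hT : ∀ᵐ ω ∂P, ∀ n, 0 ≤ T n ω) (hu₀ : IsPeaked u₀ 0 0)
    (h_init : IsPoissonProcess init (initMeasure u₀) P)
    (h_arr : IsPoissonProcess arr ((volume : Measure (ℝ × ℝ)).restrict {p | 0 < p.2}) P) :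
    ∀ᵐ ω ∂P, ∃ (t : ℕ → ℝ) (c : ℕ → ℝ × ℝ) (𝒮 : ℝ → ℝ),
      IsGreedyServer v (customers (init ω) (arr ω)) (fun n => T n ω) t c 𝒮 := by
  filter_upwards [hT, ae_infinite_init hu₀ h_init, ae_finite_customers hu₀ h_init h_arr]
    with ω hω₁ hω₂ hω₃
  refine exists_isGreedyServer hv hω₁ hω₃ ?_
  have hinj : InjOn (fun x : ℝ => (x, (0 : ℝ))) (init ω) := fun x _ y _ hxy =>
    congrArg Prod.fst hxy
  refine (hω₂.image hinj).mono ?_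
  rintro _ ⟨x, hx, rfl⟩
  exact ⟨Or.inl ⟨x, hx, rfl⟩, le_refl (0 : ℝ)⟩

end AlmostSure

end

end GreedyServer

namespace GreedyServer

noncomputable section

/-! ### The law of the greedy server -/

theorem isPeaked_of_isPotential {u : ℝ → ℝ} (h : IsPotential u) (hu : IsUnimodal u)
    (hc : IsCentered u) : IsPeaked u 0 0 := by
  obtain ⟨x, hx, huniq⟩ := h.unique_max
  have hex : ∃ x, ∀ y, u y ≤ u x := ⟨x, hx⟩
  have hpeak : ∀ y, u y ≤ u (peak u) := Classical.epsilon_spec hex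
  obtain ⟨h1, h2⟩ := hu
  obtain ⟨hc1, hc2⟩ := hc
  rw [height] at hc2
  rw [hc1] at hc2 hpeak h1 h2
  refine ⟨hc2, fun y hy => lt_of_le_of_ne (hc2 ▸ hpeak y) fun hy0 => hy ?_, h1, h2⟩
  have hy' : ∀ z, u z ≤ u y := fun z => by rw [hy0, ← hc2]; exact hpeak z
  rw [huniq y hy', huniq 0 hpeak]

/-- Two random sequences have the same law if their initial segments are the same functions of
random histories with the same law. -/
theorem identDistrib_of_hasLaw {Ω Ω' S H : Type*} [MeasurableSpace Ω] [MeasurableSpace Ω']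
    [MeasurableSpace S] [MeasurableSpace H] {P : Measure Ω} {P' : Measure Ω'}
    [IsProbabilityMeasure P]
    {X : Ω' → ℕ → S} {Y : Ω → ℕ → S} {ξ : ℕ → Ω' → H} {η : ℕ → Ω → H} {ν : ℕ → Measure H}
    {g : ℕ → H → S} (hg : ∀ k, Measurable (g k))
    (hξ : ∀ n, HasLaw (ξ n) (ν n) P') (hη : ∀ n, HasLaw (η n) (ν n) P)
    (hX : ∀ n, ∀ᵐ ω ∂P', ∀ k < n, X ω k = g k (ξ n ω))
    (hY : ∀ n, ∀ᵐ ω ∂P, ∀ k < n, Y ω k = g k (η n ω)) : IdentDistrib X Y P' P := by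
  have hXm : AEMeasurable X P' := by
    refine aemeasurable_pi_iff.2 fun k => ?_
    refine ((hg k).comp_aemeasurable (hξ (k + 1)).aemeasurable).congr ?_
    filter_upwards [hX (k + 1)] with ω hω
    exact (hω k k.lt_succ_self).symm
  have hYm : AEMeasurable Y P := by
    refine aemeasurable_pi_iff.2 fun k => ?_
    refine ((hg k).comp_aemeasurable (hη (k + 1)).aemeasurable).congr ?_
    filter_upwards [hY (k + 1)] with ω hω
    exact (hω k k.lt_succ_self).symm
  refine ⟨hXm, hYm, ?_⟩
  -- Laws on the sequence space are determined by finite sets of coordinates, and each such set is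
  -- covered by one finite history.
  have key : ∀ I : Finset ℕ, P'.map (fun ω => I.restrict (X ω)) =
      P.map (fun ω => I.restrict (Y ω)) := by
    intro I
    obtain ⟨n, hn⟩ : ∃ n, ∀ k ∈ I, k < n := ⟨I.sup id + 1, fun k hk =>
      Nat.lt_succ_of_le (Finset.le_sup (f := id) hk)⟩
    let G : H → I → S := fun σ k => g k σ
    have hG : Measurable G := measurable_pi_lambda _ fun k => hg k
    have e1 : (fun ω => I.restrict (X ω)) =ᵐ[P'] G ∘ ξ n := by
      filter_upwards [hX n] with ω hω
      funext k
      exact hω k (hn k k.2)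
    have e2 : (fun ω => I.restrict (Y ω)) =ᵐ[P] G ∘ η n := by
      filter_upwards [hY n] with ω hω
      funext k
      exact hω k (hn k k.2)
    rw [Measure.map_congr e1, Measure.map_congr e2,
      ← AEMeasurable.map_map_of_aemeasurable hG.aemeasurable (hξ n).aemeasurable,
      ← AEMeasurable.map_map_of_aemeasurable hG.aemeasurable (hη n).aemeasurable,
      (hξ n).map_eq, (hη n).map_eq]
  have l1 := isProjectiveLimit_map hXm
  have l2 := isProjectiveLimit_map hYm
  rw [funext key] at l1
  exact l1.unique l2

end

end GreedyServer

theorem lemma2 {Ω Ω' : Type*} [MeasurableSpace Ω] [MeasurableSpace Ω']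
    (P : Measure Ω) [IsProbabilityMeasure P] (P' : Measure Ω') [IsProbabilityMeasure P']
    -- the speed, the initial potential, and the law of a service time
    (v : ℝ) (hv : 0 < v)
    (u₀ : ℝ → ℝ) (hu₀ : GreedyServer.IsPotential u₀) (hu₀_uni : GreedyServer.IsUnimodal u₀)
    (hu₀_cen : GreedyServer.IsCentered u₀)
    (τ : Measure ℝ) [IsProbabilityMeasure τ] (hτ : ∀ᵐ s ∂τ, 0 ≤ s)
    -- customers waiting at time 0, later arrivals, and service times of the queueing system
    (init : Ω → Set ℝ)
    (h_init : GreedyServer.IsPoissonProcess init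
      (volume.withDensity fun x => ENNReal.ofReal (-u₀ x)) P)
    (arr : Ω → Set (ℝ × ℝ))
    (h_arr : GreedyServer.IsPoissonProcess arr
      ((volume : Measure (ℝ × ℝ)).restrict {p | 0 < p.2}) P)
    (T : ℕ → Ω → ℝ) (hT_meas : ∀ n, Measurable (T n)) (hT_law : ∀ n, HasLaw (T n) τ P)
    (hT_indep : iIndepFun T P)
    (h_indep : iIndep ![GreedyServer.pointSigma init, GreedyServer.pointSigma arr,
      ⨆ n, MeasurableSpace.comap (T n) inferInstance] P)
    -- the i.i.d. triples (service time, standard exponential, uniform), independent coordinates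
    (w : ℕ → Ω' → ℝ × ℝ × ℝ)
    (hw_law : ∀ n, HasLaw (w n)
      (τ.prod ((expMeasure 1).prod (volume.restrict (Icc (0 : ℝ) 1)))) P')
    (hw_indep : iIndepFun w P') :
    -- almost surely the greedy server exists
    (∀ᵐ ω ∂P, ∃ (t : ℕ → ℝ) (c : ℕ → ℝ × ℝ) (𝒮 : ℝ → ℝ),
      GreedyServer.IsGreedyServer v (GreedyServer.customers (init ω) (arr ω))
        (fun n => T n ω) t c 𝒮) ∧
    -- and its service start times and positions have the same law as the sequence of potentials
    ∀ (t : Ω → ℕ → ℝ) (c : Ω → ℕ → ℝ × ℝ) (𝒮 : Ω → ℝ → ℝ),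
      (∀ᵐ ω ∂P, GreedyServer.IsGreedyServer v (GreedyServer.customers (init ω) (arr ω))
        (fun n => T n ω) (t ω) (c ω) (𝒮 ω)) →
      IdentDistrib
        (fun ω' (n : ℕ) =>
          (GreedyServer.height (GreedyServer.potentialSeq v u₀ (fun k => w k ω') (n + 1)),
            GreedyServer.peak (GreedyServer.potentialSeq v u₀ (fun k => w k ω') (n + 1))))
        (fun ω (n : ℕ) => (t ω (n + 1), 𝒮 ω (t ω (n + 1))))
        P' P := by
  have hpk := GreedyServer.isPeaked_of_isPotential hu₀ hu₀_uni hu₀_cen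
  have hT : ∀ᵐ ω ∂P, ∀ n, 0 ≤ T n ω := by
    refine ae_all_iff.2 fun n => ae_of_ae_map (hT_law n).aemeasurable ?_
    rwa [(hT_law n).map_eq]
  refine ⟨GreedyServer.ae_exists_isGreedyServer hv hT hpk h_init h_arr, fun t c 𝒮 hG => ?_⟩
  have hξ := GreedyServer.hasLaw_history hv hpk hτ hw_law hw_indep
  -- Being the law of a random history, `historyLaw` has total mass one; this is what upgrades the
  -- Mecke inequality to an equality.
  have hprob : ∀ n, IsProbabilityMeasure (GreedyServer.historyLaw v u₀ τ n) := fun n =>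
    (hξ n).isProbabilityMeasure_iff.1 inferInstance
  have hη := fun n => GreedyServer.hasLaw_of_path hv hpk hτ h_init h_arr hT_meas hT_law hT_indep
    h_indep n (p := fun ω k => GreedyServer.mark (c ω k)) (by
      filter_upwards [hG, hT, GreedyServer.ae_arrival_pos h_arr] with ω hω₁ hω₂ hω₃
      exact hω₁.isPath hv hω₂ hω₃ n)
  refine GreedyServer.identDistrib_of_hasLaw
    (g := fun k σ => (GreedyServer.time v σ (k + 1), GreedyServer.pos σ (k + 1)))
    (fun k => (GreedyServer.measurable_time (k + 1)).prodMk (GreedyServer.measurable_pos (k + 1)))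
    hξ hη (fun n => ?_) fun n => ?_
  · filter_upwards [GreedyServer.ae_triple hτ hw_law] with ω hω k hk
    obtain ⟨h1, h2⟩ := GreedyServer.history_good_and_potentialSeq_eq hv hpk hω (k + 1)
    have h3 := GreedyServer.isPeaked_pot hv hpk h1
    -- Coordinate `k` needs the history up to `k + 1` only, and longer histories extend it.
    have h4 := GreedyServer.history_agree (v := v) (u₀ := u₀) (fun k => w k ω)
      (Nat.succ_le_of_lt hk)
    rw [h2, h3.height_eq, h3.peak_eq, GreedyServer.time_congr h4, GreedyServer.pos_congr h4]
  · filter_upwards [hG] with ω hω k hk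
    obtain ⟨h1, h2⟩ := hω.time_pos_eq hv (k + 1)
      (σ := GreedyServer.toHist fun k : Fin n => (T k ω, GreedyServer.mark (c ω k)))
      fun j hj => GreedyServer.toHist_apply _ ⟨j, by lia⟩
    rw [h1, h2]
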